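/- Let $k$ be a field. Dg categories are small, over $k$, with cohomological grading. The category of dg categories carries Tabuada's model structure: weak equivalences are the quasi-equivalences; a dg functor $F\colon A\to B$ is a fibration if it is surjective on morphisms in every degree and every isomorphism $v\colon F(x)\to y'$ of $H^0(B)$ equals $H^0(F)(u)$ for some isomorphism $u\colon x\to y$ of $H^0(A)$; cofibrations are the dg functors with the left lifting property with respect to all acyclic fibrations; $A$ is cofibrant if $\varnothing\to A$ is a cofibration. The generating cofibrations are $\varnothing\to\underline{k}$ (one object with endomorphisms $k$) and $s(n)\colon C(n)\to P(n)$, $n\in\mathbb{Z}$, where $C(n)$ has two objects $a,b$, $C(n)(a,a)=C(n)(b,b)=k$, $C(n)(b,a)=0$, $C(n)(a,b)=k$ in degree $1-n$, and $P(n)$ is obtained by replacing $C(n)(a,b)$ by the complex $k\xrightarrow{\mathrm{id}}k$ in degrees $-n,1-n$. An $I$-cell complex is a dg category $A$ together with a presentation of $\varnothing\to A$ as a transfinite composition, indexed by a small well-ordered set, of pushouts of coproducts of generating cofibrations; its free generators are the images in $A$ of the degree $-n$ generators of $P(n)(a,b)$, one for each cell attached along some $s(n)$. For dg categories $C,D$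 the twisted tensor product $C\overset{\sim}{\otimes}D$ is the dg category with objects $\mathrm{Ob}(C)\times\mathrm{Ob}(D)$ generated by the morphisms $f\otimes\mathrm{id}_y$ ($f$ in $C$, $y\in\mathrm{Ob}(D)$), $\mathrm{id}_x\otimes g$ ($x\in\mathrm{Ob}(C)$, $g$ in $D$) and $$\varepsilon(f;g_1,\dots,g_n)\colon (c_0,d_0)\to(c_1,d_n),\qquad \deg\varepsilon(f;g_1,\dots,g_n)=|f|+\sum_j|g_j|-n,$$ for $n\ge1$ and homogeneous $c_0\xrightarrow{f}c_1$ in $C$ and $d_0\xrightarrow{g_1}d_1\to\cdots\xrightarrow{g_n}d_n$ in $D$, subject to the following relations, in which $\varepsilon(f;\,)$ at the object $y$ means $f\otimes\mathrm{id}_y$: 1. $f\mapsto f\otimes\mathrm{id}_y$ and $g\mapsto\mathrm{id}_x\otimes g$ are dg functors $C\to C\overset{\sim}{\otimes}D$ and $D\to C\overset{\sim}{\otimes}D$; 2. $\varepsilon(f;g_1,\dots,g_n)$ is $k$-linear in each argument, and for $n\ge1$ it vanishes if $f$ or some $g_i$ is an identity morphism; 3. $\displaystyle \varepsilon(f_2f_1;g_1,\dots,g_N)=\sum_{m=0}^{N}(-1)^{|f_1|(|g_{m+1}|+\cdots+|g_N|+N-m)}\,\varepsilon(f_2;g_{m+1},\dots,g_N)\,\varepsilon(f_1;g_1,\dots,g_m)$;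 4. for $n\ge1$, $$\begin{aligned}\varepsilon(df;g_1,\dots,g_n)={}&d\,\varepsilon(f;g_1,\dots,g_n)+\sum_{j=1}^n(-1)^{|f|+\sum_{i>j}(|g_i|+1)}\varepsilon(f;g_1,\dots,dg_j,\dots,g_n)\\&+(-1)^{|f||g_n|+|f|}(\mathrm{id}_{c_1}\otimes g_n)\,\varepsilon(f;g_1,\dots,g_{n-1})\\&+(-1)^{|f|+\sum_{i\ge2}(|g_i|+1)+1}\varepsilon(f;g_2,\dots,g_n)\,(\mathrm{id}_{c_0}\otimes g_1)\\&+\sum_{i=1}^{n-1}(-1)^{|f|+\sum_{j>i}(|g_j|+1)}\varepsilon(f;g_1,\dots,g_{i+1}g_i,\dots,g_n).\end{aligned}$$ Then: (a) If $C$ and $D$ are cofibrant, then $C\overset{\sim}{\otimes}D$ is cofibrant. (b) If $C$ and $D$ are $I$-cell complexes with free generators $\{f_i\}_{i\in I}$ and $\{g_j\}_{j\in J}$, then $C\overset{\sim}{\otimes}D$ has the structure of an $I$-cell complex whose free generators are, without repetition, the morphisms $$\{f_i\otimes\mathrm{id}_y\}_{i\in I,\;y\in\mathrm{Ob}(D)}\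 \sqcup\ \{\mathrm{id}_x\otimes g_j\}_{x\in\mathrm{Ob}(C),\;j\in J}\ \sqcup\ \{\varepsilon(f_i;s_1,\dots,s_n)\}_{i\in I,\;n\ge1},$$ where $(s_1,\dots,s_n)$ runs over all sequences of composable nonempty words (monomials) in the generators $g_j$. -/

import Mathlib

open CategoryTheory

universe u

/-- A small dg category over `k`, cohomologically graded: `Hom x y n` is the degree `n` part of the
complex of morphisms `x ⟶ y`, and `comp h g f` is the composite `g ∘ f`. The equality `j + i = n`
in `comp` (and `n + 1 = m` in `d`) only serves to avoid casts between equal degrees. -/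
structure DGCat (k : Type u) [Field k] : Type (u + 1) where
  Obj : Type u
  Hom : Obj → Obj → ℤ → Type u
  [addCommGroup : ∀ x y n, AddCommGroup (Hom x y n)]
  [module : ∀ x y n, Module k (Hom x y n)]
  d : ∀ {x y : Obj} (n m : ℤ), n + 1 = m → (Hom x y n →ₗ[k] Hom x y m)
  one : ∀ x : Obj, Hom x x 0
  comp : ∀ {x y z : Obj} {j i n : ℤ}, j + i = n →
    (Hom y z j →ₗ[k] Hom x y i →ₗ[k] Hom x z n)
  d_d : ∀ {x y : Obj} (n m l : ℤ) (h : n + 1 = m) (h' : m + 1 = l) (f : Hom x y n),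
    d m l h' (d n m h f) = 0
  one_comp : ∀ {x y : Obj} {n : ℤ} (h : 0 + n = n) (f : Hom x y n), comp h (one y) f = f
  comp_one : ∀ {x y : Obj} {n : ℤ} (h : n + 0 = n) (f : Hom x y n), comp h f (one x) = f
  assoc : ∀ {x y z w : Obj} {p q r pq qr n : ℤ} (h₁ : p + q = pq) (h₂ : pq + r = n)
    (h₃ : q + r = qr) (h₄ : p + qr = n) (a : Hom z w p) (b : Hom y z q) (c : Hom x y r),
    comp h₂ (comp h₁ a b) c = comp h₄ a (comp h₃ b c)
  leibniz : ∀ {x y z : Obj} {j i n j' i' n' : ℤ} (h : j + i = n) (hn : n + 1 = n')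
    (hj : j + 1 = j') (hi : i + 1 = i') (h₁ : j' + i = n') (h₂ : j + i' = n')
    (g : Hom y z j) (f : Hom x y i),
    d n n' hn (comp h g f) =
      comp h₁ (d j j' hj g) f + j.negOnePow • comp h₂ g (d i i' hi f)

attribute [instance] DGCat.addCommGroup DGCat.module

/-- A dg functor. -/
@[ext]
structure DGFunctor {k : Type u} [Field k] (A B : DGCat.{u} k) : Type u where
  obj : A.Obj → B.Obj
  map : ∀ {x y : A.Obj} {n : ℤ}, A.Hom x y n →ₗ[k] B.Hom (obj x) (obj y) n
  map_d : ∀ {x y : A.Obj} (n m : ℤ) (h : n + 1 = m) (f : A.Hom x y n),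
    map (A.d n m h f) = B.d n m h (map f)
  map_one : ∀ x : A.Obj, map (A.one x) = B.one (obj x)
  map_comp : ∀ {x y z : A.Obj} {j i n : ℤ} (h : j + i = n) (g : A.Hom y z j) (f : A.Hom x y i),
    map (A.comp h g f) = B.comp h (map g) (map f)

/-- The category of small dg categories and dg functors. -/
instance DGCat.category (k : Type u) [Field k] : Category.{u} (DGCat.{u} k) where
  Hom A B := DGFunctor A B
  id A :=
    { obj := fun x => x
      map := LinearMap.id
      map_d := fun _ _ _ _ => rfl
      map_one := fun _ => rfl
      map_comp := fun _ _ _ => rfl }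
  comp F G :=
    { obj := fun x => G.obj (F.obj x)
      map := G.map.comp F.map
      map_d := fun n m h f => by simp [F.map_d, G.map_d]
      map_one := fun x => by simp [F.map_one, G.map_one]
      map_comp := fun h g f => by simp [F.map_comp, G.map_comp] }

section Model

variable {k : Type u} [Field k]

/-- `v` is a closed morphism of degree `0` whose class is an isomorphism in `H⁰(A)`. -/
def DGCat.IsHomotopyEquiv (A : DGCat.{u} k) {x y : A.Obj} (v : A.Hom x y 0) : Prop :=
  A.d 0 1 (by norm_num) v = 0 ∧
  ∃ w : A.Hom y x 0, A.d 0 1 (by norm_num) w = 0 ∧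
    (∃ h : A.Hom x x (-1), A.comp (add_zero 0) w v - A.one x = A.d (-1) 0 (by norm_num) h) ∧
    (∃ h : A.Hom y y (-1), A.comp (add_zero 0) v w - A.one y = A.d (-1) 0 (by norm_num) h)

/-- Quasi-equivalences: (a) every map `A(x, y) ⟶ B(F x, F y)` is a quasi-isomorphism, i.e. it is
surjective and injective on each cohomology `Hⁿ`; (b) `H⁰(F)` is an equivalence, which in presence
of (a) (`H⁰(F)` is fully faithful) means that `H⁰(F)` is essentially surjective. -/
structure DGFunctor.IsQuasiEquiv {A B : DGCat.{u} k} (F : DGFunctor A B) : Prop where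
  surj : ∀ (x y : A.Obj) (l n m : ℤ) (hl : l + 1 = n) (hm : n + 1 = m)
    (b : B.Hom (F.obj x) (F.obj y) n), B.d n m hm b = 0 →
    ∃ a : A.Hom x y n, A.d n m hm a = 0 ∧
      ∃ e : B.Hom (F.obj x) (F.obj y) l, F.map a - b = B.d l n hl e
  inj : ∀ (x y : A.Obj) (l n m : ℤ) (hl : l + 1 = n) (hm : n + 1 = m)
    (a : A.Hom x y n), A.d n m hm a = 0 →
    (∃ e : B.Hom (F.obj x) (F.obj y) l, F.map a = B.d l n hl e) →
    ∃ e : A.Hom x y l, a = A.d l n hl e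
  essSurj : ∀ y : B.Obj, ∃ (x : A.Obj) (v : B.Hom (F.obj x) y 0), B.IsHomotopyEquiv v

/-- Fibrations: (F1) surjectivity on morphisms in every degree; (F2) every isomorphism
`F x ⟶ y'` of `H⁰(B)` is the image of an isomorphism `x ⟶ y` of `H⁰(A)`. -/
structure DGFunctor.IsFibration {A B : DGCat.{u} k} (F : DGFunctor A B) : Prop where
  surj : ∀ (x y : A.Obj) (n : ℤ),
    Function.Surjective (fun a : A.Hom x y n => (F.map a : B.Hom (F.obj x) (F.obj y) n))
  lift_iso : ∀ (x : A.Obj) (y' : B.Obj) (v : B.Hom (F.obj x) y' 0), B.IsHomotopyEquiv v →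
    ∃ (y : A.Obj) (hy : F.obj y = y') (a : A.Hom x y 0), A.IsHomotopyEquiv a ∧
      ∃ e : B.Hom (F.obj x) y' (-1), (hy ▸ F.map a) - v = B.d (-1) 0 (by norm_num) e

variable (k) in
/-- The acyclic fibrations of the Tabuada model structure. -/
def DGCat.acyclicFibrations : MorphismProperty (DGCat.{u} k) :=
  fun _ _ F => DGFunctor.IsFibration F ∧ DGFunctor.IsQuasiEquiv F

variable (k) in
/-- The cofibrations of the Tabuada model structure. -/
def DGCat.cofibrations : MorphismProperty (DGCat.{u} k) :=
  (DGCat.acyclicFibrations k).llp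

variable (k) in
/-- The dg category with no objects. -/
def DGCat.empty : DGCat.{u} k where
  Obj := PEmpty
  Hom _ _ _ := PUnit
  d _ _ _ := 0
  one _ := PUnit.unit
  comp _ := 0
  d_d _ _ _ _ _ _ := rfl
  one_comp _ _ := rfl
  comp_one _ _ := rfl
  assoc _ _ _ _ _ _ _ := rfl
  leibniz _ _ _ _ _ _ _ _ := rfl

/-- The unique dg functor `∅ ⟶ A`. -/
def DGCat.emptyTo (A : DGCat.{u} k) : DGCat.empty k ⟶ A :=
  DGFunctor.mk (A := DGCat.empty k) (B := A) (fun x => PEmpty.elim x) (fun {x} => PEmpty.elim x)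
    (fun {x} => PEmpty.elim x) (fun x => PEmpty.elim x) (fun {x} => PEmpty.elim x)

/-- `A` is cofibrant for the Tabuada model structure. -/
def DGCat.IsCofibrant (A : DGCat.{u} k) : Prop := DGCat.cofibrations k A.emptyTo

end Model

section Cells

variable (k : Type u) [Field k]

/-- The degree `n` morphisms `x ⟶ y` of the dg category `DGCat.thin`: the line `k` if `S x y n`
holds, and `0` otherwise. -/
def DGCat.thinHom {O : Type u} (S : O → O → ℤ → Prop) (x y : O) (n : ℤ) : Submodule k k where
  carrier := {a | ¬ S x y n → a = 0}
  add_mem' := fun ha hb h => by rw [ha h, hb h, add_zero]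
  zero_mem' := fun _ => rfl
  smul_mem' := fun c a ha h => by rw [ha h, smul_zero]

variable {k} in
theorem DGCat.thinHom_zero {O : Type u} {S : O → O → ℤ → Prop} {x y : O} {n : ℤ}
    (h : ¬ S x y n) (a : DGCat.thinHom k S x y n) : (a : k) = 0 := a.2 h

open Classical in
/-- The dg category with set of objects `O`, whose morphisms are lines `k` (with composition the
multiplication of `k`) in the places given by `S` and zero elsewhere, and whose differential is the
identity of `k` from the places given by `δ` and zero elsewhere. -/
noncomputable def DGCat.thin (O : Type u) (S δ : O → O → ℤ → Prop)
    (h1 : ∀ x, S x x 0)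
    (hc : ∀ x y z i j, S x y i → S y z j → S x z (j + i))
    (hδ : ∀ x y n, δ x y n → S x y n ∧ S x y (n + 1) ∧ ¬ δ x y (n + 1))
    (hl : ∀ x y z i j, S x y i → S y z j →
      (δ x z (j + i) ↔ δ y z j ∨ (δ x y i ∧ j = 0)) ∧ ¬ (δ y z j ∧ δ x y i) ∧
        (δ x y i → j = 0)) :
    DGCat.{u} k where
  Obj := O
  Hom x y n := DGCat.thinHom k S x y n
  d {x y} n m h :=
    { toFun := fun a => ⟨if δ x y n then (a : k) else 0, fun hs => by
        subst h
        rw [if_neg (fun hd => hs (hδ x y n hd).2.1)]⟩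
      map_add' := fun a b => by
        ext
        by_cases hd : δ x y n <;> simp [hd]
      map_smul' := fun c a => by
        ext
        by_cases hd : δ x y n <;> simp [hd] }
  one x := ⟨1, fun h => absurd (h1 x) h⟩
  comp {x y z j i n} h :=
    LinearMap.mk₂ k (fun g f => ⟨(g : k) * (f : k), fun hs => by
        subst h
        by_cases hg : S y z j
        · by_cases hf : S x y i
          · exact absurd (hc x y z i j hf hg) hs
          · rw [DGCat.thinHom_zero hf f, mul_zero]
        · rw [DGCat.thinHom_zero hg g, zero_mul]⟩)
      (fun _ _ _ => by ext; simp [add_mul])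
      (fun _ _ _ => by ext; simp [mul_assoc])
      (fun _ _ _ => by ext; simp [mul_add])
      (fun _ _ _ => by ext; simp [mul_left_comm])
  d_d {x y} n m l h h' f := by
    subst h
    ext
    by_cases hd : δ x y n
    · simp [(hδ x y n hd).2.2]
    · simp [hd]
  one_comp _ _ := by ext; simp
  comp_one _ _ := by ext; simp
  assoc _ _ _ _ _ _ _ := by ext; simp [mul_assoc]
  leibniz {x y z j i n j' i' n'} h hn hj hi e₁ e₂ g f := by
    subst h
    ext
    by_cases hg : S y z j
    · by_cases hf : S x y i
      · obtain ⟨H1, H2, H3⟩ := hl x y z i j hf hg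
        by_cases a : δ y z j
        · have b : ¬ δ x y i := fun b => H2 ⟨a, b⟩
          simp [H1, a, b]
        · by_cases b : δ x y i
          · have hj0 := H3 b
            subst hj0
            have c : δ x z i := by
              have := H1.2 (Or.inr ⟨b, rfl⟩)
              rwa [zero_add] at this
            simp [a, b, c]
          · simp [H1, a, b]
      · simp [DGCat.thinHom_zero hf f]
    · simp [DGCat.thinHom_zero hg g]

/-- The two objects `a`, `b` of the dg categories `C(n)` and `P(n)`. -/
inductive TwoObj : Type u
  | a
  | b

/-- The dg category with a single object whose complex of endomorphisms is `k`. -/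
noncomputable def DGCat.unit : DGCat.{u} k :=
  DGCat.thin k PUnit (fun _ _ n => n = 0) (fun _ _ _ => False) (fun _ => rfl)
    (by intro _ _ _ i j hi hj; omega) (by simp) (by simp)

/-- The places of `C(n)` where there is a morphism: the identities, and a morphism `a ⟶ b` of
degree `1 - n`, so that `C(n)(a, b) = k[n - 1]`. -/
def DGCat.sphereSupport (n : ℤ) : TwoObj.{u} → TwoObj.{u} → ℤ → Prop
  | .a, .a, m => m = 0
  | .b, .b, m => m = 0
  | .a, .b, m => m = -n + 1
  | .b, .a, _ => False

/-- The places of `P(n)` where there is a morphism: the identities, and morphisms `a ⟶ b` of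
degrees `-n` and `1 - n`. -/
def DGCat.diskSupport (n : ℤ) : TwoObj.{u} → TwoObj.{u} → ℤ → Prop
  | .a, .a, m => m = 0
  | .b, .b, m => m = 0
  | .a, .b, m => m = -n ∨ m = -n + 1
  | .b, .a, _ => False

/-- The differential of `P(n)` is the identity of `k` on `P(n)(a, b)` in degree `-n`. -/
def DGCat.diskDiff (n : ℤ) : TwoObj.{u} → TwoObj.{u} → ℤ → Prop
  | .a, .b, m => m = -n
  | _, _, _ => False

/-- The dg category `C(n)`. -/
noncomputable def DGCat.sphere (n : ℤ) : DGCat.{u} k :=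
  DGCat.thin k TwoObj (DGCat.sphereSupport n) (fun _ _ _ => False)
    (by rintro (_ | _) <;> rfl)
    (by
      rintro (_ | _) (_ | _) (_ | _) i j hi hj <;>
        simp only [DGCat.sphereSupport] at hi hj ⊢ <;> omega)
    (by simp) (by simp)

/-- The dg category `P(n)`; `P(n)(a, b)` is the complex `k → k` in degrees `-n`, `1 - n`. -/
noncomputable def DGCat.disk (n : ℤ) : DGCat.{u} k :=
  DGCat.thin k TwoObj (DGCat.diskSupport n) (DGCat.diskDiff n)
    (by rintro (_ | _) <;> rfl)
    (by
      rintro (_ | _) (_ | _) (_ | _) i j hi hj <;>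
        simp only [DGCat.diskSupport] at hi hj ⊢ <;> omega)
    (by
      rintro (_ | _) (_ | _) m hm <;>
        simp only [DGCat.diskSupport, DGCat.diskDiff] at hm ⊢ <;> omega)
    (by
      rintro (_ | _) (_ | _) (_ | _) i j hi hj <;>
        simp [DGCat.diskSupport, DGCat.diskDiff] at hi hj ⊢ <;> omega)

/-- The dg functor `s(n) : C(n) ⟶ P(n)`, the identity on objects, which embeds `k[n - 1]` as the
degree `1 - n` summand. -/
noncomputable def DGCat.sphereToDisk (n : ℤ) : DGCat.sphere.{u} k n ⟶ DGCat.disk.{u} k n :=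
  DGFunctor.mk (A := DGCat.sphere.{u} k n) (B := DGCat.disk.{u} k n) (fun x => x)
    (fun {x y m} => Submodule.inclusion (p := DGCat.thinHom k (DGCat.sphereSupport n) x y m)
      (p' := DGCat.thinHom k (DGCat.diskSupport n) x y m) (by
        intro a ha hs
        refine ha (fun h => hs ?_)
        rcases x with _ | _ <;> rcases y with _ | _ <;>
          simp only [DGCat.sphereSupport, DGCat.diskSupport] at h ⊢ <;> omega))
    (by
      intro x y m l h f
      classical
      refine Subtype.ext ?_
      change (@ite k False (Classical.propDecidable False) f.1 0) =
        if DGCat.diskDiff n x y m then (f.1 : k) else 0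
      by_cases hd : DGCat.diskDiff n x y m
      · have hf : (f.1 : k) = 0 := f.2 (by
          rcases x with _ | _ <;> rcases y with _ | _ <;>
            simp only [DGCat.sphereSupport, DGCat.diskDiff] at hd ⊢ <;> omega)
        rw [hf, ite_self, ite_self]
      · rw [if_neg hd, if_neg not_false])
    (fun _ => rfl)
    (fun _ _ _ => rfl)

/-- Labels of the generating cofibrations `α : ∅ ⟶ k` and `s(n) : C(n) ⟶ P(n)`, `n ∈ ℤ`. -/
inductive CellKind : Type
  | obj
  | mor (n : ℤ)

/-- The source of a generating cofibration. -/
noncomputable def CellKind.source : CellKind → DGCat.{u} k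
  | .obj => DGCat.empty k
  | .mor n => DGCat.sphere k n

/-- The target of a generating cofibration. -/
noncomputable def CellKind.target : CellKind → DGCat.{u} k
  | .obj => DGCat.unit k
  | .mor n => DGCat.disk k n

/-- The generating cofibrations of the Tabuada model structure. -/
noncomputable def generatingCofibration :
    (i : CellKind) → (CellKind.source.{u} k i ⟶ CellKind.target.{u} k i)
  | .obj => DGCat.emptyTo (DGCat.unit k)
  | .mor n => DGCat.sphereToDisk k n

end Cells

section ICell

variable {k : Type u} [Field k]

/-- The structure of an `I`-cell complex on `A`: a presentation of `∅ ⟶ A` as a transfinite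
composition (indexed by a small well-ordered set `J`) of dg functors, each of which attaches a set
of cells along generating cofibrations. -/
structure ICellComplex (A : DGCat.{u} k) : Type (u + 1) where
  J : Type u
  [linearOrder : LinearOrder J]
  [orderBot : OrderBot J]
  [succOrder : SuccOrder J]
  [wellFoundedLT : WellFoundedLT J]
  complex : HomotopicalAlgebra.RelativeCellComplex.{u}
    (fun _ : J => generatingCofibration.{u} k) A.emptyTo

attribute [instance] ICellComplex.linearOrder ICellComplex.orderBot ICellComplex.succOrder
  ICellComplex.wellFoundedLT

/-- A homogeneous morphism of a dg category, together with its source, target and degree. -/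
structure DGCat.Mor (A : DGCat.{u} k) : Type u where
  src : A.Obj
  tgt : A.Obj
  deg : ℤ
  hom : A.Hom src tgt deg

/-- The generator of degree `-n` of `P(n)(a, b)`. -/
noncomputable def DGCat.diskTop (k : Type u) [Field k] (n : ℤ) :
    (DGCat.disk.{u} k n).Hom TwoObj.a TwoObj.b (-n) :=
  ⟨1, fun h => absurd (Or.inl rfl) h⟩

/-- The morphism of `A` which is the image of the generator of degree `-n` of `P(n)(a, b)` under
a dg functor `P(n) ⟶ A`; there is none for a cell of the kind `α`. -/
noncomputable def CellKind.generator {A : DGCat.{u} k} :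
    (i : CellKind) → (CellKind.target.{u} k i ⟶ A) → Option A.Mor
  | .obj, _ => none
  | .mor n, F => some
      ⟨DGFunctor.obj (A := DGCat.disk k n) F TwoObj.a, DGFunctor.obj (A := DGCat.disk k n) F TwoObj.b,
        -n, DGFunctor.map (A := DGCat.disk k n) F (DGCat.diskTop k n)⟩

namespace ICellComplex

variable {A : DGCat.{u} k} (c : ICellComplex A)

/-- The index set of the free generating morphisms of an `I`-cell complex: its cells attached
along the `s(n)`. -/
def Gen : Type u :=
  {γ : c.complex.Cells // (CellKind.generator γ.i γ.ι).isSome}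

/-- The free generating morphisms of an `I`-cell complex. -/
noncomputable def gen (γ : c.Gen) : A.Mor :=
  (CellKind.generator γ.1.i γ.1.ι).get γ.2

/-- Nonempty composable words in the free generators, first letter applied first. -/
inductive Word : A.Obj → A.Obj → Type u
  | single (γ : c.Gen) : Word (c.gen γ).src (c.gen γ).tgt
  | cons {z : A.Obj} (γ : c.Gen) (w : Word (c.gen γ).tgt z) : Word (c.gen γ).src z

/-- The degree of a word. -/
noncomputable def Word.deg {c : ICellComplex A} : {x y : A.Obj} → c.Word x y → ℤ
  | _, _, .single γ => (c.gen γ).deg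
  | _, _, .cons γ w => w.deg + (c.gen γ).deg

/-- The monomial given by a word: the composite of its letters. -/
noncomputable def Word.val {c : ICellComplex A} :
    {x y : A.Obj} → (w : c.Word x y) → A.Hom x y w.deg
  | _, _, .single γ => (c.gen γ).hom
  | _, _, .cons γ w => A.comp rfl w.val (c.gen γ).hom

/-- Nonempty sequences `(s₁, …, sₙ)` of composable nonempty words. -/
inductive WordSeq : A.Obj → A.Obj → Type u
  | single {x y : A.Obj} (w : c.Word x y) : WordSeq x y
  | cons {x y z : A.Obj} (w : c.Word x y) (s : WordSeq y z) : WordSeq x z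

end ICellComplex

end ICell

section Twisted

variable {k : Type u} [Field k]

/-- Chains `y₀ ⟶ y₁ ⟶ ⋯ ⟶ yₙ` (`n ≥ 0`) of composable homogeneous morphisms; `cons g s` is the
chain with first morphism `g`, followed by `s`. -/
inductive Chain (D : DGCat.{u} k) : D.Obj → D.Obj → Type u
  | nil (y : D.Obj) : Chain D y y
  | cons {x y z : D.Obj} {m : ℤ} (g : D.Hom x y m) (s : Chain D y z) : Chain D x z

namespace Chain

variable {D : DGCat.{u} k}

/-- The shifted degree `|g₁| + ⋯ + |gₙ| - n` of a chain. -/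
def deg : {x y : D.Obj} → Chain D x y → ℤ
  | _, _, nil _ => 0
  | _, _, cons (m := m) _ s => (m - 1) + s.deg

/-- Concatenation of chains. -/
def append : {x y z : D.Obj} → Chain D x y → Chain D y z → Chain D x z
  | _, _, _, nil _, t => t
  | _, _, _, cons g s, t => cons g (s.append t)

/-- A chain `a` followed by the morphism `g`. -/
def snoc {x y z : D.Obj} {m : ℤ} (a : Chain D x y) (g : D.Hom y z m) : Chain D x z :=
  a.append (cons g (nil z))

@[simp] theorem deg_nil (y : D.Obj) : (nil y : Chain D y y).deg = 0 := rfl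

@[simp] theorem deg_cons {x y z : D.Obj} {m : ℤ} (g : D.Hom x y m) (s : Chain D y z) :
    (cons g s).deg = (m - 1) + s.deg := rfl

@[simp] theorem deg_append : {x y z : D.Obj} → (s : Chain D x y) → (t : Chain D y z) →
    (s.append t).deg = s.deg + t.deg
  | _, _, _, nil _, t => by simp [append]
  | _, _, _, cons g s, t => by simp [append, deg_append s t, add_assoc]

@[simp] theorem deg_snoc {x y z : D.Obj} {m : ℤ} (a : Chain D x y) (g : D.Hom y z m) :
    (a.snoc g).deg = a.deg + (m - 1) := by simp [snoc]

end Chain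

/-- The chain `(s₁, …, sₙ)` of monomials given by a sequence of words. -/
noncomputable def ICellComplex.WordSeq.toChain {D : DGCat.{u} k} {c : ICellComplex D} :
    {x y : D.Obj} → c.WordSeq x y → Chain D x y
  | _, _, .single w => .cons w.val (.nil _)
  | _, _, .cons w s => .cons w.val s.toChain

/-- Interpretations, in a dg category `E`, of the symbols `id_c ⊗ g` (`right c g`) and
`ε(f; g₁, …, gₙ)` (`eps f s n h`, where `h` says that `n` is the degree of the symbol).
For the empty chain at an object `y`, the symbol `ε(f; )` is `f ⊗ id_y`. -/
structure TwistedPreData (C D E : DGCat.{u} k) : Type u where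
  obj : C.Obj × D.Obj → E.Obj
  right : ∀ (c : C.Obj) {y y' : D.Obj} {n : ℤ}, D.Hom y y' n → E.Hom (obj (c, y)) (obj (c, y')) n
  eps : ∀ {c c' : C.Obj} {p : ℤ} {y y' : D.Obj} (f : C.Hom c c' p) (s : Chain D y y') (n : ℤ),
    p + s.deg = n → E.Hom (obj (c, y)) (obj (c', y')) n

namespace TwistedPreData

variable {C D E : DGCat.{u} k} (T : TwistedPreData C D E)

/-- The sum of `(-1)^{|f₁| (|g_{m+1}| + ⋯ + |g_N| + N - m)} ε(f₂; g_{m+1}, …) ∘ ε(f₁; g₁, …, g_m)`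
over all ways to cut a chain `g₁, …, g_N` in two. The chain is `a` followed by `b`, and the sum is
over the cuts not inside `a`, so that all cuts occur for `a` empty. -/
def splitSum {c c' c'' : C.Obj} {p₂ p₁ : ℤ} (f₂ : C.Hom c' c'' p₂) (f₁ : C.Hom c c' p₁) :
    {x y z : D.Obj} → (a : Chain D x y) → (b : Chain D y z) → (n : ℤ) →
      (p₂ + p₁) + (a.deg + b.deg) = n → E.Hom (T.obj (c, x)) (T.obj (c'', z)) n
  | _, y, _, a, .nil _, n, h =>
      E.comp (by simp only [Chain.deg_nil] at *; omega)
        (T.eps f₂ (.nil y) _ rfl) (T.eps f₁ a _ rfl)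
  | _, _, _, a, .cons (m := m) g b, n, h =>
      (p₁ * ((m - 1) + b.deg)).negOnePow •
        E.comp (by simp only [Chain.deg_cons] at *; omega)
          (T.eps f₂ (.cons g b) _ rfl) (T.eps f₁ a _ rfl) +
      splitSum f₂ f₁ (a.snoc g) b n (by simp only [Chain.deg_cons, Chain.deg_snoc] at *; omega)

/-- The sum over `j` of `(-1)^{|f| + ∑_{i > j} (|g_i| + 1)} ε(f; g₁, …, d g_j, …, g_n)`,
where `g_j` runs over the members of `b`, for the chain `a` followed by `b`. -/
def diffSum {c c' : C.Obj} {p : ℤ} (f : C.Hom c c' p) :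
    {x y z : D.Obj} → (a : Chain D x y) → (b : Chain D y z) → (n : ℤ) →
      p + (a.deg + b.deg) + 1 = n → E.Hom (T.obj (c, x)) (T.obj (c', z)) n
  | _, _, _, _, .nil _, _, _ => 0
  | _, _, _, a, .cons (m := m) g b, n, h =>
      (p + b.deg).negOnePow • T.eps f (a.append (.cons (D.d m (m + 1) rfl g) b)) n
        (by simp only [Chain.deg_cons, Chain.deg_append] at *; omega) +
      diffSum f (a.snoc g) b n (by simp only [Chain.deg_cons, Chain.deg_snoc] at *; omega)

/-- The sum over `i` of `(-1)^{|f| + ∑_{j > i} (|g_j| + 1)} ε(f; g₁, …, g_{i+1} ∘ g_i, …, g_n)`,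
where `g_i` runs over `g` and the members of `b` except the last one, for the chain `a`
followed by `g` and `b`. -/
def mulSum {c c' : C.Obj} {p : ℤ} (f : C.Hom c c' p) :
    {x y z w : D.Obj} → {m : ℤ} → (a : Chain D x y) → (g : D.Hom y z m) → (b : Chain D z w) →
      (n : ℤ) → p + (a.deg + ((m - 1) + b.deg)) + 1 = n →
      E.Hom (T.obj (c, x)) (T.obj (c', w)) n
  | _, _, _, _, _, _, _, .nil _, _, _ => 0
  | _, _, _, _, _, a, g, .cons (m := m') g' b, n, h =>
      (p + ((m' - 1) + b.deg)).negOnePow • T.eps f (a.append (.cons (D.comp rfl g' g) b)) n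
        (by simp only [Chain.deg_cons, Chain.deg_append] at *; omega) +
      mulSum f (a.snoc g) g' b n (by simp only [Chain.deg_cons, Chain.deg_snoc] at *; omega)

/-- The term `(-1)^{|f| |g_n| + |f|} (id ⊗ g_n) ∘ ε(f; g₁, …, g_{n-1})`, for the chain `a` followed
by `g` and `b`. -/
def lastTerm {c c' : C.Obj} {p : ℤ} (f : C.Hom c c' p) :
    {x y z w : D.Obj} → {m : ℤ} → (a : Chain D x y) → (g : D.Hom y z m) → (b : Chain D z w) →
      (n : ℤ) → p + (a.deg + ((m - 1) + b.deg)) + 1 = n →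
      E.Hom (T.obj (c, x)) (T.obj (c', w)) n
  | _, _, _, _, m, a, g, .nil _, n, h =>
      (p * m + p).negOnePow •
        E.comp (by simp only [Chain.deg_nil] at *; omega) (T.right c' g) (T.eps f a _ rfl)
  | _, _, _, _, _, a, g, .cons g' b, n, h =>
      lastTerm f (a.snoc g) g' b n (by simp only [Chain.deg_cons, Chain.deg_snoc] at *; omega)

/-- The term `(-1)^{|f| + ∑_{i ≥ 2} (|g_i| + 1) + 1} ε(f; g₂, …, g_n) ∘ (id ⊗ g₁)`, for the chain
with first morphism `g` followed by `s`. -/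
def firstTerm {c c' : C.Obj} {p : ℤ} (f : C.Hom c c' p) {x y z : D.Obj} {m : ℤ}
    (g : D.Hom x y m) (s : Chain D y z) (n : ℤ) (h : p + ((m - 1) + s.deg) + 1 = n) :
    E.Hom (T.obj (c, x)) (T.obj (c', z)) n :=
  (p + s.deg + 1).negOnePow • E.comp (by omega) (T.eps f s _ rfl) (T.right c g)

end TwistedPreData

/-- Interpretations of the symbols in a dg category `E` which satisfy the defining relations of
the twisted tensor product of `C` and `D`. -/
structure TwistedData (C D E : DGCat.{u} k) : Type u extends TwistedPreData C D E where
  right_add : ∀ (c : C.Obj) {y y' : D.Obj} {n : ℤ} (g g' : D.Hom y y' n),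
    right c (g + g') = right c g + right c g'
  right_smul : ∀ (c : C.Obj) {y y' : D.Obj} {n : ℤ} (r : k) (g : D.Hom y y' n),
    right c (r • g) = r • right c g
  right_one : ∀ (c : C.Obj) (y : D.Obj), right c (D.one y) = E.one (obj (c, y))
  right_comp : ∀ (c : C.Obj) {x y z : D.Obj} {j i n : ℤ} (h : j + i = n) (g : D.Hom y z j)
    (g' : D.Hom x y i), right c (D.comp h g g') = E.comp h (right c g) (right c g')
  right_d : ∀ (c : C.Obj) {x y : D.Obj} (n m : ℤ) (h : n + 1 = m) (g : D.Hom x y n),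
    right c (D.d n m h g) = E.d n m h (right c g)
  eps_add_left : ∀ {c c' : C.Obj} {p : ℤ} {y y' : D.Obj} (f f' : C.Hom c c' p)
    (s : Chain D y y') (n : ℤ) (h : p + s.deg = n),
    eps (f + f') s n h = eps f s n h + eps f' s n h
  eps_smul_left : ∀ {c c' : C.Obj} {p : ℤ} {y y' : D.Obj} (r : k) (f : C.Hom c c' p)
    (s : Chain D y y') (n : ℤ) (h : p + s.deg = n),
    eps (r • f) s n h = r • eps f s n h
  eps_add : ∀ {c c' : C.Obj} {p : ℤ} {w x y z : D.Obj} {m : ℤ} (f : C.Hom c c' p)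
    (a : Chain D w x) (g g' : D.Hom x y m) (b : Chain D y z) (n : ℤ)
    (h : p + (a.append (.cons (g + g') b)).deg = n) (h₁ : p + (a.append (.cons g b)).deg = n)
    (h₂ : p + (a.append (.cons g' b)).deg = n),
    eps f (a.append (.cons (g + g') b)) n h =
      eps f (a.append (.cons g b)) n h₁ + eps f (a.append (.cons g' b)) n h₂
  eps_smul : ∀ {c c' : C.Obj} {p : ℤ} {w x y z : D.Obj} {m : ℤ} (f : C.Hom c c' p)
    (a : Chain D w x) (r : k) (g : D.Hom x y m) (b : Chain D y z) (n : ℤ)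
    (h : p + (a.append (.cons (r • g) b)).deg = n) (h₁ : p + (a.append (.cons g b)).deg = n),
    eps f (a.append (.cons (r • g) b)) n h = r • eps f (a.append (.cons g b)) n h₁
  left_one : ∀ (c : C.Obj) (y : D.Obj) (h : 0 + (Chain.nil y : Chain D y y).deg = 0),
    eps (C.one c) (.nil y) 0 h = E.one (obj (c, y))
  eps_one : ∀ {c c' : C.Obj} {p : ℤ} {x y z : D.Obj} (f : C.Hom c c' p)
    (a : Chain D x y) (b : Chain D y z) (n : ℤ) (h : p + (a.append (.cons (D.one y) b)).deg = n),
    eps f (a.append (.cons (D.one y) b)) n h = 0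
  one_eps : ∀ (c : C.Obj) {x y z : D.Obj} {m : ℤ} (g : D.Hom x y m) (s : Chain D y z) (n : ℤ)
    (h : 0 + (Chain.cons g s).deg = n), eps (C.one c) (.cons g s) n h = 0
  /-- composition; for the empty chain this says `(f₂ ∘ f₁) ⊗ id = (f₂ ⊗ id) ∘ (f₁ ⊗ id)` -/
  comp_eps : ∀ {c c' c'' : C.Obj} {p₂ p₁ p : ℤ} (hp : p₂ + p₁ = p) (f₂ : C.Hom c' c'' p₂)
    (f₁ : C.Hom c c' p₁) {x y : D.Obj} (s : Chain D x y) (n : ℤ) (h : p + s.deg = n)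
    (h' : p₂ + p₁ + ((Chain.nil x : Chain D x x).deg + s.deg) = n),
    eps (C.comp hp f₂ f₁) s n h = toTwistedPreData.splitSum f₂ f₁ (.nil x) s n h'
  left_d : ∀ {c c' : C.Obj} {p p' : ℤ} (hp : p + 1 = p') (f : C.Hom c c' p) (y : D.Obj)
    (n n' : ℤ) (hn : n + 1 = n') (h : p + (Chain.nil y : Chain D y y).deg = n)
    (h' : p' + (Chain.nil y : Chain D y y).deg = n'),
    E.d n n' hn (eps f (.nil y) n h) = eps (C.d p p' hp f) (.nil y) n' h'
  eps_d : ∀ {c c' : C.Obj} {p p' : ℤ} (hp : p + 1 = p') (f : C.Hom c c' p) {x y z : D.Obj}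
    {m : ℤ} (g : D.Hom x y m) (s : Chain D y z) (n n' : ℤ) (hn : n + 1 = n')
    (h : p + (Chain.cons g s).deg = n) (h₁ : p' + (Chain.cons g s).deg = n')
    (h₂ : p + ((Chain.nil x : Chain D x x).deg + (Chain.cons g s).deg) + 1 = n')
    (h₃ : p + ((Chain.nil x : Chain D x x).deg + ((m - 1) + s.deg)) + 1 = n')
    (h₄ : p + ((m - 1) + s.deg) + 1 = n'),
    eps (C.d p p' hp f) (.cons g s) n' h₁ =
      E.d n n' hn (eps f (.cons g s) n h) +
      toTwistedPreData.diffSum f (.nil x) (.cons g s) n' h₂ +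
      (toTwistedPreData.lastTerm f (.nil x) g s n' h₃ +
        toTwistedPreData.firstTerm f g s n' h₄ +
        toTwistedPreData.mulSum f (.nil x) g s n' h₃)

/-- Formal expressions in the symbols `id_c ⊗ g` and `ε(f; g₁, …, gₙ)` and the operations of a dg
category with set of objects `Ob C × Ob D`. -/
inductive TwistedTerm (C D : DGCat.{u} k) : C.Obj × D.Obj → C.Obj × D.Obj → ℤ → Type u
  | one (x : C.Obj × D.Obj) : TwistedTerm C D x x 0
  | comp {x y z : C.Obj × D.Obj} {j i n : ℤ} (h : j + i = n) (t : TwistedTerm C D y z j)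
      (t' : TwistedTerm C D x y i) : TwistedTerm C D x z n
  | zero (x y : C.Obj × D.Obj) (n : ℤ) : TwistedTerm C D x y n
  | add {x y : C.Obj × D.Obj} {n : ℤ} (t t' : TwistedTerm C D x y n) : TwistedTerm C D x y n
  | smul {x y : C.Obj × D.Obj} {n : ℤ} (r : k) (t : TwistedTerm C D x y n) : TwistedTerm C D x y n
  | d {x y : C.Obj × D.Obj} (n m : ℤ) (h : n + 1 = m) (t : TwistedTerm C D x y n) :
      TwistedTerm C D x y m
  | right (c : C.Obj) {y y' : D.Obj} {n : ℤ} (g : D.Hom y y' n) : TwistedTerm C D (c, y) (c, y') n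
  | eps {c c' : C.Obj} {p : ℤ} {y y' : D.Obj} (f : C.Hom c c' p) (s : Chain D y y') (n : ℤ)
      (h : p + s.deg = n) : TwistedTerm C D (c, y) (c', y') n

/-- The value of a formal expression under an interpretation of the symbols. -/
def TwistedPreData.eval {C D E : DGCat.{u} k} (T : TwistedPreData C D E) :
    {x y : C.Obj × D.Obj} → {n : ℤ} → TwistedTerm C D x y n → E.Hom (T.obj x) (T.obj y) n
  | _, _, _, .one x => E.one (T.obj x)
  | _, _, _, .comp h t t' => E.comp h (T.eval t) (T.eval t')
  | _, _, _, .zero _ _ _ => 0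
  | _, _, _, .add t t' => T.eval t + T.eval t'
  | _, _, _, .smul r t => r • T.eval t
  | _, _, _, .d n m h t => E.d n m h (T.eval t)
  | _, _, _, .right c g => T.right c g
  | _, _, _, .eps f s n h => T.eps f s n h

/-- Two formal expressions are identified in the twisted tensor product when their equality follows
from the axioms of dg categories and the defining relations, i.e. when they have the same value
under all interpretations satisfying the defining relations. (The twisted tensor product is itself
such an interpretation, see `twistedUniversal`.) -/
def twistedSetoid (C D : DGCat.{u} k) (x y : C.Obj × D.Obj) (n : ℤ) :
    Setoid (TwistedTerm C D x y n) where
  r t t' := ∀ (E : DGCat.{u} k) (T : TwistedData C D E), T.eval t = T.eval t'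
  iseqv := ⟨fun _ _ _ => rfl, fun h E T => (h E T).symm, fun h h' E T => (h E T).trans (h' E T)⟩

/-- The morphisms of the twisted tensor product. -/
def TwistedHom (C D : DGCat.{u} k) (x y : C.Obj × D.Obj) (n : ℤ) : Type u :=
  Quotient (twistedSetoid C D x y n)

namespace TwistedHom

variable {C D : DGCat.{u} k} {x y : C.Obj × D.Obj} {n : ℤ}

/-- The class of a formal expression. -/
def mk (t : TwistedTerm C D x y n) : TwistedHom C D x y n := Quotient.mk _ t

theorem eval_eq {t t' : TwistedTerm C D x y n} (h : (twistedSetoid C D x y n) t t')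
    (E : DGCat.{u} k) (T : TwistedData C D E) : T.eval t = T.eval t' := h E T

/-- The value of a morphism of the twisted tensor product under an interpretation. -/
def eval {E : DGCat.{u} k} (T : TwistedData C D E) (f : TwistedHom C D x y n) :
    E.Hom (T.obj x) (T.obj y) n :=
  Quotient.lift (fun t => T.eval t) (fun _ _ h => eval_eq h E T) f

theorem ext {f g : TwistedHom C D x y n}
    (h : ∀ (E : DGCat.{u} k) (T : TwistedData C D E), f.eval T = g.eval T) : f = g := by
  induction f using Quotient.ind
  induction g using Quotient.ind
  exact Quotient.sound h

instance : Zero (TwistedHom C D x y n) := ⟨mk (.zero x y n)⟩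

instance : Add (TwistedHom C D x y n) :=
  ⟨Quotient.map₂ .add (fun _ _ h _ _ h' E T =>
    congrArg₂ (· + ·) (eval_eq h E T) (eval_eq h' E T))⟩

instance : SMul k (TwistedHom C D x y n) :=
  ⟨fun r => Quotient.map (.smul r) (fun _ _ h E T =>
    congrArg (r • ·) (eval_eq h E T))⟩

instance : Neg (TwistedHom C D x y n) := ⟨fun f => (-1 : k) • f⟩

section

variable {E : DGCat.{u} k} (T : TwistedData C D E)

theorem eval_zero : (0 : TwistedHom C D x y n).eval T = 0 := rfl

theorem eval_add (f g : TwistedHom C D x y n) : (f + g).eval T = f.eval T + g.eval T := by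
  induction f using Quotient.ind
  induction g using Quotient.ind
  rfl

theorem eval_smul (r : k) (f : TwistedHom C D x y n) : (r • f).eval T = r • f.eval T := by
  induction f using Quotient.ind
  rfl

theorem eval_neg (f : TwistedHom C D x y n) : (-f).eval T = -f.eval T := by
  change ((-1 : k) • f).eval T = _
  rw [eval_smul, neg_one_smul]

end

instance : AddCommGroup (TwistedHom C D x y n) where
  add_assoc f g h := ext fun E T => by simp only [eval_add, add_assoc]
  zero_add f := ext fun E T => by simp only [eval_add, eval_zero, zero_add]
  add_zero f := ext fun E T => by simp only [eval_add, eval_zero, add_zero]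
  add_comm f g := ext fun E T => by simp only [eval_add, add_comm]
  neg_add_cancel f := ext fun E T => by simp only [eval_add, eval_neg, eval_zero, neg_add_cancel]
  nsmul := nsmulRec
  zsmul := zsmulRec

instance : Module k (TwistedHom C D x y n) where
  one_smul f := ext fun E T => by simp only [eval_smul, one_smul]
  mul_smul r r' f := ext fun E T => by simp only [eval_smul, mul_smul]
  smul_zero r := ext fun E T => by simp only [eval_smul, eval_zero, smul_zero]
  smul_add r f g := ext fun E T => by simp only [eval_smul, eval_add, smul_add]
  add_smul r r' f := ext fun E T => by simp only [eval_smul, eval_add, add_smul]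
  zero_smul f := ext fun E T => by simp only [eval_smul, eval_zero, zero_smul]

/-- The value under an interpretation, as a linear map. -/
def evalₗ {E : DGCat.{u} k} (T : TwistedData C D E) :
    TwistedHom C D x y n →ₗ[k] E.Hom (T.obj x) (T.obj y) n where
  toFun f := f.eval T
  map_add' := eval_add T
  map_smul' := eval_smul T

theorem eval_units_smul {E : DGCat.{u} k} (T : TwistedData C D E) (r : ℤˣ)
    (f : TwistedHom C D x y n) : (r • f).eval T = r • f.eval T := by
  rcases Int.units_eq_one_or r with rfl | rfl
  · simp
  · simp [eval_neg]

/-- Composition. -/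
def comp {x y z : C.Obj × D.Obj} {j i n : ℤ} (h : j + i = n) (f : TwistedHom C D y z j)
    (g : TwistedHom C D x y i) : TwistedHom C D x z n :=
  Quotient.map₂ (.comp h) (fun _ _ e _ _ e' E T => by
    simp only [TwistedPreData.eval, eval_eq e E T, eval_eq e' E T]) f g

/-- The differential. -/
def d {x y : C.Obj × D.Obj} (n m : ℤ) (h : n + 1 = m) (f : TwistedHom C D x y n) :
    TwistedHom C D x y m :=
  Quotient.map (.d n m h) (fun _ _ e E T =>
    congrArg (E.d n m h) (eval_eq e E T)) f

section

variable {E : DGCat.{u} k} (T : TwistedData C D E)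

theorem eval_comp {x y z : C.Obj × D.Obj} {j i n : ℤ} (h : j + i = n) (f : TwistedHom C D y z j)
    (g : TwistedHom C D x y i) : (comp h f g).eval T = E.comp h (f.eval T) (g.eval T) := by
  induction f using Quotient.ind
  induction g using Quotient.ind
  rfl

theorem eval_d {x y : C.Obj × D.Obj} (n m : ℤ) (h : n + 1 = m) (f : TwistedHom C D x y n) :
    (d n m h f).eval T = E.d n m h (f.eval T) := by
  induction f using Quotient.ind
  rfl

end

end TwistedHom

open TwistedHom in
/-- The twisted tensor product of two small dg categories: the dg category with set of objects
`Ob C × Ob D` generated by the symbols `f ⊗ id_y`, `id_c ⊗ g`, `ε(f; g₁, …, gₙ)`, subject to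
the defining relations (which include the formulas for the differentials of the symbols). -/
def twistedTensor (C D : DGCat.{u} k) : DGCat.{u} k where
  Obj := C.Obj × D.Obj
  Hom := TwistedHom C D
  d n m h :=
    { toFun := TwistedHom.d n m h
      map_add' := fun f g => TwistedHom.ext fun E T => by simp only [eval_add, eval_d, map_add]
      map_smul' := fun r f => TwistedHom.ext fun E T => by
        simp only [eval_smul, eval_d, map_smul, RingHom.id_apply] }
  one x := TwistedHom.mk (.one x)
  comp h := LinearMap.mk₂ k (TwistedHom.comp h)
    (fun _ _ _ => TwistedHom.ext fun E T => by
      simp only [eval_add, eval_comp, map_add, LinearMap.add_apply])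
    (fun _ _ _ => TwistedHom.ext fun E T => by
      simp only [eval_smul, eval_comp, map_smul, LinearMap.smul_apply])
    (fun _ _ _ => TwistedHom.ext fun E T => by simp only [eval_add, eval_comp, map_add])
    (fun _ _ _ => TwistedHom.ext fun E T => by simp only [eval_smul, eval_comp, map_smul])
  d_d n m l h h' f := TwistedHom.ext fun E T =>
    (eval_d T m l h' _).trans ((congrArg _ (eval_d T n m h f)).trans (E.d_d n m l h h' _))
  one_comp h f := TwistedHom.ext fun E T => (eval_comp T h (.mk (.one _)) f).trans (E.one_comp h _)
  comp_one h f := TwistedHom.ext fun E T => (eval_comp T h f (.mk (.one _))).trans (E.comp_one h _)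
  assoc h₁ h₂ h₃ h₄ a b c := TwistedHom.ext fun E T => by
    simp only [LinearMap.mk₂_apply, eval_comp]
    exact E.assoc h₁ h₂ h₃ h₄ _ _ _
  leibniz h hn hj hi h₁ h₂ g f := TwistedHom.ext fun E T => by
    simp only [LinearMap.mk₂_apply, LinearMap.coe_mk, AddHom.coe_mk, eval_comp, eval_d, eval_add,
      eval_units_smul]
    exact E.leibniz h hn hj hi h₁ h₂ _ _

/-- The symbols, as morphisms of the twisted tensor product. -/
def twistedSymbols (C D : DGCat.{u} k) : TwistedPreData C D (twistedTensor C D) where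
  obj x := x
  right c _ _ _ g := TwistedHom.mk (.right c g)
  eps f s n h := TwistedHom.mk (.eps f s n h)

/-- The dg functor out of the twisted tensor product given by an interpretation of the symbols
which satisfies the defining relations. -/
def twistedLift {C D E : DGCat.{u} k} (T : TwistedData C D E) : twistedTensor C D ⟶ E :=
  DGFunctor.mk (A := twistedTensor C D) (B := E) T.obj (TwistedHom.evalₗ T)
    (fun n m h f => TwistedHom.eval_d T n m h f) (fun _ => rfl)
    (fun h g f => TwistedHom.eval_comp T h g f)

section Universal

variable {C D E E' : DGCat.{u} k}

theorem DGFunctor.map_units_smul (F : DGFunctor E E') {x y : E.Obj} {n : ℤ} (r : ℤˣ)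
    (f : E.Hom x y n) : F.map (r • f) = r • F.map f := by
  rcases Int.units_eq_one_or r with rfl | rfl <;> simp

namespace TwistedPreData

/-- The image of an interpretation under a dg functor. -/
def map (T : TwistedPreData C D E) (F : DGFunctor E E') : TwistedPreData C D E' where
  obj x := F.obj (T.obj x)
  right c _ _ _ g := F.map (T.right c g)
  eps f s n h := F.map (T.eps f s n h)

variable (T : TwistedPreData C D E) (F : DGFunctor E E')

theorem map_splitSum {c c' c'' : C.Obj} {p₂ p₁ : ℤ} (f₂ : C.Hom c' c'' p₂) (f₁ : C.Hom c c' p₁)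
    {x y z : D.Obj} (a : Chain D x y) (b : Chain D y z) (n : ℤ)
    (h : (p₂ + p₁) + (a.deg + b.deg) = n) :
    F.map (T.splitSum f₂ f₁ a b n h) = (T.map F).splitSum f₂ f₁ a b n h := by
  induction b with
  | nil y => exact F.map_comp _ _ _
  | cons g b ih =>
    simp only [splitSum, map_add, DGFunctor.map_units_smul, F.map_comp, ih]
    rfl

theorem map_diffSum {c c' : C.Obj} {p : ℤ} (f : C.Hom c c' p) {x y z : D.Obj} (a : Chain D x y)
    (b : Chain D y z) (n : ℤ) (h : p + (a.deg + b.deg) + 1 = n) :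
    F.map (T.diffSum f a b n h) = (T.map F).diffSum f a b n h := by
  induction b with
  | nil y => exact map_zero _
  | cons g b ih =>
    simp only [diffSum, map_add, DGFunctor.map_units_smul, ih]
    rfl

theorem map_mulSum {c c' : C.Obj} {p : ℤ} (f : C.Hom c c' p) {x y z w : D.Obj} {m : ℤ}
    (a : Chain D x y) (g : D.Hom y z m) (b : Chain D z w) (n : ℤ)
    (h : p + (a.deg + ((m - 1) + b.deg)) + 1 = n) :
    F.map (T.mulSum f a g b n h) = (T.map F).mulSum f a g b n h := by
  induction b generalizing y m with
  | nil y => exact map_zero _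
  | cons g b ih =>
    simp only [mulSum, map_add, DGFunctor.map_units_smul, ih]
    rfl

theorem map_lastTerm {c c' : C.Obj} {p : ℤ} (f : C.Hom c c' p) {x y z w : D.Obj} {m : ℤ}
    (a : Chain D x y) (g : D.Hom y z m) (b : Chain D z w) (n : ℤ)
    (h : p + (a.deg + ((m - 1) + b.deg)) + 1 = n) :
    F.map (T.lastTerm f a g b n h) = (T.map F).lastTerm f a g b n h := by
  induction b generalizing y m with
  | nil y =>
    simp only [lastTerm, DGFunctor.map_units_smul, F.map_comp]
    rfl
  | cons g b ih =>
    simp only [lastTerm, ih]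
    rfl

theorem map_firstTerm {c c' : C.Obj} {p : ℤ} (f : C.Hom c c' p) {x y z : D.Obj} {m : ℤ}
    (g : D.Hom x y m) (s : Chain D y z) (n : ℤ) (h : p + ((m - 1) + s.deg) + 1 = n) :
    F.map (T.firstTerm f g s n h) = (T.map F).firstTerm f g s n h := by
  simp only [firstTerm, DGFunctor.map_units_smul, F.map_comp]
  rfl

end TwistedPreData

theorem twistedTensor_ext {x y : C.Obj × D.Obj} {n : ℤ} {f g : (twistedTensor C D).Hom x y n}
    (h : ∀ (E : DGCat.{u} k) (T : TwistedData C D E),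
      DGFunctor.map (A := twistedTensor C D) (B := E) (twistedLift T) f =
        DGFunctor.map (A := twistedTensor C D) (B := E) (twistedLift T) g) : f = g :=
  TwistedHom.ext h

/-- The symbols satisfy the defining relations in the twisted tensor product. -/
def twistedUniversal (C D : DGCat.{u} k) : TwistedData C D (twistedTensor C D) where
  toTwistedPreData := twistedSymbols C D
  right_add c _ _ _ g g' := twistedTensor_ext fun E T => by
    rw [map_add]; exact T.right_add c g g'
  right_smul c _ _ _ r g := twistedTensor_ext fun E T => by
    rw [map_smul]; exact T.right_smul c r g
  right_one c y := twistedTensor_ext fun E T => T.right_one c y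
  right_comp c _ _ _ _ _ _ h g g' := twistedTensor_ext fun E T => T.right_comp c h g g'
  right_d c _ _ n m h g := twistedTensor_ext fun E T => T.right_d c n m h g
  eps_add_left f f' s n h := twistedTensor_ext fun E T => by
    rw [map_add]; exact T.eps_add_left f f' s n h
  eps_smul_left r f s n h := twistedTensor_ext fun E T => by
    rw [map_smul]; exact T.eps_smul_left r f s n h
  eps_add f a g g' b n h h₁ h₂ := twistedTensor_ext fun E T => by
    rw [map_add]; exact T.eps_add f a g g' b n h h₁ h₂
  eps_smul f a r g b n h h₁ := twistedTensor_ext fun E T => by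
    rw [map_smul]; exact T.eps_smul f a r g b n h h₁
  left_one c y h := twistedTensor_ext fun E T => T.left_one c y h
  eps_one f a b n h := twistedTensor_ext fun E T => by
    rw [map_zero]; exact T.eps_one f a b n h
  one_eps c _ _ _ _ g s n h := twistedTensor_ext fun E T => by
    rw [map_zero]; exact T.one_eps c g s n h
  comp_eps hp f₂ f₁ _ _ s n h h' := twistedTensor_ext fun E T => by
    rw [TwistedPreData.map_splitSum]; exact T.comp_eps hp f₂ f₁ s n h h'
  left_d hp f y n n' hn h h' := twistedTensor_ext fun E T => T.left_d hp f y n n' hn h h'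
  eps_d hp f _ _ _ _ g s n n' hn h h₁ h₂ h₃ h₄ := twistedTensor_ext fun E T => by
    simp only [map_add, TwistedPreData.map_diffSum, TwistedPreData.map_lastTerm,
      TwistedPreData.map_firstTerm, TwistedPreData.map_mulSum]
    exact T.eps_d hp f g s n n' hn h h₁ h₂ h₃ h₄

end Universal

section Generators

variable {C D : DGCat.{u} k} (c : ICellComplex C) (d : ICellComplex D)

/-- The index set of the free generators of the twisted tensor product of two `I`-cell complexes
with free generators `(f_i)` and `(g_j)`: those of the form `f_i ⊗ id_y`, those of the form
`id_x ⊗ g_j`, and those of the form `ε(f_i; s₁, …, sₙ)` with `n ≥ 1` and composable nonempty words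
`s₁, …, sₙ` in the `g_j`. -/
inductive TwistedGen : Type u
  | left (i : c.Gen) (y : D.Obj)
  | right (x : C.Obj) (j : d.Gen)
  | eps (i : c.Gen) {y y' : D.Obj} (s : d.WordSeq y y')

/-- The corresponding morphisms of the twisted tensor product. -/
noncomputable def TwistedGen.mor {c : ICellComplex C} {d : ICellComplex D} :
    TwistedGen c d → (twistedTensor C D).Mor
  | .left i y => ⟨((c.gen i).src, y), ((c.gen i).tgt, y), _,
      (twistedSymbols C D).eps (c.gen i).hom (.nil y) _ rfl⟩
  | .right x j => ⟨(x, (d.gen j).src), (x, (d.gen j).tgt), _,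
      (twistedSymbols C D).right x (d.gen j).hom⟩
  | .eps i (y := y) (y' := y') s => ⟨((c.gen i).src, y), ((c.gen i).tgt, y'), _,
      (twistedSymbols C D).eps (c.gen i).hom s.toChain _ rfl⟩

end Generators

end Twisted

/-! ### Signs as scalars, and families of morphisms indexed by all degrees -/

section TotalMorphisms

variable {k : Type u} [Field k]

/-! The engine is an adjunction. For dg categories D and E, the dg functors D → E are the objects of
a dg category `coherent D E`. A morphism F → G of degree p is a normalized multilinear cochain: it
sends a chain g₁, …, gₙ from y to z to a morphism F y → G z of degree p + ∑(|gᵢ| - 1). The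
differential is the Hochschild differential `Fnl.cdiff` and the composition is the convolution
`Fnl.conv`. Up to the sign (-1)^{|f|(∑|gᵢ| - n)}, the defining relations say exactly that f ↦ ε(f;
…) is a dg functor C → `coherent D E`: relation 3 is compatibility with composition, relation 4 with
differentials. So dg functors from the twisted tensor product to E are transposed to dg functors C →
`coherent D E`, naturally in E (`TwistedData.toCoherent`, `TwistedData.ofCoherent`).

For (a), acyclic fibrations are the dg functors which are surjective on objects and on morphisms and
have acyclic kernels. If D is cofibrant and P : E → E' is one of these, so is `coherent D E` →
`coherent D E'` (`coherent.map_isTrivialFibration`). Objects lift because D is cofibrant. Cochains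
lift by linear sections of P. A closed cochain with values in the kernel of P is bounded by
successive approximation along the length of chains, using a contracting homotopy of the kernel. By
adjunction, a lifting problem for the tensor product against P is then one for C against an acyclic
fibration.

For (b), it suffices (`DGCat.IsSemifree.exists_iCellComplex`) that the proposed generators generate
freely as a graded category, and can be well-ordered so that the differential of each is generated
by earlier ones.

Freeness is obtained without computing a basis of the tensor product. Let Z[ε] be Z with its
differential forgotten, tensored with k[ε], dε = 1. A primitive in Z[ε] of a given closed morphism
exists and is determined by its component in Z, which is arbitrary. Hence an I-cell complex maps to
Z[ε] with arbitrary Z-components on its generators, and projecting to Z shows that it is free as a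
graded category. In particular words are linearly independent, so normalized cochains on D are
freely given by their values on sequences of words. The same primitive property therefore holds in
`coherent D Z[ε]`, with the Z-components on sequences of words as free parameters
(`coherent.existsUnique_cdiff_eq`). Mapping the cells of C there, transposing and projecting to Z
gives graded functors with prescribed values on all f_i ⊗ id, id ⊗ g_j and ε(f_i; s₁, …, sₙ).

Generation follows from multilinearity and relation 3. For the order, the generators id ⊗ g_j come
first. The others are compared by the stage of f_i, then by the multiset of stages of the letters in
the Dershowitz–Manna order, then by the number of words; every term of relation 4 lowers this rank.
-/

/-- The sign `(-1)^p`, as a scalar. -/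
noncomputable def sg (k : Type u) [Field k] (p : ℤ) : k := if Even p then 1 else -1

/-- With signs as scalars of `k`, linear maps commute with them and sign identities become case
splits on parities. -/
theorem negOnePow_smul_eq_sg {M : Type*} [AddCommGroup M] [Module k M] (p : ℤ) (x : M) :
    p.negOnePow • x = sg k p • x := by
  by_cases hp : Even p
  · rw [Int.negOnePow_even p hp, sg, if_pos hp, one_smul, one_smul]
  · rw [Int.negOnePow_odd p (Int.not_even_iff_odd.1 hp), sg, if_neg hp]
    simp

theorem sg_mul_self (p : ℤ) : sg k p * sg k p = 1 := by
  unfold sg; split_ifs <;> simp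

theorem sg_add (p q : ℤ) : sg k (p + q) = sg k p * sg k q := by
  unfold sg
  by_cases hp : Even p <;> by_cases hq : Even q <;>
  simp [Int.even_add, -Int.not_even_iff_odd, hp, hq]

theorem sg_one : sg k 1 = -1 := by simp [sg]

theorem sg_sub (p q : ℤ) : sg k (p - q) = sg k p * sg k q := by
  unfold sg
  by_cases hp : Even p <;> by_cases hq : Even q <;>
  simp [Int.even_sub, -Int.not_even_iff_odd, hp, hq]

theorem sg_mul (p q : ℤ) : sg k (p * q) = if Even p then 1 else sg k q := by
  unfold sg
  by_cases hp : Even p <;> by_cases hq : Even q <;>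
  simp [Int.even_mul, -Int.not_even_iff_odd, hp, hq]

theorem sg_succ_mul (p q : ℤ) : sg k ((p + 1) * q) = if Even p then sg k q else 1 := by
  rw [sg_mul]
  by_cases hp : Even p
  · rw [if_pos hp, if_neg (by rw [Int.even_add_one, not_not]; exact hp)]
  · rw [if_neg hp, if_pos (by rw [Int.even_add_one]; exact hp)]

theorem sg_succ_succ_mul (p q : ℤ) : sg k ((p + 1 + 1) * q) = if Even p then 1 else sg k q := by
  rw [sg_succ_mul]
  by_cases hp : Even p
  · rw [if_pos hp, if_neg (by rw [Int.even_add_one, not_not]; exact hp)]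
  · rw [if_neg hp, if_pos (by rw [Int.even_add_one]; exact hp)]

namespace DGCat

variable (E : DGCat.{u} k)

/-- Families of morphisms, one in each degree. -/
abbrev Tot (x y : E.Obj) : Type u := ∀ n : ℤ, E.Hom x y n

variable {E}

/-- Composition with the degree `p` component of a family. -/
def tcomp {x y z : E.Obj} (p : ℤ) : E.Tot y z →ₗ[k] E.Tot x y →ₗ[k] E.Tot x z :=
  LinearMap.mk₂ k (fun t v n => E.comp (add_sub_cancel p n) (t p) (v (n - p)))
    (fun _ _ _ => by funext n; simp) (fun _ _ _ => by funext n; simp)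
    (fun _ _ _ => by funext n; simp) (fun _ _ _ => by funext n; simp)

/-- The differential of a family. -/
def td {x y : E.Obj} : E.Tot x y →ₗ[k] E.Tot x y where
  toFun t n := E.d (n - 1) n (sub_add_cancel n 1) (t (n - 1))
  map_add' _ _ := by funext n; simp
  map_smul' _ _ := by funext n; simp

/-- The family with a single component. -/
noncomputable def single {x y : E.Obj} (m : ℤ) : E.Hom x y m →ₗ[k] E.Tot x y :=
  LinearMap.single k (fun n => E.Hom x y n) m

/-- The family given by an identity morphism. -/
noncomputable def tone (x : E.Obj) : E.Tot x x := single 0 (E.one x)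

@[simp] theorem single_same {x y : E.Obj} (m : ℤ) (a : E.Hom x y m) :
    (single m a : E.Tot x y) m = a := by
  simp [single]

theorem single_of_ne {x y : E.Obj} {m n : ℤ} (h : n ≠ m) (a : E.Hom x y m) :
    (single m a : E.Tot x y) n = 0 := by
  simp [single, h]

theorem tcomp_apply {x y z : E.Obj} {p i n : ℤ} (h : p + i = n) (t : E.Tot y z) (v : E.Tot x y) :
    tcomp p t v n = E.comp h (t p) (v i) := by
  obtain rfl : i = n - p := by omega
  rfl

theorem td_apply {x y : E.Obj} {m n : ℤ} (h : m + 1 = n) (t : E.Tot x y) :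
    td t n = E.d m n h (t m) := by
  obtain rfl : m = n - 1 := by omega
  rfl

theorem td_td {x y : E.Obj} (t : E.Tot x y) : td (td t) = 0 := by
  funext n
  rw [td_apply (m := n - 1) (by omega), td_apply (m := n - 1 - 1) (by omega), E.d_d]
  rfl

theorem tcomp_assoc {x y z w : E.Obj} (p q r : ℤ) (h : p + q = r) (t : E.Tot z w) (v : E.Tot y z)
    (s : E.Tot x y) : tcomp p t (tcomp q v s) = tcomp r (tcomp p t v) s := by
  funext n
  rw [tcomp_apply (p := p) (i := n - p) (by omega),
    tcomp_apply (p := q) (i := n - p - q) (by omega),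
    tcomp_apply (p := r) (i := n - p - q) (by omega), tcomp_apply h, E.assoc]

/-- Only the component of degree `p` of the left factor enters the composite, so its differential
enters in degree `p + 1` and the sign is that of `p`, whatever `t` is in other degrees. -/
theorem td_tcomp {x y z : E.Obj} (p : ℤ) (t : E.Tot y z) (v : E.Tot x y) :
    td (tcomp p t v) = tcomp (p + 1) (td t) v + sg k p • tcomp p t (td v) := by
  funext n
  rw [td_apply (m := n - 1) (by omega), tcomp_apply (p := p) (i := n - 1 - p) (by omega),
    E.leibniz (by omega) (by omega) (j' := p + 1) rfl (i' := n - p) (by omega) (by omega)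
      (by omega), Pi.add_apply, Pi.smul_apply,
    tcomp_apply (p := p + 1) (i := n - 1 - p) (by omega), td_apply (m := p) rfl,
    tcomp_apply (p := p) (i := n - p) (by omega), td_apply (m := n - 1 - p) (by omega),
    negOnePow_smul_eq_sg (k := k)]

theorem tcomp_tone_left {x y : E.Obj} (t : E.Tot x y) : tcomp 0 (tone y) t = t := by
  funext n
  rw [tcomp_apply (p := 0) (i := n) (by omega), tone, single_same, E.one_comp]

/-- Homogeneity is needed because `tcomp p` discards every component of `t` outside degree `p`. -/
theorem tcomp_tone_right {x y : E.Obj} (p : ℤ) (t : E.Tot x y) (ht : ∀ n, n ≠ p → t n = 0) :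
    tcomp p t (tone x) = t := by
  funext n
  rw [tcomp_apply (p := p) (i := n - p) (by omega)]
  by_cases h : n = p
  · subst h
    -- The degree `n - n` is replaced by a variable, since it equals 0 only propositionally.
    have : ∀ m (hm : m = 0) (h : n + m = n), E.comp h (t n) (tone (E := E) x m) = t n := by
      rintro m rfl h
      rw [tone, single_same, E.comp_one]
    exact this _ (by omega) _
  · rw [ht n h, tone, single_of_ne (by omega), map_zero]

theorem td_single {x y : E.Obj} {m n : ℤ} (h : m + 1 = n) (a : E.Hom x y m) :
    td (single m a : E.Tot x y) = single n (E.d m n h a) := by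
  subst h
  funext i
  rw [td_apply (m := i - 1) (by omega)]
  by_cases h : i = m + 1
  · subst h
    have : ∀ j (hj : j = m) (h : j + 1 = m + 1), E.d j (m + 1) h ((single m a : E.Tot x y) j) =
      E.d m (m + 1) rfl a := by
      rintro j rfl h
      rw [single_same]
    rw [single_same]
    exact this _ (by omega) _
  · rw [single_of_ne h, single_of_ne (by omega), map_zero]

theorem tcomp_single {x y z : E.Obj} {p q r : ℤ} (h : p + q = r) (a : E.Hom y z p)
    (b : E.Hom x y q) :
    tcomp p (single p a : E.Tot y z) (single q b) = single r (E.comp h a b) := by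
  subst h
  funext i
  by_cases h : i = p + q
  · subst h
    rw [tcomp_apply rfl, single_same, single_same, single_same]
  · rw [tcomp_apply (p := p) (i := i - p) (by omega), single_of_ne h, single_of_ne (m := q) (by omega),
      map_zero]

theorem tcomp_homog {x y z : E.Obj} {p q : ℤ} (t : E.Tot y z) (v : E.Tot x y)
    (hv : ∀ n, n ≠ q → v n = 0) (n : ℤ) (hn : n ≠ p + q) : tcomp p t v n = 0 := by
  rw [tcomp_apply (p := p) (i := n - p) (by omega), hv _ (by omega), map_zero]

theorem td_homog {x y : E.Obj} {p : ℤ} (t : E.Tot x y) (ht : ∀ n, n ≠ p → t n = 0) (n : ℤ)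
    (hn : n ≠ p + 1) : td t n = 0 := by
  rw [td_apply (m := n - 1) (by omega), ht _ (by omega), map_zero]

theorem tcomp_congr {x y z : E.Obj} {p q : ℤ} (h : p = q) (t : E.Tot y z) (v : E.Tot x y) :
    tcomp p t v = tcomp q t v := by rw [h]

end DGCat

end TotalMorphisms

/-! ### Cochains on chains of morphisms: convolution and Hochschild differential -/

section Cochains

variable {k : Type u} [Field k] {D E : DGCat.{u} k}

open DGCat

theorem Chain.cons_comp_congr {x y z w : D.Obj} {j i n n' : ℤ} (h : j + i = n) (h' : j + i = n')
    (a : D.Hom y z j) (b : D.Hom x y i) (s : Chain D z w) :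
    Chain.cons (D.comp h a b) s = Chain.cons (D.comp h' a b) s := by
  subst h; subst h'; rfl

theorem Chain.cons_assoc {x y z w v : D.Obj} {p q r : ℤ} (a : D.Hom z w p) (b : D.Hom y z q)
    (c : D.Hom x y r) (s : Chain D w v) :
    Chain.cons (D.comp rfl a (D.comp rfl b c)) s = Chain.cons (D.comp rfl (D.comp rfl a b) c) s := by
  rw [D.assoc rfl rfl rfl (add_assoc p q r).symm]
  exact Chain.cons_comp_congr _ _ _ _ _

theorem Chain.cons_one_comp {x y z : D.Obj} {n : ℤ} (g : D.Hom x y n) (s : Chain D y z) :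
    Chain.cons (D.comp rfl (D.one y) g) s = Chain.cons g s := by
  rw [Chain.cons_comp_congr rfl (zero_add n), D.one_comp]

theorem Chain.cons_comp_one {x y z : D.Obj} {n : ℤ} (g : D.Hom x y n) (s : Chain D y z) :
    Chain.cons (D.comp rfl g (D.one x)) s = Chain.cons g s := by
  rw [Chain.cons_comp_congr rfl (add_zero n), D.comp_one]

/-- The Leibniz rule for 1 ∘ 1 = 1 gives d 1 = d 1 + d 1. -/
theorem DGCat.d_one (D : DGCat.{u} k) (x : D.Obj) {m : ℤ} (h : 0 + 1 = m) :
    D.d 0 m h (D.one x) = 0 := by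
  have := D.leibniz (add_zero 0) h h h (add_zero m |>.symm ▸ rfl : m + 0 = m)
    (by omega : 0 + m = m) (D.one x) (D.one x)
  rw [D.comp_one, D.comp_one, D.one_comp] at this
  simpa using this

/-- Functionals on the chains which start at `y`. -/
abbrev Fnl (D E : DGCat.{u} k) (G : D.Obj → E.Obj) (e : E.Obj) (y : D.Obj) : Type u :=
  ∀ z, Chain D y z → E.Tot e (G z)

namespace Fnl

section

variable {G : D.Obj → E.Obj} {e : E.Obj}

/-- Evaluation on the chains with first morphism `g`. -/
def sh {x y : D.Obj} {m : ℤ} (g : D.Hom x y m) : Fnl D E G e x →ₗ[k] Fnl D E G e y where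
  toFun θ z s := θ z (.cons g s)
  map_add' _ _ := rfl
  map_smul' _ _ := rfl

theorem sh_apply {x y z : D.Obj} {m : ℤ} (g : D.Hom x y m) (θ : Fnl D E G e x)
    (s : Chain D y z) : sh g θ z s = θ z (.cons g s) := rfl

/-- Composition of the values of a functional of degree `q` with a family of morphisms. -/
def rmul (q : ℤ) {e' : E.Obj} {x : D.Obj} :
    Fnl D E G e x →ₗ[k] E.Tot e' e →ₗ[k] Fnl D E G e' x :=
  LinearMap.mk₂ k (fun θ a z s => tcomp (q + s.deg) (θ z s) a)
    (fun _ _ _ => by funext z s; simp) (fun _ _ _ => by funext z s; simp)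
    (fun _ _ _ => by funext z s; simp) (fun _ _ _ => by funext z s; simp)

theorem rmul_apply (q : ℤ) {e' : E.Obj} {x z : D.Obj} (θ : Fnl D E G e x) (a : E.Tot e' e)
    (s : Chain D x z) : rmul q θ a z s = tcomp (q + s.deg) (θ z s) a := rfl

theorem sh_rmul (q q' : ℤ) {e' : E.Obj} {x y : D.Obj} {m : ℤ} (h : q + (m - 1) = q')
    (g : D.Hom x y m) (θ : Fnl D E G e x)
    (a : E.Tot e' e) : sh g (rmul q θ a) = rmul q' (sh g θ) a := by
  funext z s
  exact tcomp_congr (by simp; omega) _ _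

/-- The operations on functionals are recursive in the first morphism of a chain, so they are
compared by fixing that morphism. -/
theorem ext_chain {x : D.Obj} {θ θ' : Fnl D E G e x} (h₀ : θ x (.nil x) = θ' x (.nil x))
    (h : ∀ {y : D.Obj} {m : ℤ} (g : D.Hom x y m), sh g θ = sh g θ') : θ = θ' := by
  funext z s
  cases s with
  | nil => exact h₀
  | cons g s => exact congrFun (congrFun (h g) z) s

/-- The values of the convolution product of `η` and `θ`. -/
noncomputable def convAux (p : ℤ) {G' : D.Obj → E.Obj} (η : ∀ y, Fnl D E G' (G y) y) :
    {y z : D.Obj} → (s : Chain D y z) → (Fnl D E G e y →ₗ[k] E.Tot e (G' z))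
  | _, _, .nil y => tcomp p (η y y (.nil y)) ∘ₗ LinearMap.proj (Chain.nil y) ∘ₗ LinearMap.proj y
  | y, _, .cons (m := m) g s => sg k (p * (m - 1)) • (convAux p η s ∘ₗ sh g) +
      tcomp (p + (Chain.cons g s).deg) (η _ _ (.cons g s)) ∘ₗ LinearMap.proj (Chain.nil y) ∘ₗ
        LinearMap.proj y

/-- The convolution product of `η`, of degree `p`, with a functional. -/
noncomputable def conv (p : ℤ) {G' : D.Obj → E.Obj} (η : ∀ y, Fnl D E G' (G y) y) {y : D.Obj} :
    Fnl D E G e y →ₗ[k] Fnl D E G' e y :=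
  LinearMap.pi fun _ => LinearMap.pi fun s => convAux p η s

variable (p : ℤ) {G' : D.Obj → E.Obj} (η : ∀ y, Fnl D E G' (G y) y)

@[simp] theorem conv_nil {y : D.Obj} (θ : Fnl D E G e y) :
    conv p η θ y (.nil y) = tcomp p (η y y (.nil y)) (θ y (.nil y)) := rfl

theorem conv_cons {x y z : D.Obj} {m : ℤ} (g : D.Hom x y m) (s : Chain D y z)
    (θ : Fnl D E G e x) : conv p η θ z (.cons g s) =
      sg k (p * (m - 1)) • conv p η (sh g θ) z s +
        tcomp (p + (Chain.cons g s).deg) (η x z (.cons g s)) (θ x (.nil x)) := rfl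

/-- In every cut but one the first morphism goes to `θ`. The remaining cut gives the whole chain to
`η` and the empty chain to `θ`. -/
theorem sh_conv {x y : D.Obj} {m q : ℤ} (hq : p + (m - 1) = q) (g : D.Hom x y m)
    (θ : Fnl D E G e x) :
    sh g (conv p η θ) = sg k (p * (m - 1)) • conv p η (sh g θ) +
      rmul q (sh g (η x)) (θ x (.nil x)) := by
  funext z s
  rw [sh_apply, conv_cons, Pi.add_apply, Pi.add_apply]
  congr 1
  exact tcomp_congr (by simp; omega) _ _

theorem conv_rmul (q r : ℤ) (h : p + q = r) {e' : E.Obj} {x : D.Obj} (θ : Fnl D E G e x)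
    (a : E.Tot e' e) :
    conv p η (rmul q θ a) = rmul r (conv p η θ) a := by
  funext z s
  induction s generalizing q r with
  | nil y =>
    rw [conv_nil, rmul_apply, rmul_apply, conv_nil,
      tcomp_assoc _ _ (r + (Chain.nil y : Chain D y y).deg) (by simp; omega)]
  | cons g s ih =>
    rw [conv_cons, sh_rmul _ _ rfl, ih _ _ rfl, rmul_apply, rmul_apply, rmul_apply, conv_cons, map_add,
      LinearMap.add_apply, map_smul, LinearMap.smul_apply,
      tcomp_assoc _ _ (r + (Chain.cons g s).deg) (by simp; omega)]
    congr 2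
    exact tcomp_congr (by simp; omega) _ _

/-- Both sides sum over the ways to cut a chain into three pieces. Fixing the first morphism
separates the case where the piece given to `θ` is empty, and `conv_rmul` handles that term. -/
theorem conv_assoc (q r : ℤ) (h : p + q = r) {G'' : D.Obj → E.Obj}
    (ζ : ∀ y, Fnl D E G (G'' y) y) {x : D.Obj} (θ : Fnl D E G'' e x) :
    conv p η (conv q ζ θ) = conv r (fun y => conv p η (ζ y)) θ := by
  funext z s
  induction s with
  | nil y => exact tcomp_assoc _ _ _ h _ _ _
  | @cons x y z m g s ih =>
    rw [conv_cons, sh_conv _ _ rfl, map_add, map_smul, conv_rmul _ _ _ _ rfl, Pi.add_apply,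
      Pi.add_apply, Pi.smul_apply, Pi.smul_apply, ih, conv_nil, rmul_apply, conv_cons,
      conv_cons (η := η), tcomp_assoc _ _ (r + (Chain.cons g s).deg) (by simp; omega), map_add,
      LinearMap.add_apply, map_smul, LinearMap.smul_apply,
      tcomp_congr (q := r + (Chain.cons g s).deg) (by simp; omega)]
    subst h
    simp only [sg_sub, sg_one, sg_mul]
    -- The signs depend only on the parities of the degrees involved.
    by_cases hp : Even p <;> by_cases hq : Even q <;> by_cases hm : Even m <;>
    simp [sg, Int.even_add, -Int.not_even_iff_odd, hp, hq, hm] <;> abel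

/-- The functionals which give the identity natural transformation. -/
noncomputable def unit (G : D.Obj → E.Obj) (y : D.Obj) : Fnl D E G (G y) y
  | _, .nil y => tone (G y)
  | _, .cons _ _ => 0

@[simp] theorem sh_unit {x y : D.Obj} {m : ℤ} (g : D.Hom x y m) : sh g (unit (E := E) G x) = 0 :=
  rfl

theorem unit_conv {x : D.Obj} (θ : Fnl D E G e x) : conv 0 (unit G) θ = θ := by
  funext z s
  induction s with
  | nil y => exact tcomp_tone_left _
  | cons g s ih =>
    rw [conv_cons, ih, zero_mul]
    simp [sg, unit, sh_apply]

theorem conv_unit {x : D.Obj} (hη : ∀ {z} (s : Chain D x z) n, n ≠ p + s.deg → η x z s n = 0) :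
    conv p η (unit G x) = η x := by
  funext z s
  cases s with
  | nil => exact tcomp_tone_right _ _ (fun n hn => hη _ _ (by simpa using hn))
  | cons g s =>
    rw [conv_cons, sh_unit, map_zero, Pi.zero_apply, Pi.zero_apply, smul_zero, zero_add]
    exact tcomp_tone_right _ _ (hη _)

end

section

variable {e : E.Obj} (G : DGFunctor D E)

/-- Precomposition with a morphism of `D`. -/
noncomputable def act {x y : D.Obj} {m : ℤ} (g : D.Hom x y m) :
    Fnl D E G.obj e x →ₗ[k] Fnl D E G.obj e y where
  toFun θ
    | _, .nil _ => tcomp m (single m (G.map g)) (θ x (.nil x))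
    | z, .cons h t => θ z (.cons (D.comp rfl h g) t)
  map_add' _ _ := by funext z s; cases s <;> simp
  map_smul' _ _ := by funext z s; cases s <;> simp

@[simp] theorem act_nil {x y : D.Obj} {m : ℤ} (g : D.Hom x y m) (θ : Fnl D E G.obj e x) :
    act G g θ y (.nil y) = tcomp m (single m (G.map g)) (θ x (.nil x)) := rfl

theorem act_cons {x y z w : D.Obj} {m n : ℤ} (g : D.Hom x y m) (h : D.Hom y z n)
    (t : Chain D z w) (θ : Fnl D E G.obj e x) :
    act G g θ w (.cons h t) = θ w (.cons (D.comp rfl h g) t) := rfl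

theorem sh_act {x y z : D.Obj} {m n : ℤ} (g : D.Hom x y m) (h : D.Hom y z n)
    (θ : Fnl D E G.obj e x) : sh h (act G g θ) = sh (D.comp rfl h g) θ := rfl

/-- The values of the differential of a functional. -/
noncomputable def diffAux : {y z : D.Obj} → (s : Chain D y z) →
    (Fnl D E G.obj e y →ₗ[k] E.Tot e (G.obj z))
  | _, _, .nil y => td ∘ₗ LinearMap.proj (Chain.nil y) ∘ₗ LinearMap.proj y
  | _, z, .cons (m := m) g s => sg k (m - 1) • (diffAux s ∘ₗ sh g +
      LinearMap.proj s ∘ₗ LinearMap.proj z ∘ₗ (sh (D.d m (m + 1) rfl g) + act G g))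

/-- The part of the differential of a functional which does not involve its source. -/
noncomputable def diff {y : D.Obj} : Fnl D E G.obj e y →ₗ[k] Fnl D E G.obj e y :=
  LinearMap.pi fun _ => LinearMap.pi fun s => diffAux G s

@[simp] theorem diff_nil {y : D.Obj} (θ : Fnl D E G.obj e y) :
    diff G θ y (.nil y) = td (θ y (.nil y)) := rfl

theorem sh_diff {x y : D.Obj} {m n : ℤ} (hn : m + 1 = n) (g : D.Hom x y m)
    (θ : Fnl D E G.obj e x) :
    sh g (diff G θ) = sg k (m - 1) • (diff G (sh g θ) + (sh (D.d m n hn g) θ + act G g θ)) := by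
  subst hn
  rfl

theorem diff_cons {x y z : D.Obj} {m n : ℤ} (hn : m + 1 = n) (g : D.Hom x y m) (s : Chain D y z)
    (θ : Fnl D E G.obj e x) : diff G θ z (.cons g s) =
      sg k (m - 1) • (diff G (sh g θ) z s + (θ z (.cons (D.d m n hn g) s) + act G g θ z s)) := by
  subst hn
  rfl

/-- A morphism acts through `G` on the value at the empty chain, and is absorbed into the first
morphism of any other chain. Together with `diff_act` this is a dg module structure on multilinear
functionals. -/
theorem act_act {x y z : D.Obj} {m n : ℤ} (h : D.Hom y z n) (g : D.Hom x y m)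
    (θ : Fnl D E G.obj e x) : act G h (act G g θ) = act G (D.comp rfl h g) θ := by
  refine ext_chain ?_ fun l => ?_
  · rw [act_nil, act_nil, act_nil, tcomp_assoc _ _ (n + m) rfl, tcomp_single rfl, G.map_comp]
  · funext z s
    exact congrArg (θ _) (Chain.cons_assoc l h g s).symm

theorem diff_rmul (q : ℤ) {e' : E.Obj} {x : D.Obj} (θ : Fnl D E G.obj e x) (a : E.Tot e' e) :
    diff G (rmul q θ a) = rmul (q + 1) (diff G θ) a + sg k q • rmul q θ (td a) := by
  funext z s
  induction s generalizing q with
  | nil y =>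
    simp only [diff_nil, rmul_apply, Pi.add_apply, Pi.smul_apply, Chain.deg_nil, add_zero, td_tcomp]
  | @cons x y z m g s ih =>
    have hact : act G g (rmul q θ a) = rmul (q + m) (act G g θ) a := by
      refine ext_chain ?_ fun h => ?_
      · simp only [act_nil, rmul_apply]
        rw [tcomp_assoc _ _ _ rfl]
        exact tcomp_congr (by simp; omega) _ _
      · funext w t
        exact tcomp_congr (by simp; omega) _ _
    rw [diff_cons _ rfl, sh_rmul _ _ rfl, ih, hact]
    simp only [rmul_apply, Pi.add_apply, Pi.smul_apply]
    rw [diff_cons _ rfl]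
    simp only [map_add, map_smul, LinearMap.add_apply, LinearMap.smul_apply, Chain.deg_cons,
      sh_apply]
    rw [tcomp_congr (show q + (m - 1) + 1 + s.deg = q + 1 + (m - 1 + s.deg) by omega),
      tcomp_congr (show q + (m - 1) + s.deg = q + (m - 1 + s.deg) by omega),
      tcomp_congr (show q + ((m + 1) - 1 + s.deg) = q + 1 + (m - 1 + s.deg) by omega),
      tcomp_congr (show q + m + s.deg = q + 1 + (m - 1 + s.deg) by omega)]
    simp only [sg_add, sg_sub, sg_one]
    by_cases hq : Even q <;> by_cases hm : Even m <;>
    simp [sg, -Int.not_even_iff_odd, hq, hm] <;> abel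

end

end Fnl

end Cochains

/-! ### Normalized multilinear cochains, and d² = 0 -/

section Coherent

variable {k : Type u} [Field k] {D E : DGCat.{u} k}

open DGCat

namespace Fnl

/-- Functionals which are linear in each morphism of the chain. -/
structure IsMulti {G : D.Obj → E.Obj} {e : E.Obj} {y : D.Obj} (θ : Fnl D E G e y) : Prop where
  lin : ∀ {w x z : D.Obj} {m : ℤ} (a : Chain D y w) (r : k) (g g' : D.Hom w x m) (b : Chain D x z),
    θ z (a.append (.cons (r • g + g') b)) =
      r • θ z (a.append (.cons g b)) + θ z (a.append (.cons g' b))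

/-- Multilinear functionals of degree `p` which vanish on chains containing an identity. -/
structure IsNormalized (p : ℤ) {G : D.Obj → E.Obj} {e : E.Obj} {y : D.Obj} (θ : Fnl D E G e y) :
    Prop extends IsMulti θ where
  homog : ∀ {z : D.Obj} (s : Chain D y z) (n : ℤ), n ≠ p + s.deg → θ z s n = 0
  one : ∀ {w z : D.Obj} (a : Chain D y w) (b : Chain D w z),
    θ z (a.append (.cons (D.one w) b)) = 0

section

variable {G : D.Obj → E.Obj} {e : E.Obj}

theorem IsMulti.lin_nil {y x z : D.Obj} {m : ℤ} {θ : Fnl D E G e y} (h : IsMulti θ) (r : k)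
    (g g' : D.Hom y x m) (b : Chain D x z) :
    θ z (.cons (r • g + g') b) = r • θ z (.cons g b) + θ z (.cons g' b) :=
  h.lin (.nil y) r g g' b

theorem IsMulti.lin_cons {y v w x z : D.Obj} {m n : ℤ} {θ : Fnl D E G e y} (h : IsMulti θ)
    (l : D.Hom y v n) (a : Chain D v w) (r : k) (g g' : D.Hom w x m) (b : Chain D x z) :
    θ z (.cons l (a.append (.cons (r • g + g') b))) =
      r • θ z (.cons l (a.append (.cons g b))) + θ z (.cons l (a.append (.cons g' b))) :=
  h.lin (.cons l a) r g g' b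

theorem IsNormalized.one_nil {p : ℤ} {y z : D.Obj} {θ : Fnl D E G e y} (h : IsNormalized p θ)
    (b : Chain D y z) : θ z (.cons (D.one y) b) = 0 :=
  h.one (.nil y) b

theorem IsNormalized.one_cons {p n : ℤ} {y v w z : D.Obj} {θ : Fnl D E G e y}
    (h : IsNormalized p θ) (l : D.Hom y v n) (a : Chain D v w) (b : Chain D w z) :
    θ z (.cons l (a.append (.cons (D.one w) b))) = 0 :=
  h.one (.cons l a) b

theorem IsMulti.sh {x y : D.Obj} {m : ℤ} {θ : Fnl D E G e x} (h : IsMulti θ) (g : D.Hom x y m) :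
    IsMulti (sh g θ) := ⟨fun a => h.lin (.cons g a)⟩

theorem IsMulti.sh_lin {x y : D.Obj} {m : ℤ} {θ : Fnl D E G e x} (h : IsMulti θ) (r : k)
    (g g' : D.Hom x y m) : Fnl.sh (r • g + g') θ = r • Fnl.sh g θ + Fnl.sh g' θ := by
  funext z s
  exact h.lin (.nil x) r g g' s

theorem IsMulti.sh_add_smul {x y : D.Obj} {m : ℤ} {θ : Fnl D E G e x} (h : IsMulti θ) (r : k)
    (g g' : D.Hom x y m) : Fnl.sh (g' + r • g) θ = Fnl.sh g' θ + r • Fnl.sh g θ := by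
  rw [add_comm, h.sh_lin, add_comm]

theorem IsNormalized.sh {p q : ℤ} {x y : D.Obj} {m : ℤ} (hq : p + (m - 1) = q) {θ : Fnl D E G e x}
    (h : IsNormalized p θ) (g : D.Hom x y m) : IsNormalized q (sh g θ) where
  toIsMulti := h.toIsMulti.sh g
  homog s n hn := h.homog (.cons g s) n (by simp only [Chain.deg_cons]; omega)
  one a := h.one (.cons g a)

theorem IsMulti.slot_zero {y : D.Obj} {θ : Fnl D E G e y} (h : IsMulti θ) {w x z : D.Obj} {m : ℤ}
    (a : Chain D y w) (b : Chain D x z) :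
    θ z (a.append (.cons (0 : D.Hom w x m) b)) = 0 := by
  have := h.lin a 1 (0 : D.Hom w x m) 0 b
  rw [one_smul, one_smul, add_zero] at this
  exact left_eq_add.1 this

theorem IsMulti.add {y : D.Obj} {θ θ' : Fnl D E G e y} (h : IsMulti θ) (h' : IsMulti θ') :
    IsMulti (θ + θ') := ⟨fun a r g g' b => by
  simp only [Pi.add_apply, h.lin, h'.lin]; module⟩

theorem IsMulti.smul {y : D.Obj} {θ : Fnl D E G e y} (h : IsMulti θ) (c : k) :
    IsMulti (c • θ) := ⟨fun a r g g' b => by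
  simp only [Pi.smul_apply, h.lin]; module⟩

theorem IsNormalized.add {p : ℤ} {y : D.Obj} {θ θ' : Fnl D E G e y} (h : IsNormalized p θ)
    (h' : IsNormalized p θ') : IsNormalized p (θ + θ') where
  toIsMulti := h.toIsMulti.add h'.toIsMulti
  homog s n hn := by simp [h.homog s n hn, h'.homog s n hn]
  one a b := by simp [h.one a b, h'.one a b]

theorem IsNormalized.smul {p : ℤ} {y : D.Obj} {θ : Fnl D E G e y} (h : IsNormalized p θ) (c : k) :
    IsNormalized p (c • θ) where
  toIsMulti := h.toIsMulti.smul c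
  homog s n hn := by simp [h.homog s n hn]
  one a b := by simp [h.one a b]

theorem IsNormalized.zero {p : ℤ} {y : D.Obj} : IsNormalized p (0 : Fnl D E G e y) where
  lin a r g g' b := by simp
  homog s n hn := rfl
  one a b := rfl

theorem IsNormalized.unit (y : D.Obj) : IsNormalized 0 (unit (E := E) G y) where
  lin a r g g' b := by cases a <;> simp [Fnl.unit, Chain.append]
  homog s n hn := by
    cases s with
    | nil => exact single_of_ne (by simpa using hn) _
    | cons => rfl
  one a b := by cases a <;> rfl

variable {G' : D.Obj → E.Obj} {η : ∀ y, Fnl D E G' (G y) y} {p : ℤ}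

theorem IsMulti.conv (hη : ∀ y, IsMulti (η y)) {y : D.Obj}
    {θ : Fnl D E G e y} (h : IsMulti θ) : IsMulti (conv p η θ) := by
  refine ⟨fun {w x z m} a r g g' b => ?_⟩
  induction a with
  | nil y =>
    simp only [Chain.append]
    rw [conv_cons, conv_cons, conv_cons, h.sh_lin, (hη y).lin_nil]
    simp only [map_add, map_smul, LinearMap.add_apply, LinearMap.smul_apply, Pi.add_apply,
      Pi.smul_apply, Chain.deg_cons]
    module
  | @cons u v _ n l a ih =>
    simp only [Chain.append]
    rw [conv_cons, conv_cons, conv_cons, ih (h.sh l), (hη u).lin_cons]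
    simp only [map_add, map_smul, LinearMap.add_apply, LinearMap.smul_apply, Chain.deg_cons,
      Chain.deg_append]
    module

theorem IsNormalized.conv {q r : ℤ} (hr : p + q = r) (hη : ∀ y, IsNormalized p (η y)) {y : D.Obj}
    {θ : Fnl D E G e y} (h : IsNormalized q θ) : IsNormalized r (conv p η θ) where
  toIsMulti := IsMulti.conv (fun y => (hη y).toIsMulti) h.toIsMulti
  homog {z} s n hn := by
    induction s generalizing q r n with
    | nil y =>
      rw [conv_nil]
      refine tcomp_homog _ _ (q := q) (fun i hi => h.homog _ _ (by simpa using hi)) _ (by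
        simp only [Chain.deg_nil] at hn; omega)
    | @cons x y z m g s ih =>
      rw [conv_cons, Pi.add_apply, Pi.smul_apply, ih rfl (h.sh rfl g) n (by
        simp only [Chain.deg_cons] at hn; omega), smul_zero, zero_add]
      exact tcomp_homog _ _ (q := q) (fun i hi => h.homog _ _ (by simpa using hi)) _ (by omega)
  one {w z} a b := by
    induction a generalizing q r with
    | nil y =>
      simp only [Chain.append]
      have : Fnl.sh (D.one y) θ = 0 := by
        funext w s
        exact h.one (.nil y) s
      rw [conv_cons, this, (hη y).one_nil]
      simp
    | @cons x y z m g a ih =>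
      simp only [Chain.append]
      rw [conv_cons, ih rfl (h.sh rfl g), (hη x).one_cons]
      simp

end

section

variable {e : E.Obj} (G : DGFunctor D E)

theorem IsMulti.act_lin {x y : D.Obj} {m : ℤ} {θ : Fnl D E G.obj e x} (h : IsMulti θ)
    (r : k) (g g' : D.Hom x y m) : act G (r • g + g') θ = r • act G g θ + act G g' θ := by
  funext z s
  cases s with
  | nil => simp
  | cons l s =>
    simp only [Pi.add_apply, Pi.smul_apply, act_cons, map_add, map_smul]
    exact h.lin (.nil x) _ _ _ _

theorem IsMulti.act {x y : D.Obj} {m : ℤ} {θ : Fnl D E G.obj e x} (h : IsMulti θ)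
    (g : D.Hom x y m) : IsMulti (act G g θ) := by
  refine ⟨fun a r l l' b => ?_⟩
  cases a with
  | nil =>
    simp only [Chain.append, act_cons, map_add, map_smul, LinearMap.add_apply, LinearMap.smul_apply]
    exact h.lin (.nil x) _ _ _ _
  | cons f a => exact h.lin (.cons (D.comp rfl f g) a) _ _ _ _

theorem IsMulti.diff {y : D.Obj} {θ : Fnl D E G.obj e y} (h : IsMulti θ) : IsMulti (diff G θ) := by
  refine ⟨fun {w x z m} a r g g' b => ?_⟩
  induction a with
  | nil y =>
    simp only [Chain.append]
    rw [diff_cons _ rfl, diff_cons _ rfl, diff_cons _ rfl, h.sh_lin, h.act_lin, map_add, map_smul,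
      map_add, map_smul, h.lin_nil]
    simp only [Pi.add_apply, Pi.smul_apply]
    module
  | @cons u v _ n l a ih =>
    simp only [Chain.append]
    rw [diff_cons _ rfl, diff_cons _ rfl, diff_cons _ rfl, ih (h.sh l), (h.act G l).lin,
      h.lin_cons]
    module

/-- Multilinearity enters when d(l ∘ g) in the first slot is expanded by the Leibniz rule. -/
theorem diff_act {x y : D.Obj} {m n : ℤ} (hn : m + 1 = n) {θ : Fnl D E G.obj e x} (h : IsMulti θ)
    (g : D.Hom x y m) : Fnl.diff G (Fnl.act G g θ) =
      Fnl.act G (D.d m n hn g) θ + sg k m • Fnl.act G g (Fnl.diff G θ) := by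
  subst hn
  refine ext_chain ?_ fun {z j} l => ?_
  · simp only [diff_nil, act_nil, Pi.add_apply, Pi.smul_apply, td_tcomp, td_single rfl, G.map_d]
  · have key : Fnl.sh (D.d (j + m) (j + m + 1) rfl (D.comp rfl l g)) θ =
        Fnl.sh (D.comp rfl (D.d j (j + 1) rfl l) g) θ +
          sg k j • Fnl.sh (D.comp rfl l (D.d m (m + 1) rfl g)) θ := by
      rw [D.leibniz rfl rfl rfl rfl (by omega) (by omega), negOnePow_smul_eq_sg (k := k),
        h.sh_add_smul]
      funext w s
      simp only [Pi.add_apply, Pi.smul_apply, sh_apply]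
      rw [Chain.cons_comp_congr _ rfl, Chain.cons_comp_congr _ rfl (n' := j + (m + 1))]
    rw [sh_diff _ rfl, sh_act, act_act, sh_act, map_add, map_smul, sh_act, sh_act, sh_diff _ rfl, key]
    simp only [sg_add, sg_sub, sg_one]
    by_cases hj : Even j <;> by_cases hm : Even m <;> simp [sg, hj, hm] <;> abel

/-- Expanding twice in the first morphism `g` leaves a term with d d g = 0, the square for the
shorter chain, and mixed terms which cancel by `diff_act`. -/
theorem diff_diff {y : D.Obj} {θ : Fnl D E G.obj e y} (h : IsMulti θ) :
    Fnl.diff G (Fnl.diff G θ) = 0 := by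
  funext z s
  induction s with
  | nil => exact td_td _
  | @cons x y z m g s ih =>
    have h0 : (Fnl.sh (D.d (m + 1) (m + 1 + 1) rfl (D.d m (m + 1) rfl g)) θ) = 0 := by
      rw [D.d_d]
      funext w t
      exact h.slot_zero (.nil x) t
    have : Fnl.diff G (Fnl.diff G (Fnl.sh g θ)) z s = 0 := ih (h.sh g)
    change Fnl.sh g (Fnl.diff G (Fnl.diff G θ)) z s = 0
    rw [sh_diff _ rfl, sh_diff _ rfl, sh_diff _ rfl]
    simp only [map_add, map_smul, diff_act _ rfl h, h0]
    simp only [Pi.add_apply, Pi.smul_apply, this, Pi.zero_apply]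
    simp only [sg_add, sg_sub, sg_one]
    by_cases hm : Even m <;> simp [sg, hm] <;> abel

/-- Only the action term survives, and an identity acts trivially. The result is nonzero; the source
term `front` will cancel it. -/
theorem IsNormalized.diff_one_cons {p : ℤ} {x z : D.Obj} {θ : Fnl D E G.obj e x} (h : IsNormalized p θ)
    (b : Chain D x z) : Fnl.diff G θ z (.cons (D.one x) b) = - θ z b := by
  have h1 : Fnl.sh (D.one x) θ = 0 := by
    funext w s
    exact h.one (.nil x) s
  have h2 : θ z (.cons (D.d 0 (0 + 1) rfl (D.one x)) b) = 0 := by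
    rw [D.d_one]
    exact h.slot_zero (.nil x) b
  have h3 : Fnl.act G (D.one x) θ z b = θ z b := by
    cases b with
    | nil => rw [act_nil, G.map_one]; exact tcomp_tone_left _
    | cons l b => rw [act_cons, Chain.cons_comp_one]
  rw [diff_cons _ rfl, h1, h2, h3]
  simp [sg]

/-- An identity behind another morphism is multiplied into both of its neighbours, and the two terms
have opposite signs. -/
theorem IsNormalized.diff_one {p : ℤ} {y w x z : D.Obj} {m : ℤ} {θ : Fnl D E G.obj e y}
    (h : IsNormalized p θ) (g : D.Hom y w m) (a : Chain D w x) (b : Chain D x z) :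
    Fnl.diff G θ z (.cons g (a.append (.cons (D.one x) b))) = 0 := by
  rw [diff_cons _ rfl, h.one_cons]
  induction a generalizing p m y θ with
  | nil x =>
    simp only [Chain.append]
    rw [(h.sh rfl g).diff_one_cons, act_cons, Chain.cons_one_comp, sh_apply]
    simp
  | cons l a ih =>
    simp only [Chain.append]
    rw [diff_cons _ rfl, (h.sh rfl g).one_cons, ih (h.sh rfl g) l, act_cons, h.one_cons]
    simp

theorem IsNormalized.diff_homog {p : ℤ} {y z : D.Obj} {θ : Fnl D E G.obj e y}
    (h : IsNormalized p θ) (s : Chain D y z) (n : ℤ) (hn : n ≠ p + 1 + s.deg) :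
    Fnl.diff G θ z s n = 0 := by
  induction s generalizing p with
  | nil y =>
    rw [diff_nil]
    exact td_homog (p := p) _ (fun i hi => h.homog _ _ (by simpa using hi)) _ (by simpa using hn)
  | @cons x y z m g s ih =>
    simp only [Chain.deg_cons] at hn
    have : Fnl.act G g θ z s n = 0 := by
      cases s with
      | nil =>
        rw [act_nil]
        exact tcomp_homog (q := p) _ _ (fun i hi => h.homog _ _ (by simpa using hi)) _ (by
          simp only [Chain.deg_nil] at hn; omega)
      | cons l s => exact h.homog _ _ (by simp only [Chain.deg_cons] at hn ⊢; omega)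
    rw [diff_cons _ rfl, Pi.smul_apply, Pi.add_apply, Pi.add_apply, this,
      ih (h.sh rfl g) (by omega), h.homog _ _ (by simp only [Chain.deg_cons]; omega)]
    simp

end

section

variable (p : ℤ) {F G : DGFunctor D E} (η : ∀ y, Fnl D E G.obj (F.obj y) y)

/-- The part of the differential of a family of functionals which involves its source. -/
noncomputable def front (x : D.Obj) : Fnl D E G.obj (F.obj x) x
  | _, .nil _ => 0
  | z, .cons (y := y) (m := m) g s =>
      sg k ((p + 1) * m) • tcomp (p + s.deg) (η y z s) (single m (F.map g))

@[simp] theorem front_nil (x : D.Obj) : front p η x x (.nil x) = 0 := rfl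

theorem front_cons {x y z : D.Obj} {m : ℤ} (g : D.Hom x y m) (s : Chain D y z) :
    front p η x z (.cons g s) =
      sg k ((p + 1) * m) • tcomp (p + s.deg) (η y z s) (single m (F.map g)) := rfl

theorem sh_front {x y : D.Obj} {m : ℤ} (g : D.Hom x y m) :
    sh g (front p η x) = sg k ((p + 1) * m) • rmul p (η y) (single m (F.map g)) := rfl

/-- The differential of a family of functionals of degree `p`. -/
noncomputable def cdiff (x : D.Obj) : Fnl D E G.obj (F.obj x) x := diff G (η x) + front p η x

variable {p η}

/-- As `diff` squares to zero, it remains to see that `diff` of the source term cancels the source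
term of `cdiff`. -/
theorem cdiff_cdiff {q : ℤ} (hq : p + 1 = q) (h : ∀ y, IsMulti (η y)) (x : D.Obj) :
    cdiff q (cdiff p η) x = 0 := by
  subst hq
  have key : diff G (front p η x) = - front (p + 1) (cdiff p η) x := by
    refine ext_chain ?_ fun {y m} g => ?_
    · simp only [diff_nil, front_nil, Pi.neg_apply]
      rw [map_zero, neg_zero]
    · have hact : act G g (front p η x) = sg k ((p + 1) * m) •
          rmul (p + 1) (front p η y) (single m (F.map g)) := by
        refine ext_chain ?_ fun {z j} l => ?_
        · simp only [act_nil, front_nil, Pi.smul_apply, rmul_apply, map_zero, LinearMap.zero_apply,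
            smul_zero]
        · rw [sh_act, sh_front, map_smul, sh_rmul _ _ rfl, sh_front]
          funext w t
          simp only [Pi.smul_apply, rmul_apply, map_smul, LinearMap.smul_apply]
          rw [tcomp_congr (show p + 1 + (j - 1) + t.deg = p + t.deg + j by omega),
            ← tcomp_assoc (p + t.deg) j _ rfl, tcomp_single rfl, ← F.map_comp rfl]
          simp only [sg_add, sg_succ_mul]
          by_cases hp : Even p <;> by_cases hm : Even m <;> by_cases hj : Even j <;>
          simp [sg, hp, hm, hj]
      rw [sh_diff _ rfl, map_neg, sh_front, sh_front, sh_front, hact, map_smul, diff_rmul,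
        td_single rfl, F.map_d _ _ rfl]
      simp only [cdiff, map_add, LinearMap.add_apply]
      simp only [sg_succ_succ_mul]
      simp only [sg_succ_mul]
      simp only [sg_add, sg_sub, sg_one]
      by_cases hp : Even p <;> by_cases hm : Even m <;>
      simp [sg, hp, hm] <;> abel
  rw [cdiff, cdiff, map_add, diff_diff _ (h x), key, zero_add]
  exact neg_add_cancel _

/-- A Leibniz rule in which only `η` contributes its source term: the source term of `θ` is composed
on the far side and does not interact with the convolution. -/
theorem diff_conv {e : E.Obj} {F : DGFunctor D E} {η : ∀ y, Fnl D E G.obj (F.obj y) y}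
    {x : D.Obj} (θ : Fnl D E F.obj e x) :
    diff G (conv p η θ) = conv (p + 1) (cdiff p η) θ + sg k p • conv p η (diff F θ) := by
  funext z s
  induction s with
  | nil => 
    simp only [diff_nil, conv_nil, Pi.add_apply, Pi.smul_apply, td_tcomp, cdiff, front_nil, add_zero]
  | @cons x y z m g s ih =>
    -- Convolving `η` with the action of `g` on `θ` has one surplus term, η(s) ∘ F g ∘ θ(), from the
    -- cut which leaves `θ` the empty chain. It is subtracted here and matches the source term of
    -- `cdiff p η`.
    have hact : act G g (conv p η θ) = rmul (p + m) (act G g (η x)) (θ x (.nil x)) +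
        sg k (p * m) • (conv p η (act F g θ) -
          rmul p (η y) (tcomp m (single m (F.map g)) (θ x (.nil x)))) := by
      refine ext_chain ?_ fun {w j} l => ?_
      · simp only [act_nil, conv_nil, Pi.add_apply, Pi.smul_apply, Pi.sub_apply, rmul_apply,
          Chain.deg_nil, add_zero]
        rw [tcomp_assoc _ _ (p + m) (by omega)]
        simp
      · rw [sh_act, sh_conv _ _ rfl, map_add, map_smul, map_sub, sh_rmul _ _ rfl,
          sh_rmul _ _ rfl, sh_conv _ _ rfl, sh_act, sh_act, act_nil]
        simp only [add_sub_cancel_right]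
        rw [show p + m + (j - 1) = p + (j + m - 1) by omega]
        simp only [sg_add, sg_sub, sg_one, sg_mul]
        by_cases hp : Even p <;> by_cases hm : Even m <;> by_cases hj : Even j <;>
        simp [sg, hp, hm, hj] <;> abel
    change sh g (diff G (conv p η θ)) z s =
      sh g (conv (p + 1) (cdiff p η) θ + sg k p • conv p η (diff F θ)) z s
    rw [sh_diff _ rfl, sh_conv _ _ rfl,
      sh_conv _ _ rfl, hact, map_add, map_smul, map_add, map_smul,
      sh_conv _ _ rfl, diff_rmul, sh_conv _ _ rfl, sh_diff _ rfl]
    simp only [cdiff, diff_nil, map_add, map_smul] 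
    rw [sh_diff _ rfl, sh_front]
    have ih' := ih (sh g θ)
    have hr : rmul p (η y) (tcomp m (single m (F.map g)) (θ x (.nil x))) =
        rmul (p + m) (rmul p (η y) (single m (F.map g))) (θ x (.nil x)) := by
      funext w t
      simp only [rmul_apply]
      exact tcomp_assoc _ _ _ (by omega) _ _ _
    rw [hr, show p + (m + 1 - 1) = p + m by omega, show p + 1 + (m - 1) = p + m by omega,
      show p + (m - 1) + 1 = p + m by omega]
    simp only [Pi.add_apply, Pi.smul_apply, map_add, map_smul, LinearMap.add_apply,
      LinearMap.smul_apply, ih', Pi.sub_apply]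
    simp only [sg_succ_mul]
    simp only [sg_add, sg_sub, sg_one, sg_mul]
    by_cases hp : Even p <;> by_cases hm : Even m <;>
    simp [sg, hp, hm] <;> abel

end

end Fnl

end Coherent

/-! ### The dg category of dg functors and coherent natural transformations -/

section CoherentCategory

variable {k : Type u} [Field k] {D E : DGCat.{u} k}

open DGCat

namespace Fnl

section

variable {e : E.Obj} (p : ℤ) {G G' : D.Obj → E.Obj}

theorem conv_lin_left (r : k) (η ζ : ∀ y, Fnl D E G' (G y) y) {y : D.Obj} (θ : Fnl D E G e y) :
    conv p (r • η + ζ) θ = r • conv p η θ + conv p ζ θ := by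
  funext z s
  induction s with
  | nil y => simp
  | cons g s ih =>
    simp only [conv_cons, Pi.add_apply, Pi.smul_apply, ih, map_add, map_smul, LinearMap.add_apply,
      LinearMap.smul_apply]
    module

end

section

variable {p : ℤ} {F G : DGFunctor D E} {η : ∀ y, Fnl D E G.obj (F.obj y) y}

theorem front_lin (r : k) (η ζ : ∀ y, Fnl D E G.obj (F.obj y) y) :
    front p (r • η + ζ) = r • front p η + front p ζ := by
  funext x z s
  cases s with
  | nil => simp
  | cons g s =>
    simp only [front_cons, Pi.add_apply, Pi.smul_apply, map_add, map_smul, LinearMap.add_apply,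
      LinearMap.smul_apply]
    module

theorem cdiff_lin (r : k) (η ζ : ∀ y, Fnl D E G.obj (F.obj y) y) :
    cdiff p (r • η + ζ) = r • cdiff p η + cdiff p ζ := by
  funext x
  simp only [cdiff, front_lin, Pi.add_apply, Pi.smul_apply, map_add, map_smul]
  module

/-- The delicate clause is normalization: for an identity in first position the action term and the
source term cancel, and for later positions `diff_one` applies. -/
theorem IsNormalized.cdiff {q : ℤ} (hq : p + 1 = q) (h : ∀ y, IsNormalized p (η y)) (x : D.Obj) :
    IsNormalized q (cdiff p η x) where
  lin {w y z m} a r g g' b := by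
    subst hq
    have h1 := ((h x).toIsMulti.diff G).lin a r g g' b
    have h2 : front p η x z (a.append (.cons (r • g + g') b)) =
        r • front p η x z (a.append (.cons g b)) + front p η x z (a.append (.cons g' b)) := by
      cases a with
      | nil =>
        simp only [Chain.append, front_cons, map_add, map_smul]
        module
      | cons l a =>
        simp only [Chain.append, front_cons, map_add, map_smul, (h _).lin, Chain.deg_append,
          Chain.deg_cons, LinearMap.add_apply, LinearMap.smul_apply]
        module
    simp only [Fnl.cdiff, Pi.add_apply, h1, h2]
    module
  homog {z} s n hn := by
    subst hq
    have h2 : front p η x z s n = 0 := by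
      cases s with
      | nil => rfl
      | @cons _ y _ m g s =>
        rw [front_cons, Pi.smul_apply, tcomp_homog (q := m), smul_zero]
        · intro i hi
          exact single_of_ne hi _
        · simp only [Chain.deg_cons] at hn
          omega
    rw [Fnl.cdiff, Pi.add_apply, Pi.add_apply, Pi.add_apply, h2, (h x).diff_homog _ s n hn, add_zero]
  one {w z} a b := by
    rw [Fnl.cdiff, Pi.add_apply, Pi.add_apply]
    cases a with
    | nil =>
      simp only [Chain.append]
      rw [(h x).diff_one_cons, front_cons, F.map_one]
      change _ + _ • tcomp _ _ (tone _) = _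
      rw [tcomp_tone_right _ _ ((h x).homog b)]
      simp [sg]
    | cons g a =>
      simp only [Chain.append]
      rw [(h x).diff_one, front_cons, (h _).one]
      simp

/-- Composition at the source takes place on the side of `ζ`, so convolution with `η` passes through
it up to sign. -/
theorem front_conv {q r : ℤ} (hr : p + q = r) {F' : DGFunctor D E}
    (ζ : ∀ y, Fnl D E F.obj (F'.obj y) y) (x : D.Obj) :
    front r (fun y => conv p η (ζ y)) x = sg k p • conv p η (front q ζ x) := by
  subst hr
  refine ext_chain ?_ fun {y m} g => ?_
  · simp
  · rw [map_smul, sh_conv _ _ rfl, sh_front, sh_front, front_nil, map_zero, add_zero, map_smul,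
      conv_rmul _ _ _ _ rfl]
    rw [show (p + q + 1) * m = p * m + (q + 1) * m by ring]
    simp only [sg_add, sg_sub, sg_one, sg_mul]
    by_cases hp : Even p <;> by_cases hm : Even m <;> simp [sg, hp, hm]

theorem cdiff_conv {q r : ℤ} (hr : p + q = r) {F' : DGFunctor D E}
    (ζ : ∀ y, Fnl D E F.obj (F'.obj y) y) (x : D.Obj) :
    cdiff r (fun y => conv p η (ζ y)) x =
      conv (p + 1) (cdiff p η) (ζ x) + sg k p • conv p η (cdiff q ζ x) := by
  rw [cdiff, diff_conv, front_conv hr]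
  simp only [cdiff, map_add]
  module

end

end Fnl

/-- The coherent natural transformations of degree `p`. -/
def coherentHom (F G : DGFunctor D E) (p : ℤ) :
    Submodule k (∀ y, Fnl D E G.obj (F.obj y) y) where
  carrier := {η | ∀ y, Fnl.IsNormalized p (η y)}
  add_mem' h h' y := (h y).add (h' y)
  zero_mem' _ := Fnl.IsNormalized.zero
  smul_mem' c _ h y := (h y).smul c

variable (D E) in
/-- The dg category of dg functors from `D` to `E` and coherent natural transformations. -/
noncomputable def coherent : DGCat.{u} k where
  Obj := DGFunctor D E
  Hom F G p := coherentHom F G p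
  d n m h :=
    { toFun := fun η => ⟨Fnl.cdiff n η.1, Fnl.IsNormalized.cdiff h η.2⟩
      map_add' := fun η ζ => Subtype.ext (by
        have := Fnl.cdiff_lin (p := n) 1 η.1 ζ.1
        rwa [one_smul, one_smul] at this)
      map_smul' := fun r η => Subtype.ext (by
        have h := Fnl.cdiff_lin (p := n) r η.1 0
        have h' := Fnl.cdiff_lin (p := n) 0 η.1 0
        -- This forces the value of `cdiff` at 0 to vanish, which turns `h` into homogeneity.
        have h'' := Fnl.cdiff_lin (p := n) 1 η.1 0
        simp only [zero_smul, zero_add, one_smul, add_zero] at h h' h''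
        simpa [left_eq_add.1 h''] using h) }
  one F := ⟨Fnl.unit F.obj, Fnl.IsNormalized.unit⟩
  comp {_ _ _ j _ _} h :=
    LinearMap.mk₂ k (fun η ζ => ⟨fun y => Fnl.conv j η.1 (ζ.1 y), fun y => (ζ.2 y).conv h η.2⟩)
      (fun η η' ζ => Subtype.ext (funext fun y => by
        have := Fnl.conv_lin_left j 1 η.1 η'.1 (ζ.1 y)
        rwa [one_smul, one_smul] at this))
      (fun r η ζ => Subtype.ext (funext fun y => by
        have h := Fnl.conv_lin_left j r η.1 0 (ζ.1 y)
        have h'' := Fnl.conv_lin_left j 1 η.1 0 (ζ.1 y)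
        simp only [one_smul, add_zero] at h h''
        simpa [left_eq_add.1 h''] using h))
      (fun η ζ ζ' => Subtype.ext (funext fun y => map_add _ _ _))
      (fun r η ζ => Subtype.ext (funext fun y => (Fnl.conv j η.1).map_smul r (ζ.1 y)))
  d_d n m l h h' η := Subtype.ext (funext fun y =>
    Fnl.cdiff_cdiff h (fun y => (η.2 y).toIsMulti) y)
  one_comp h η := Subtype.ext (funext fun y => Fnl.unit_conv _)
  comp_one h η := Subtype.ext (funext fun y => Fnl.conv_unit _ _ (η.2 y).homog)
  assoc h₁ h₂ h₃ h₄ a b c := Subtype.ext (funext fun y => (Fnl.conv_assoc _ _ _ _ h₁ _ _).symm)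
  leibniz {_ _ _ j i n j' i' n'} h hn hj hi h₁ h₂ η ζ := Subtype.ext (funext fun y => by
    subst hj
    rw [negOnePow_smul_eq_sg (k := k)]
    exact Fnl.cdiff_conv h ζ.1 y)

end CoherentCategory

/-! ### The defining relations as identities of cochains -/

section Adjunction

variable {k : Type u} [Field k] {C D E : DGCat.{u} k}

open DGCat

namespace Chain

theorem append_assoc {x y z w : D.Obj} (a : Chain D x y) (b : Chain D y z) (c : Chain D z w) :
    (a.append b).append c = a.append (b.append c) := by
  induction a with
  | nil => rfl
  | cons g a ih => simp only [append, ih]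

theorem snoc_append {x y z w : D.Obj} {m : ℤ} (a : Chain D x y) (g : D.Hom y z m)
    (b : Chain D z w) : (a.snoc g).append b = a.append (cons g b) := by
  rw [snoc, append_assoc]
  rfl

theorem append_nil {x y : D.Obj} (a : Chain D x y) : a.append (nil y) = a := by
  induction a with
  | nil => rfl
  | cons g a ih => simp only [append, ih]

end Chain

namespace Fnl

/-- Evaluation on the chains which begin with `a`. -/
def shc {G : D.Obj → E.Obj} {e : E.Obj} {x y : D.Obj} (a : Chain D x y) :
    Fnl D E G e x →ₗ[k] Fnl D E G e y where
  toFun θ z s := θ z (a.append s)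
  map_add' _ _ := rfl
  map_smul' _ _ := rfl

theorem shc_apply {G : D.Obj → E.Obj} {e : E.Obj} {x y z : D.Obj} (a : Chain D x y)
    (θ : Fnl D E G e x) (s : Chain D y z) : shc a θ z s = θ z (a.append s) := rfl

theorem sh_shc {G : D.Obj → E.Obj} {e : E.Obj} {x y z : D.Obj} {m : ℤ} (a : Chain D x y)
    (g : D.Hom y z m) (θ : Fnl D E G e x) : sh g (shc a θ) = shc (a.snoc g) θ := by
  funext w s
  rw [sh_apply, shc_apply, shc_apply, Chain.snoc_append]

end Fnl

namespace TwistedPreData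

/-- The interpretation of the symbols given by a family of dg functors and the values of the symbols
`ε(f; g₁, …, gₙ)`. -/
abbrev ofFunctors (R : C.Obj → DGFunctor D E)
    (ε : ∀ {c c' : C.Obj} {p : ℤ} {y y' : D.Obj} (_ : C.Hom c c' p) (s : Chain D y y') (n : ℤ),
      p + s.deg = n → E.Hom ((R c).obj y) ((R c').obj y') n) : TwistedPreData C D E where
  obj x := (R x.1).obj x.2
  right c _ _ _ g := (R c).map g
  eps := ε

/-- The functionals on chains given by the symbols `ε(f; g₁, …, gₙ)`. -/
noncomputable def fnl (T : TwistedPreData C D E) {c c' : C.Obj} {p : ℤ} (f : C.Hom c c' p)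
    (x : D.Obj) : Fnl D E (fun z => T.obj (c', z)) (T.obj (c, x)) x :=
  fun _ s n => if h : p + s.deg = n then sg k (p * s.deg) • T.eps f s n h else 0

theorem fnl_apply (T : TwistedPreData C D E) {c c' : C.Obj} {p : ℤ} (f : C.Hom c c' p)
    {x z : D.Obj} (s : Chain D x z) (n : ℤ) (h : p + s.deg = n) :
    T.fnl f x z s n = sg k (p * s.deg) • T.eps f s n h := by
  rw [fnl, dif_pos h]

/-- The sign (-1)^{|f| deg s} translates the conventions of relations 3 and 4 into those of
`Fnl.conv` and `Fnl.cdiff`. -/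
theorem eps_eq (T : TwistedPreData C D E) {c c' : C.Obj} {p : ℤ} (f : C.Hom c c' p)
    {x z : D.Obj} (s : Chain D x z) (n : ℤ) (h : p + s.deg = n) :
    T.eps f s n h = sg k (p * s.deg) • T.fnl f x z s n := by
  rw [fnl_apply _ _ _ _ h, smul_smul, sg_mul_self, one_smul]

/-- The chain `a` is already allotted to `f₁`, so the cuts of `b` give a convolution with the
functional of `f₁` shifted by `a`. For `a` empty the sign is the one relating `eps` and `fnl` for
the composite `f₂ ∘ f₁`. -/
theorem splitSum_eq (T : TwistedPreData C D E) {c c' c'' : C.Obj} {p₂ p₁ : ℤ}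
    (f₂ : C.Hom c' c'' p₂) (f₁ : C.Hom c c' p₁) {x y z : D.Obj} (a : Chain D x y)
    (b : Chain D y z) (n : ℤ) (h : (p₂ + p₁) + (a.deg + b.deg) = n) :
    T.splitSum f₂ f₁ a b n h = sg k ((p₂ + p₁) * b.deg + p₁ * a.deg) •
      Fnl.conv p₂ (T.fnl f₂) (Fnl.shc a (T.fnl f₁ x)) z b n := by
  induction b with
  | nil y =>
    rw [splitSum, Fnl.conv_nil,
      tcomp_congr (q := p₂ + (Chain.nil y : Chain D y y).deg) (by simp),
      tcomp_apply (i := p₁ + a.deg) (by simp at h ⊢; omega),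
      Fnl.shc_apply, Chain.append_nil, fnl_apply _ f₁ _ _ rfl, fnl_apply _ f₂ _ _ rfl,
      map_smul, map_smul, LinearMap.smul_apply, smul_smul, smul_smul]
    simp only [Chain.deg_nil, mul_zero, zero_add, sg_mul_self]
    simp [sg]
  | @cons y w z m g b ih =>
    rw [splitSum, ih, Fnl.conv_cons, Fnl.sh_shc, Pi.add_apply, Pi.smul_apply,
      tcomp_apply (i := p₁ + a.deg) (by simp at h ⊢; omega),
      Fnl.shc_apply, Chain.append_nil, fnl_apply _ f₁ _ _ rfl, fnl_apply _ f₂ _ _ rfl,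
      map_smul, map_smul, LinearMap.smul_apply, negOnePow_smul_eq_sg (k := k), add_comm, smul_add]
    simp only [Chain.deg_cons, Chain.deg_snoc]
    congr 1
    · rw [smul_smul]
      congr 1
      simp only [add_mul, mul_add, mul_sub, sg_add, sg_sub, sg_mul]
      by_cases hp : Even p₁ <;> by_cases hq : Even p₂ <;> by_cases hm : Even m <;>
      by_cases hb : Even b.deg <;> by_cases ha : Even a.deg <;> simp [sg, hp, hq, hm, hb, ha]
    · simp only [smul_smul]
      congr 1
      simp only [add_mul, mul_add, mul_sub, sg_add, sg_sub, sg_mul]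
      by_cases hp : Even p₁ <;> by_cases hq : Even p₂ <;> by_cases hm : Even m <;>
      by_cases hb : Even b.deg <;> by_cases ha : Even a.deg <;> simp [sg, hp, hq, hm, hb, ha]

section

variable (R : C.Obj → DGFunctor D E)
    (ε : ∀ {c c' : C.Obj} {p : ℤ} {y y' : D.Obj} (_ : C.Hom c c' p) (s : Chain D y y') (n : ℤ),
      p + s.deg = n → E.Hom ((R c).obj y) ((R c').obj y') n)

theorem diffSum_cons {c c' : C.Obj} {p : ℤ} (f : C.Hom c c' p) {x y z w : D.Obj} {m : ℤ}
    (a : Chain D x y) (g : D.Hom y z m) (b : Chain D z w) (n : ℤ)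
    (h : p + (a.deg + (Chain.cons g b).deg) + 1 = n) :
    (ofFunctors R ε).diffSum f a (.cons g b) n h =
      sg k (p + b.deg) • ε f (a.append (.cons (D.d m (m + 1) rfl g) b)) n
        (by simp only [Chain.deg_cons, Chain.deg_append] at *; omega) +
      (ofFunctors R ε).diffSum f (a.snoc g) b n
        (by simp only [Chain.deg_cons, Chain.deg_snoc] at *; omega) := by
  rw [← negOnePow_smul_eq_sg]
  rfl

theorem mulSum_cons {c c' : C.Obj} {p : ℤ} (f : C.Hom c c' p) {x y z v w : D.Obj} {m m' : ℤ}
    (a : Chain D x y) (g : D.Hom y z m) (g' : D.Hom z v m') (b : Chain D v w) (n : ℤ)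
    (h : p + (a.deg + ((m - 1) + (Chain.cons g' b).deg)) + 1 = n) :
    (ofFunctors R ε).mulSum f a g (.cons g' b) n h =
      sg k (p + ((m' - 1) + b.deg)) • ε f (a.append (.cons (D.comp rfl g' g) b)) n
        (by simp only [Chain.deg_cons, Chain.deg_append] at *; omega) +
      (ofFunctors R ε).mulSum f (a.snoc g) g' b n
        (by simp only [Chain.deg_cons, Chain.deg_snoc] at *; omega) := by
  rw [← negOnePow_smul_eq_sg]
  rfl

theorem lastTerm_nil {c c' : C.Obj} {p : ℤ} (f : C.Hom c c' p) {x y z : D.Obj} {m : ℤ}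
    (a : Chain D x y) (g : D.Hom y z m) (n : ℤ)
    (h : p + (a.deg + ((m - 1) + (Chain.nil z : Chain D z z).deg)) + 1 = n) :
    (ofFunctors R ε).lastTerm f a g (.nil z) n h =
      sg k (p * m + p) • E.comp (by simp only [Chain.deg_nil] at *; omega) ((R c').map g)
        (ε f a _ rfl) := by
  rw [← negOnePow_smul_eq_sg]
  rfl

/-- Here `a` is the part of the chain already passed, and the terms of relation 4 concerning `g` and
`b` obey the recursion which defines `Fnl.diff`. The induction on `b` moves `g` to the end of `a`.
-/
theorem diff_eq {c c' : C.Obj} {p : ℤ} (f : C.Hom c c' p) {x y z w : D.Obj}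
    (θ : Fnl D E (R c').obj ((R c).obj x) x)
    (hθ : ∀ {z : D.Obj} (s : Chain D x z) (n : ℤ) (h : p + s.deg = n),
      ε f s n h = sg k (p * s.deg) • θ z s n) {m : ℤ}
    (a : Chain D x y) (g : D.Hom y z m) (b : Chain D z w) (i n : ℤ) (hn : i + 1 = n)
    (h : p + (a.append (.cons g b)).deg = i)
    (h₁ : p + (a.deg + (Chain.cons g b).deg) + 1 = n)
    (h₂ : p + (a.deg + ((m - 1) + b.deg)) + 1 = n) :
    E.d i n hn (ε f (a.append (.cons g b)) i h) +
      (ofFunctors R ε).diffSum f a (.cons g b) n h₁ +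
      ((ofFunctors R ε).lastTerm f a g b n h₂ + (ofFunctors R ε).mulSum f a g b n h₂) =
    sg k ((p + 1) * (Chain.cons g b).deg + p * a.deg) •
      Fnl.diff (R c') (Fnl.shc a θ) w (.cons g b) n := by
  induction b generalizing y m with
  | nil z =>
    rw [diffSum_cons, lastTerm_nil, Fnl.diff_cons _ rfl, Fnl.sh_shc,
      Fnl.diff_nil, Fnl.act_nil, Fnl.shc_apply, Fnl.shc_apply, Fnl.shc_apply, Chain.append_nil,
      Chain.append_nil, Pi.smul_apply, Pi.add_apply, Pi.add_apply, td_apply hn,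
      tcomp_apply (p := m) (i := p + a.deg) (by simp at h; omega), single_same,
      hθ, hθ, hθ, map_smul, map_smul]
    change _ + (_ + 0) + (_ + 0) = _
    rw [add_zero, add_zero, Chain.snoc]
    simp only [smul_add, smul_smul, Chain.deg_cons, Chain.deg_nil, Chain.deg_append]
    rw [← add_assoc]
    simp only [add_mul, mul_add, mul_sub, sg_add, sg_sub, sg_mul, one_mul]
    by_cases hp : Even p <;> by_cases hm : Even m <;>
    by_cases ha : Even a.deg <;> simp [sg, hp, hm, ha, add_assoc]
  | @cons z v w j l b ih =>
    have ih' := ih (a.snoc g) l (by simp at h ⊢; omega) (by simp at h ⊢; omega)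
      (by simp at h ⊢; omega)
    rw [hθ, Chain.snoc_append] at ih'
    -- Multiplying by the sign once more isolates `Fnl.diff` at the shorter chain.
    have hs := congrArg (sg k ((p + 1) * (Chain.cons l b).deg + p * (a.snoc g).deg) • ·) ih'
    simp only [smul_smul, sg_mul_self, one_smul] at hs
    rw [diffSum_cons, mulSum_cons, Fnl.diff_cons _ rfl, Fnl.sh_shc, Fnl.act_cons, Pi.smul_apply,
      Pi.add_apply, Pi.add_apply, Fnl.shc_apply, Fnl.shc_apply, hθ, hθ, hθ, ← hs]
    change _ + _ + ((ofFunctors R ε).lastTerm f (a.snoc g) l b n _ + _) = _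
    simp only [Chain.deg_cons, Chain.deg_append, Chain.deg_snoc]
    simp only [add_mul, mul_add, mul_sub, sg_add, sg_sub, sg_mul, one_mul]
    by_cases hp : Even p <;> by_cases hm : Even m <;> by_cases hj : Even j <;>
    by_cases ha : Even a.deg <;> by_cases hb : Even b.deg <;>
    simp [sg, hp, hm, ha, hb, hj] <;> abel

theorem firstTerm_eq {c c' : C.Obj} {p : ℤ} (f : C.Hom c c' p)
    (η : ∀ x, Fnl D E (R c').obj ((R c).obj x) x)
    (hη : ∀ {x z : D.Obj} (s : Chain D x z) (n : ℤ) (h : p + s.deg = n),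
      ε f s n h = sg k (p * s.deg) • η x z s n) {x y z : D.Obj} {m : ℤ}
    (g : D.Hom x y m) (s : Chain D y z) (n : ℤ) (h : p + ((m - 1) + s.deg) + 1 = n) :
    (ofFunctors R ε).firstTerm f g s n h = sg k ((p + 1) * (Chain.cons g s).deg) •
      Fnl.front (F := R c) (G := R c') p η x z (.cons g s) n := by
  have e : (ofFunctors R ε).firstTerm f g s n h =
      sg k (p + s.deg + 1) • E.comp (by omega) (ε f s _ rfl) ((R c).map g) := by
    rw [← negOnePow_smul_eq_sg]
    rfl
  rw [e, Fnl.front_cons, Pi.smul_apply, tcomp_apply (i := m) (by omega), single_same,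
    hη, map_smul, LinearMap.smul_apply, smul_smul, smul_smul]
  congr 1
  simp only [Chain.deg_cons, add_mul, mul_add, mul_sub, sg_add, sg_sub, sg_mul, one_mul]
  by_cases hp : Even p <;> by_cases hm : Even m <;> by_cases hs : Even s.deg <;>
  simp [sg, hp, hm, hs]

/-- In relation 4 the composite with `id ⊗ g₁` at the source is `Fnl.front`; all other terms on the
right-hand side make up `Fnl.diff`. -/
theorem cdiff_eq {c c' : C.Obj} {p : ℤ} (f : C.Hom c c' p)
    (η : ∀ x, Fnl D E (R c').obj ((R c).obj x) x)
    (hη : ∀ {x z : D.Obj} (s : Chain D x z) (n : ℤ) (h : p + s.deg = n),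
      ε f s n h = sg k (p * s.deg) • η x z s n) {x y z : D.Obj} {m : ℤ}
    (g : D.Hom x y m) (s : Chain D y z) (n n' : ℤ) (hn : n + 1 = n')
    (h : p + (Chain.cons g s).deg = n)
    (h₂ : p + ((Chain.nil x : Chain D x x).deg + (Chain.cons g s).deg) + 1 = n')
    (h₃ : p + ((Chain.nil x : Chain D x x).deg + ((m - 1) + s.deg)) + 1 = n')
    (h₄ : p + ((m - 1) + s.deg) + 1 = n') :
    E.d n n' hn (ε f (.cons g s) n h) +
      (ofFunctors R ε).diffSum f (.nil x) (.cons g s) n' h₂ +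
      ((ofFunctors R ε).lastTerm f (.nil x) g s n' h₃ + (ofFunctors R ε).firstTerm f g s n' h₄ +
        (ofFunctors R ε).mulSum f (.nil x) g s n' h₃) =
    sg k ((p + 1) * (Chain.cons g s).deg) •
      Fnl.cdiff (F := R c) (G := R c') p η x z (.cons g s) n' := by
  have h5 := diff_eq R ε f (η x) hη (.nil x) g s n n' hn h h₂ h₃
  rw [Chain.deg_nil, mul_zero, add_zero] at h5
  rw [Fnl.cdiff, Pi.add_apply, Pi.add_apply, Pi.add_apply, smul_add,
    ← firstTerm_eq R ε f η hη g s n' h₄]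
  change _ = sg k _ • Fnl.diff (R c') (Fnl.shc (.nil x) (η x)) z _ _ + _
  rw [← h5]
  change _ = (E.d n n' hn (ε f (.cons g s) n h) + _ + _) + _
  abel

end

end TwistedPreData

end Adjunction

/-! ### Transposition between interpretations and dg functors to `coherent D E` -/

section Adjunction

variable {k : Type u} [Field k] {C D E E' : DGCat.{u} k}

open DGCat

/-- A dg functor, as an object of the dg category of dg functors. -/
def coherent.of (F : DGFunctor D E) : (coherent D E).Obj := F

/-- The coherent natural transformation which is the value of a dg functor. -/
noncomputable def DGFunctor.fnl (Φ : DGFunctor C (coherent D E)) {c c' : C.Obj} {p : ℤ} (f : C.Hom c c' p) :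
    coherentHom (Φ.obj c : DGFunctor D E) (Φ.obj c' : DGFunctor D E) p := Φ.map f

namespace TwistedPreData

/-- The symbols associated with a dg functor to the dg category of dg functors. -/
noncomputable abbrev ofCoherent (Φ : DGFunctor C (coherent D E)) : TwistedPreData C D E :=
  ofFunctors (fun c => (Φ.obj c : DGFunctor D E))
    (fun {_ _ p y y'} f s n _ => sg k (p * s.deg) • (Φ.fnl f).1 y y' s n)

theorem ofCoherent_fnl (Φ : DGFunctor C (coherent D E)) {c c' : C.Obj} {p : ℤ} (f : C.Hom c c' p) :
    (ofCoherent Φ).fnl f = (Φ.fnl f).1 := by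
  funext y z s n
  by_cases h : p + s.deg = n
  · rw [fnl_apply _ _ _ _ h]
    exact (smul_smul _ _ _).trans (by rw [sg_mul_self, one_smul])
  · rw [TwistedPreData.fnl, dif_neg h]
    exact (((Φ.fnl f).2 y).homog s n (Ne.symm h)).symm

end TwistedPreData

/-- The interpretation of the symbols associated with a dg functor to the dg category of dg
functors. -/
noncomputable def TwistedData.ofCoherent (Φ : DGFunctor C (coherent D E)) : TwistedData C D E where
  toTwistedPreData := TwistedPreData.ofCoherent Φ
  right_add c _ _ _ g g' := map_add _ _ _
  right_smul c _ _ _ r g := map_smul _ _ _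
  right_one c y := (Φ.obj c : DGFunctor D E).map_one y
  right_comp c _ _ _ _ _ _ h g g' := (Φ.obj c : DGFunctor D E).map_comp h g g'
  right_d c _ _ n m h g := (Φ.obj c : DGFunctor D E).map_d n m h g
  eps_add_left {_ _ p y y'} f f' s n h := by
    have : Φ.fnl (f + f') = Φ.fnl f + Φ.fnl f' := Φ.map.map_add f f'
    change _ • (Φ.fnl (f + f')).1 y y' s n = _
    rw [this]
    exact smul_add _ _ _
  eps_smul_left {_ _ p y y'} r f s n h := by
    have : Φ.fnl (r • f) = r • Φ.fnl f := Φ.map.map_smul r f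
    change _ • (Φ.fnl (r • f)).1 y y' s n = _
    rw [this]
    exact smul_comm _ _ _
  eps_add {_ _ p w x y z m} f a g g' b n h h₁ h₂ := by
    have := ((Φ.fnl f).2 w).lin a 1 g g' b
    rw [one_smul, one_smul] at this
    change _ • (Φ.fnl f).1 w z _ n = _ • (Φ.fnl f).1 w z _ n + _ • (Φ.fnl f).1 w z _ n
    rw [this, Pi.add_apply, smul_add]
    simp only [Chain.deg_append, Chain.deg_cons]
  eps_smul {_ _ p w x y z m} f a r g b n h h₁ := by
    have := ((Φ.fnl f).2 w).lin a r g 0 b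
    rw [((Φ.fnl f).2 w).slot_zero, add_zero, add_zero] at this
    change _ • (Φ.fnl f).1 w z _ n = _ • _ • (Φ.fnl f).1 w z _ n
    rw [this, Pi.smul_apply, smul_comm]
    simp only [Chain.deg_append, Chain.deg_cons]
  left_one c y h := by
    have : Φ.fnl (C.one c) = (coherent D E).one (Φ.obj c) := Φ.map_one c
    change _ • (Φ.fnl (C.one c)).1 y y (.nil y) 0 = _
    rw [this]
    change _ • (tone _ : E.Tot _ _) 0 = _
    rw [tone, single_same]
    simp [sg]
  eps_one {_ _ p x y z} f a b n h := by
    change _ • (Φ.fnl f).1 x z _ n = 0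
    rw [((Φ.fnl f).2 x).one]
    exact smul_zero _
  one_eps c {x _ z _} g s n h := by
    have : Φ.fnl (C.one c) = (coherent D E).one (Φ.obj c) := Φ.map_one c
    change _ • (Φ.fnl (C.one c)).1 x z (.cons g s) n = _
    rw [this]
    exact smul_zero _
  comp_eps {_ _ _ p₂ p₁ p} hp f₂ f₁ x y s n h h' := by
    have : Φ.fnl (C.comp hp f₂ f₁) = (coherent D E).comp hp (Φ.fnl f₂) (Φ.fnl f₁) :=
      Φ.map_comp hp f₂ f₁
    change _ • (Φ.fnl (C.comp hp f₂ f₁)).1 x y s n = _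
    rw [TwistedPreData.splitSum_eq, this, TwistedPreData.ofCoherent_fnl,
      TwistedPreData.ofCoherent_fnl]
    subst hp
    rw [Chain.deg_nil, mul_zero, add_zero]
    rfl
  left_d {_ _ p p'} hp f y n n' hn h h' := by
    have : Φ.fnl (C.d p p' hp f) = (coherent D E).d p p' hp (Φ.fnl f) := Φ.map_d p p' hp f
    change E.d n n' hn (_ • (Φ.fnl f).1 y y (.nil y) n) = _ • (Φ.fnl (C.d p p' hp f)).1 y y (.nil y) n'
    rw [this, map_smul, Chain.deg_nil, mul_zero, mul_zero, ← td_apply hn]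
    congr 1
    exact (congrFun (add_zero (td ((Φ.fnl f).1 y y (.nil y)))) n').symm
  eps_d {_ _ p p'} hp f x y z m g s n n' hn h h₁ h₂ h₃ h₄ := by
    have : Φ.fnl (C.d p p' hp f) = (coherent D E).d p p' hp (Φ.fnl f) := Φ.map_d p p' hp f
    refine Eq.trans ?_ (TwistedPreData.cdiff_eq _ _ f (Φ.fnl f).1
      (fun s n h => rfl) g s n n' hn h h₂ h₃ h₄).symm
    change _ • (Φ.fnl (C.d p p' hp f)).1 x z _ n' = _
    rw [this]
    subst hp
    rfl

namespace TwistedData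

variable (T : TwistedData C D E)

/-- The dg functor `g ↦ id_c ⊗ g`. -/
def functor (c : C.Obj) : DGFunctor D E where
  obj y := T.obj (c, y)
  map := { toFun := T.right c, map_add' := T.right_add c, map_smul' := T.right_smul c }
  map_d := T.right_d c
  map_one := T.right_one c
  map_comp := T.right_comp c

theorem isNormalized_fnl {c c' : C.Obj} {p : ℤ} (f : C.Hom c c' p) (y : D.Obj) :
    Fnl.IsNormalized (G := (T.functor c').obj) p (T.fnl f y) where
  lin {w x z m} a r g g' b := by
    funext n
    by_cases h : p + (a.append (.cons g b)).deg = n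
    · have h' : p + (a.append (.cons (r • g + g') b)).deg = n := by
        simpa only [Chain.deg_append, Chain.deg_cons] using h
      have h'' : p + (a.append (.cons (r • g) b)).deg = n := by
        simpa only [Chain.deg_append, Chain.deg_cons] using h
      have h''' : p + (a.append (.cons g' b)).deg = n := by
        simpa only [Chain.deg_append, Chain.deg_cons] using h
      change _ = r • T.fnl f y z _ n + T.fnl f y z _ n
      rw [T.fnl_apply _ _ _ h, T.fnl_apply _ _ _ h', T.fnl_apply _ _ _ h''',
        T.eps_add f a _ _ b n h' h'' h''', T.eps_smul f a r g b n h'' h]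
      simp only [Chain.deg_append, Chain.deg_cons]
      module
    · have h' : ¬ p + (a.append (.cons (r • g + g') b)).deg = n := by
        simpa only [Chain.deg_append, Chain.deg_cons] using h
      have h''' : ¬ p + (a.append (.cons g' b)).deg = n := by
        simpa only [Chain.deg_append, Chain.deg_cons] using h
      change _ = r • T.fnl f y z _ n + T.fnl f y z _ n
      rw [TwistedPreData.fnl, TwistedPreData.fnl, TwistedPreData.fnl, dif_neg h, dif_neg h',
        dif_neg h''', smul_zero, add_zero]
  homog s n hn := by rw [TwistedPreData.fnl, dif_neg (Ne.symm hn)]; rfl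
  one {w z} a b := by
    funext n
    by_cases h : p + (a.append (.cons (D.one w) b)).deg = n
    · rw [T.fnl_apply _ _ _ h, T.eps_one, smul_zero]
      rfl
    · rw [TwistedPreData.fnl, dif_neg h]
      rfl

theorem fnl_lin {c c' : C.Obj} {p : ℤ} (r : k) (f f' : C.Hom c c' p) :
    T.fnl (r • f + f') = r • T.fnl f + T.fnl f' := by
  funext y z s n
  change _ = r • T.fnl f y z _ n + T.fnl f' y z _ n
  by_cases h : p + s.deg = n
  · rw [T.fnl_apply _ _ _ h, T.fnl_apply _ _ _ h, T.fnl_apply _ _ _ h, T.eps_add_left,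
      T.eps_smul_left]
    module
  · rw [TwistedPreData.fnl, TwistedPreData.fnl, TwistedPreData.fnl, dif_neg h, dif_neg h,
      dif_neg h, smul_zero, add_zero]

theorem fnl_zero {c c' : C.Obj} {p : ℤ} : T.fnl (0 : C.Hom c c' p) = 0 := by
  have := T.fnl_lin (1 : k) (0 : C.Hom c c' p) 0
  rw [one_smul, one_smul, add_zero] at this
  exact left_eq_add.1 this

/-- The dg functor to the dg category of dg functors associated with an interpretation of the
symbols. -/
noncomputable def toCoherent : DGFunctor C (coherent D E) where
  obj c := coherent.of (T.functor c)
  map {c c' p} :=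
    { toFun := fun f => (⟨T.fnl f, T.isNormalized_fnl f⟩ :
          coherentHom (T.functor c) (T.functor c') p)
      map_add' := fun f f' => Subtype.ext (by
        have := T.fnl_lin 1 f f'
        rwa [one_smul, one_smul] at this)
      map_smul' := fun r f => Subtype.ext (by
        have := T.fnl_lin r f 0
        rwa [fnl_zero, add_zero, add_zero] at this) }
  map_d {c c' : C.Obj} p p' hp f := Subtype.ext (funext fun x => funext fun z => funext fun s => by
    funext n'
    change T.fnl (C.d p p' hp f) x z s n' =
      Fnl.cdiff (F := T.functor c) (G := T.functor c') p (T.fnl f) x z s n'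
    -- Outside the expected degree both sides vanish by homogeneity; inside it the claim is the
    -- relation for the differential of a symbol.
    by_cases h : p' + s.deg = n'
    · rw [T.fnl_apply _ _ _ h]
      cases s with
      | nil x =>
        simp only [Chain.deg_nil] at h
        rw [Chain.deg_nil, mul_zero, ← T.left_d hp f x p n' (by omega) (by simp) (by simp; omega)]
        change _ = (td (T.fnl f x x (.nil x)) + 0) n'
        rw [add_zero, td_apply (m := p) (by omega), T.fnl_apply f _ _ (by simp)]
        have h0 : sg k (p * (Chain.nil x : Chain D x x).deg) = 1 := by simp [sg]
        rw [h0, one_smul]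
        simp [sg]
      | @cons _ y _ m g s =>
        simp only [Chain.deg_cons] at h
        rw [T.eps_d hp f g s (p + (Chain.cons g s).deg) n' (by simp; omega) rfl
          (by simp; omega) (by simp; omega) (by simp; omega) (by omega)]
        refine (congrArg (sg k (p' * (Chain.cons g s).deg) • ·)
          (TwistedPreData.cdiff_eq T.functor T.eps f (T.fnl f) (fun s n h => T.eps_eq f s n h)
          g s (p + (Chain.cons g s).deg) n' (by simp; omega) rfl
          (by simp; omega) (by simp; omega) (by omega))).trans ?_
        subst hp
        exact (smul_smul _ _ _).trans (by rw [sg_mul_self]; exact one_smul _ _)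
    · rw [TwistedPreData.fnl, dif_neg h]
      exact ((Fnl.IsNormalized.cdiff (F := T.functor c) (G := T.functor c') hp
        (T.isNormalized_fnl f) x).homog s n' (Ne.symm h)).symm)
  map_one c := Subtype.ext (funext fun x => funext fun z => funext fun s => by
    funext n
    change T.fnl (C.one c) x z s n = Fnl.unit (E := E) (T.functor c).obj x z s n
    by_cases h : 0 + s.deg = n
    · rw [T.fnl_apply _ _ _ h]
      cases s with
      | nil x =>
        obtain rfl : n = 0 := by rw [← h]; rfl
        rw [T.left_one]
        change _ = (tone _ : E.Tot _ _) 0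
        rw [tone, single_same]
        simp [sg]
      | cons g s =>
        rw [T.one_eps, smul_zero]
        rfl
    · rw [TwistedPreData.fnl, dif_neg h]
      exact ((Fnl.IsNormalized.unit (G := (T.functor c).obj) x).homog s n (Ne.symm h)).symm)
  map_comp {c c' c'' p₂ p₁ p} hp f₂ f₁ :=
      Subtype.ext (funext fun x => funext fun z => funext fun s => by
    funext n
    change T.fnl (C.comp hp f₂ f₁) x z s n = Fnl.conv p₂ (T.fnl f₂) (T.fnl f₁ x) z s n
    by_cases h : p + s.deg = n
    · rw [T.fnl_apply _ _ _ h, T.comp_eps hp f₂ f₁ s n h (by simp; omega), T.splitSum_eq]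
      subst hp
      rw [Chain.deg_nil, mul_zero, add_zero, smul_smul, sg_mul_self, one_smul]
      rfl
    · rw [TwistedPreData.fnl, dif_neg h]
      exact (((T.isNormalized_fnl f₁ x).conv hp (T.isNormalized_fnl f₂)).homog s n
        (Ne.symm h)).symm)

/-- The sign between `eps` and `fnl` is its own inverse. With `twistedTensor_functor_ext`, this
composite of the two transpositions suffices for the lifting argument. -/
theorem ofCoherent_toCoherent :
    (ofCoherent T.toCoherent).toTwistedPreData = T.toTwistedPreData := by
  change TwistedPreData.mk _ _ _ = TwistedPreData.mk _ _ _
  congr 1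
  funext c c' p y y' f s n h
  change sg k (p * s.deg) • T.fnl f y y' s n = _
  rw [T.fnl_apply _ _ _ h, smul_smul, sg_mul_self, one_smul]

end TwistedData

end Adjunction

/-! ### Naturality of the transposition in the target -/

section Functoriality

variable {k : Type u} [Field k] {A B C D E E' : DGCat.{u} k}

open DGCat

/-- Composition of dg functors. -/
abbrev DGFunctor.comp (F : DGFunctor A B) (G : DGFunctor B C) : DGFunctor A C :=
  CategoryStruct.comp (obj := DGCat.{u} k) F G

/-- The image of an interpretation of the symbols under a dg functor. -/
def TwistedData.map (T : TwistedData C D E) (F : DGFunctor E E') : TwistedData C D E' where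
  toTwistedPreData := T.toTwistedPreData.map F
  right_add c _ _ _ g g' := (congrArg F.map (T.right_add c g g')).trans (map_add _ _ _)
  right_smul c _ _ _ r g := (congrArg F.map (T.right_smul c r g)).trans (map_smul _ _ _)
  right_one c y := (congrArg F.map (T.right_one c y)).trans (F.map_one _)
  right_comp c _ _ _ _ _ _ h g g' := (congrArg F.map (T.right_comp c h g g')).trans
    (F.map_comp _ _ _)
  right_d c _ _ n m h g := (congrArg F.map (T.right_d c n m h g)).trans (F.map_d _ _ _ _)
  eps_add_left f f' s n h := (congrArg F.map (T.eps_add_left f f' s n h)).trans (map_add _ _ _)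
  eps_smul_left r f s n h := (congrArg F.map (T.eps_smul_left r f s n h)).trans (map_smul _ _ _)
  eps_add f a g g' b n h h₁ h₂ := (congrArg F.map (T.eps_add f a g g' b n h h₁ h₂)).trans
    (map_add _ _ _)
  eps_smul f a r g b n h h₁ := (congrArg F.map (T.eps_smul f a r g b n h h₁)).trans
    (map_smul _ _ _)
  left_one c y h := (congrArg F.map (T.left_one c y h)).trans (F.map_one _)
  eps_one f a b n h := (congrArg F.map (T.eps_one f a b n h)).trans (map_zero _)
  one_eps c _ _ _ _ g s n h := (congrArg F.map (T.one_eps c g s n h)).trans (map_zero _)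
  comp_eps hp f₂ f₁ _ _ s n h h' := (congrArg F.map (T.comp_eps hp f₂ f₁ s n h h')).trans
    (TwistedPreData.map_splitSum _ _ _ _ _ _ _ _)
  left_d hp f y n n' hn h h' := (F.map_d _ _ _ _).symm.trans
    (congrArg F.map (T.left_d hp f y n n' hn h h'))
  eps_d hp f _ _ _ _ g s n n' hn h h₁ h₂ h₃ h₄ := by
    refine (congrArg F.map (T.eps_d hp f g s n n' hn h h₁ h₂ h₃ h₄)).trans ?_
    simp only [map_add, TwistedPreData.map_diffSum, TwistedPreData.map_lastTerm,
      TwistedPreData.map_firstTerm, TwistedPreData.map_mulSum, F.map_d]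
    rfl

theorem DGFunctor.map_hom_add (F : DGFunctor A B) {x y : A.Obj} {n : ℤ} (f g : A.Hom x y n) :
    F.map (f + g) = F.map f + F.map g := map_add _ _ _

theorem DGFunctor.map_hom_smul (F : DGFunctor A B) {x y : A.Obj} {n : ℤ} (r : k) (f : A.Hom x y n) :
    F.map (r • f) = r • F.map f := map_smul _ _ _

theorem DGFunctor.map_hom_zero (F : DGFunctor A B) (x y : A.Obj) (n : ℤ) :
    F.map (0 : A.Hom x y n) = 0 := map_zero _

theorem DGFunctor.mk_congr (o : A.Obj → B.Obj)
    {φ ψ : ∀ {x y : A.Obj} {n : ℤ}, A.Hom x y n →ₗ[k] B.Hom (o x) (o y) n}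
    (h : ∀ {x y : A.Obj} {n : ℤ} (f : A.Hom x y n), φ f = ψ f) (h₁ h₂ h₃ h₁' h₂' h₃') :
    (⟨o, φ, h₁, h₂, h₃⟩ : DGFunctor A B) = ⟨o, ψ, h₁', h₂', h₃'⟩ := by
  congr 1
  funext x y n
  exact LinearMap.ext h

/-- A dg functor commutes with every operation used to build formal expressions, so it is determined
by its effect on the symbols. -/
theorem DGFunctor.map_mk (F : DGFunctor (twistedTensor C D) E) {x y : C.Obj × D.Obj} {n : ℤ}
    (t : TwistedTerm C D x y n) :
    F.map (TwistedHom.mk t : (twistedTensor C D).Hom x y n) =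
      ((twistedSymbols C D).map F).eval t := by
  induction t with
  | one x => exact F.map_one x
  | comp h t t' ih ih' =>
    refine (F.map_comp h (TwistedHom.mk t : (twistedTensor C D).Hom _ _ _)
      (TwistedHom.mk t' : (twistedTensor C D).Hom _ _ _)).trans ?_
    rw [ih, ih']
    rfl
  | zero x y n => exact F.map_hom_zero x y n
  | add t t' ih ih' =>
    refine (F.map_hom_add (TwistedHom.mk t : (twistedTensor C D).Hom _ _ _)
      (TwistedHom.mk t' : (twistedTensor C D).Hom _ _ _)).trans ?_
    rw [ih, ih']
    rfl
  | smul r t ih =>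
    refine (F.map_hom_smul r (TwistedHom.mk t : (twistedTensor C D).Hom _ _ _)).trans ?_
    rw [ih]
    rfl
  | d n m h t ih =>
    refine (F.map_d n m h (TwistedHom.mk t : (twistedTensor C D).Hom _ _ _)).trans ?_
    rw [ih]
    rfl
  | right c g => rfl
  | eps f s n h => rfl

theorem twistedLift_map (F : DGFunctor (twistedTensor C D) E) :
    twistedLift ((twistedUniversal C D).map F) = F :=
  DGFunctor.mk_congr (A := twistedTensor C D) F.obj (fun {x y n} f => by
    induction f using Quotient.ind
    exact (F.map_mk _).symm) _ _ _ _ _ _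

/-- The relations are propositions, so an interpretation is determined by its values on the symbols.
-/
theorem twistedTensor_functor_ext {F G : DGFunctor (twistedTensor C D) E}
    (h : (twistedSymbols C D).map F = (twistedSymbols C D).map G) : F = G := by
  rw [← twistedLift_map F, ← twistedLift_map G]
  congr 1
  change TwistedData.mk _ _ _ _ _ _ _ _ _ _ _ _ _ _ _ _ = TwistedData.mk _ _ _ _ _ _ _ _ _ _ _ _ _ _ _ _
  congr 1

/-- The action of a dg functor on families of morphisms. -/
def DGFunctor.tmap (P : DGFunctor E E') {x y : E.Obj} :
    E.Tot x y →ₗ[k] E'.Tot (P.obj x) (P.obj y) where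
  toFun t n := P.map (t n)
  map_add' _ _ := by funext n; simp
  map_smul' _ _ := by funext n; simp

namespace DGFunctor

variable (P : DGFunctor E E')

theorem tmap_apply {x y : E.Obj} (t : E.Tot x y) (n : ℤ) : P.tmap t n = P.map (t n) := rfl

theorem tmap_tcomp {x y z : E.Obj} (p : ℤ) (t : E.Tot y z) (v : E.Tot x y) :
    P.tmap (tcomp p t v) = tcomp p (P.tmap t) (P.tmap v) := funext fun _ => P.map_comp _ _ _

theorem tmap_td {x y : E.Obj} (t : E.Tot x y) : P.tmap (td t) = td (P.tmap t) :=
  funext fun _ => P.map_d _ _ _ _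

theorem tmap_single {x y : E.Obj} {m : ℤ} (a : E.Hom x y m) :
    P.tmap (single m a) = single m (P.map a) := by
  funext n
  by_cases h : n = m
  · subst h
    rw [tmap_apply, single_same, single_same]
  · rw [tmap_apply, single_of_ne h, single_of_ne h, map_zero]

/-- The action of a dg functor on functionals. -/
def pushFnl {G : D.Obj → E.Obj} {e : E.Obj} {y : D.Obj} :
    Fnl D E G e y →ₗ[k] Fnl D E' (fun z => P.obj (G z)) (P.obj e) y where
  toFun θ z s := P.tmap (θ z s)
  map_add' _ _ := by funext z s; simp
  map_smul' _ _ := by funext z s; simp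

theorem pushFnl_conv {G G' : D.Obj → E.Obj} {e : E.Obj} (p : ℤ)
    (η : ∀ y, Fnl D E G' (G y) y) {y : D.Obj} (θ : Fnl D E G e y) :
    P.pushFnl (Fnl.conv p η θ) = Fnl.conv p (fun y => P.pushFnl (η y)) (P.pushFnl θ) := by
  funext z s
  induction s with
  | nil => exact P.tmap_tcomp _ _ _
  | cons g s ih =>
    change P.tmap _ = _
    rw [Fnl.conv_cons, map_add, map_smul, tmap_tcomp, Fnl.conv_cons]
    exact congrArg₂ (· + ·) (congrArg (sg k _ • ·) (ih _)) rfl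

theorem pushFnl_act (G : DGFunctor D E) {e : E.Obj} {x y : D.Obj} {m : ℤ} (g : D.Hom x y m)
    (θ : Fnl D E G.obj e x) : P.pushFnl (Fnl.act G g θ) = Fnl.act (G.comp P) g (P.pushFnl θ) := by
  refine Fnl.ext_chain ?_ fun h => rfl
  change P.tmap _ = _
  rw [Fnl.act_nil, tmap_tcomp, tmap_single]
  rfl

theorem pushFnl_diff (G : DGFunctor D E) {e : E.Obj} {y : D.Obj} (θ : Fnl D E G.obj e y) :
    P.pushFnl (Fnl.diff G θ) = Fnl.diff (G.comp P) (P.pushFnl θ) := by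
  funext z s
  induction s with
  | nil => exact P.tmap_td _
  | cons g s ih =>
    change P.tmap _ = _
    rw [Fnl.diff_cons _ rfl, Fnl.diff_cons _ rfl, map_smul, map_add, map_add]
    refine congrArg (sg k _ • ·) (congrArg₂ (· + ·) (ih _) (congrArg₂ (· + ·) rfl ?_))
    exact congrFun (congrFun (P.pushFnl_act G g θ) _) s

theorem pushFnl_cdiff {F G : DGFunctor D E} (p : ℤ) (η : ∀ y, Fnl D E G.obj (F.obj y) y)
    (x : D.Obj) : P.pushFnl (Fnl.cdiff p η x) =
      Fnl.cdiff (F := F.comp P) (G := G.comp P) p (fun y => P.pushFnl (η y)) x := by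
  rw [Fnl.cdiff, map_add, pushFnl_diff]
  refine congrArg₂ (· + ·) rfl ?_
  refine Fnl.ext_chain ?_ fun {y m} g => ?_
  · exact map_zero P.tmap
  · funext z s
    change P.tmap _ = _
    rw [Fnl.front_cons, map_smul, tmap_tcomp, tmap_single]
    rfl

theorem _root_.Fnl.IsNormalized.pushFnl {G : D.Obj → E.Obj} {e : E.Obj} {y : D.Obj} {p : ℤ}
    {θ : Fnl D E G e y} (h : Fnl.IsNormalized p θ) : Fnl.IsNormalized p (P.pushFnl θ) where
  lin a r g g' b := by
    change P.tmap _ = r • P.tmap _ + P.tmap _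
    rw [h.lin, map_add, map_smul]
  homog s n hn := (congrArg P.map (h.homog s n hn)).trans (map_zero _)
  one a b := (congrArg P.tmap (h.one a b)).trans (map_zero _)

end DGFunctor

/-- The dg functor between dg categories of dg functors given by composition with `P`. -/
noncomputable def coherent.map (D : DGCat.{u} k) (P : DGFunctor E E') :
    DGFunctor (coherent D E) (coherent D E') where
  obj F := coherent.of (DGFunctor.comp F P)
  map {F G p} :=
    { toFun := fun η => (⟨fun y => P.pushFnl (Subtype.val η y), fun y => (Subtype.prop η y).pushFnl P⟩ :
        coherentHom (DGFunctor.comp F P) (DGFunctor.comp G P) p)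
      map_add' := fun η ζ => Subtype.ext (funext fun y => P.pushFnl.map_add _ _)
      map_smul' := fun r η => Subtype.ext (funext fun y => P.pushFnl.map_smul _ _) }
  map_d {F G} n m h η := Subtype.ext (funext fun y => P.pushFnl_cdiff (F := F) (G := G) _ _ y)
  map_one F := Subtype.ext (funext fun y => funext fun z => funext fun s => by
    cases s with
    | nil => exact (P.tmap_single _).trans (congrArg _ (P.map_one _))
    | cons g s => exact map_zero P.tmap)
  map_comp h g f := Subtype.ext (funext fun y => P.pushFnl_conv _ _ _)

/-- This is the naturality of the adjunction in `E`, at the level of symbols. -/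
theorem TwistedData.ofCoherent_map (Φ : DGFunctor C (coherent D E)) (P : DGFunctor E E') :
    (TwistedData.ofCoherent (Φ.comp (coherent.map D P))).toTwistedPreData =
      (TwistedData.ofCoherent Φ).toTwistedPreData.map P := by
  change TwistedPreData.mk _ _ _ = TwistedPreData.mk _ _ _
  congr 1
  funext c c' p y y' f s n h
  exact (P.map.map_smul _ _).symm

end Functoriality

/-! ### Acyclic fibrations as surjections with acyclic kernel -/

section TrivialFibrations

variable {k : Type u} [Field k] {A B : DGCat.{u} k}

open DGCat

/-- A dg functor which is surjective on objects and on morphisms, with acyclic kernel. -/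
structure DGFunctor.IsTrivialFibration (F : DGFunctor A B) : Prop where
  obj_surj : Function.Surjective F.obj
  map_surj : ∀ (x y : A.Obj) (n : ℤ) (b : B.Hom (F.obj x) (F.obj y) n),
    ∃ a : A.Hom x y n, F.map a = b
  ker_acyclic : ∀ (x y : A.Obj) (l n m : ℤ) (hl : l + 1 = n) (hm : n + 1 = m) (a : A.Hom x y n),
    A.d n m hm a = 0 → F.map a = 0 → ∃ e : A.Hom x y l, F.map e = 0 ∧ A.d l n hl e = a

theorem DGFunctor.IsTrivialFibration.of_acyclicFibration {F : DGFunctor A B}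
    (hF : F.IsFibration) (hF' : F.IsQuasiEquiv) : F.IsTrivialFibration where
  obj_surj y := by
    obtain ⟨x, v, hv⟩ := hF'.essSurj y
    obtain ⟨y', hy, -⟩ := hF.lift_iso x y v hv
    exact ⟨y', hy⟩
  map_surj := hF.surj
  ker_acyclic x y l n m hl hm a ha hFa := by
    -- The primitive `e` of `a` need not lie in the kernel, but `F e` is closed. Subtracting a
    -- closed `e'` with F e' - F e = d w, and adding the boundary of a lift of `w`, moves it there
    -- without changing its differential.
    obtain ⟨e, he⟩ := hF'.inj x y l n m hl hm a ha ⟨0, by rw [hFa, map_zero]⟩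
    obtain ⟨e', he', w, hw⟩ := hF'.surj x y (l - 1) l n (by omega) hl (F.map e)
      (by rw [← F.map_d, ← he, hFa])
    obtain ⟨w', hw'⟩ := hF.surj x y _ w
    subst hw'
    refine ⟨e - e' + A.d (l - 1) l (by omega) w', ?_, ?_⟩
    · simp only at hw
      rw [map_add, map_sub, F.map_d, ← hw]
      abel
    · rw [map_add, map_sub, he', A.d_d, ← he, sub_zero, add_zero]

theorem DGCat.isHomotopyEquiv_one (x : A.Obj) : A.IsHomotopyEquiv (A.one x) := by
  refine ⟨A.d_one x _, A.one x, A.d_one x _, ⟨0, ?_⟩, ⟨0, ?_⟩⟩ <;>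
  rw [A.one_comp, sub_self, map_zero]

namespace DGFunctor.IsTrivialFibration

variable {F : DGFunctor A B}

/-- For any lift `a` of `b`, the differential of `a` is a closed morphism of the kernel; a primitive
of it in the kernel corrects `a`. -/
theorem exists_closed_lift (hF : F.IsTrivialFibration) {x y : A.Obj} {n m : ℤ} (hm : n + 1 = m)
    (b : B.Hom (F.obj x) (F.obj y) n) (hb : B.d n m hm b = 0) :
    ∃ a : A.Hom x y n, A.d n m hm a = 0 ∧ F.map a = b := by
  obtain ⟨a, rfl⟩ := hF.map_surj x y n b
  obtain ⟨e, he, hea⟩ := hF.ker_acyclic x y n m _ hm rfl (A.d n m hm a) (A.d_d _ _ _ _ _ _)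
    (by rw [F.map_d, hb])
  exact ⟨a - e, by rw [map_sub, hea, sub_self], by rw [map_sub, he, sub_zero]⟩

theorem exact_of_map_exact (hF : F.IsTrivialFibration) {x y : A.Obj} {l n m : ℤ} (hl : l + 1 = n) (hm : n + 1 = m)
    (a : A.Hom x y n) (ha : A.d n m hm a = 0) (e : B.Hom (F.obj x) (F.obj y) l)
    (he : F.map a = B.d l n hl e) : ∃ e : A.Hom x y l, a = A.d l n hl e := by
  obtain ⟨w, rfl⟩ := hF.map_surj x y l e
  obtain ⟨w', -, hw'⟩ := hF.ker_acyclic x y l n m hl hm (a - A.d l n hl w)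
    (by rw [map_sub, ha, A.d_d, sub_zero]) (by rw [map_sub, he, F.map_d, sub_self])
  exact ⟨w + w', by rw [map_add, hw']; abel⟩

theorem isQuasiEquiv (hF : F.IsTrivialFibration) : F.IsQuasiEquiv where
  surj x y l n m hl hm b hb := by
    obtain ⟨a, ha, rfl⟩ := hF.exists_closed_lift hm b hb
    exact ⟨a, ha, 0, by rw [sub_self, map_zero]⟩
  inj x y l n m hl hm a ha := fun ⟨e, he⟩ => hF.exact_of_map_exact hl hm a ha e he
  essSurj y := by
    obtain ⟨x, rfl⟩ := hF.obj_surj y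
    exact ⟨x, _, isHomotopyEquiv_one _⟩

/-- A homotopy equivalence and its inverse have closed strict lifts, and `exact_of_map_exact` lifts
the statement that they are inverse up to homotopy. Strictness makes the final witness 0. -/
theorem isFibration (hF : F.IsTrivialFibration) : F.IsFibration where
  surj := hF.map_surj
  lift_iso x y' v := by
    rintro ⟨hv, w, hw, ⟨h, hh⟩, ⟨h', hh'⟩⟩
    obtain ⟨y, rfl⟩ := hF.obj_surj y'
    obtain ⟨a, ha, rfl⟩ := hF.exists_closed_lift _ v hv
    obtain ⟨b, hb, rfl⟩ := hF.exists_closed_lift _ w hw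
    have key : ∀ {x y : A.Obj} (a : A.Hom x y 0) (b : A.Hom y x 0) (ha : A.d 0 1 (by norm_num) a = 0)
        (hb : A.d 0 1 (by norm_num) b = 0) (h : B.Hom (F.obj x) (F.obj x) (-1)),
        B.comp (add_zero 0) (F.map b) (F.map a) - B.one (F.obj x) = B.d (-1) 0 (by norm_num) h →
        ∃ h : A.Hom x x (-1), A.comp (add_zero 0) b a - A.one x = A.d (-1) 0 (by norm_num) h := by
      intro x y a b ha hb h hh
      refine hF.exact_of_map_exact _ (by norm_num : (0 : ℤ) + 1 = 1) _ ?_ h ?_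
      · rw [map_sub, A.d_one, A.leibniz (add_zero 0) _ (by norm_num : (0 : ℤ) + 1 = 1)
          (by norm_num : (0 : ℤ) + 1 = 1) (by norm_num) (by norm_num), ha, hb]
        simp
      · rw [map_sub, F.map_comp, F.map_one, hh]
    exact ⟨y, rfl, a, ⟨ha, b, hb, key a b ha hb h hh, key b a hb ha h' hh'⟩, 0,
      by rw [sub_self, map_zero]⟩

theorem acyclicFibrations (hF : F.IsTrivialFibration) : DGCat.acyclicFibrations k (X := A) (Y := B) F :=
  ⟨hF.isFibration, hF.isQuasiEquiv⟩

end DGFunctor.IsTrivialFibration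

theorem DGCat.empty_functor_ext (F G : DGFunctor (DGCat.empty k) A) : F = G := by
  rcases F with ⟨o, φ, h₁, h₂, h₃⟩
  rcases G with ⟨o', ψ, h₁', h₂', h₃'⟩
  obtain rfl : o = o' := funext fun x => PEmpty.elim x
  exact DGFunctor.mk_congr (A := DGCat.empty k) o (fun {x} => PEmpty.elim x) _ _ _ _ _ _

/-- Squares starting at the empty dg category commute automatically, so cofibrancy is a lifting
property of single dg functors. -/
theorem DGCat.isCofibrant_iff : A.IsCofibrant ↔ ∀ (E E' : DGCat.{u} k) (P : DGFunctor E E')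
    (G : DGFunctor A E'), P.IsTrivialFibration → ∃ G' : DGFunctor A E, G'.comp P = G := by
  constructor
  · intro h E E' P G hP
    have := h (X := E) (Y := E') P hP.acyclicFibrations
    have sq : CommSq (E.emptyTo) A.emptyTo (C := DGCat k) P G := ⟨empty_functor_ext _ _⟩
    exact ⟨sq.lift, sq.fac_right⟩
  · intro h E E' P hP
    refine ⟨fun {f g} sq => ?_⟩
    obtain ⟨G, hG⟩ := h E E' P g (.of_acyclicFibration hP.1 hP.2)
    exact ⟨⟨⟨G, empty_functor_ext _ _, hG⟩⟩⟩

end TrivialFibrations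

/-! ### Trivial fibrations of dg categories of dg functors, and part (a) -/

section Lifting

variable {k : Type u} [Field k] {C D E E' : DGCat.{u} k}

open DGCat

/-- By hypothesis `p` surjects onto q ⊔ f(p). A linear right inverse there extends to all of `W`. -/
theorem LinearMap.exists_section_on {V W : Type*} [AddCommGroup V] [AddCommGroup W] [Module k V]
    [Module k W] (f : V →ₗ[k] W) (p : Submodule k V) (q : Submodule k W)
    (h : ∀ w ∈ q, ∃ v ∈ p, f v = w) :
    ∃ S : W →ₗ[k] V, ∀ w ∈ q, S w ∈ p ∧ f (S w) = w := by
  have hs : Function.Surjective ((f.domRestrict p).codRestrict (q ⊔ p.map f) (fun v =>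
      Submodule.mem_sup_right (Submodule.mem_map_of_mem v.2))) := by
    rintro ⟨w, hw⟩
    obtain ⟨a, ha, b, ⟨v, hv, rfl⟩, rfl⟩ := Submodule.mem_sup.1 hw
    obtain ⟨v', hv', rfl⟩ := h a ha
    exact ⟨⟨v' + v, p.add_mem hv' hv⟩, Subtype.ext (map_add f _ _)⟩
  obtain ⟨g, hg⟩ := LinearMap.exists_rightInverse_of_surjective _ (LinearMap.range_eq_top.2 hs)
  obtain ⟨S, hS⟩ := LinearMap.exists_extend (p.subtype ∘ₗ g)
  refine ⟨S, fun w hw => ?_⟩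
  have h1 : S w = g ⟨w, Submodule.mem_sup_left hw⟩ :=
    LinearMap.congr_fun hS ⟨w, Submodule.mem_sup_left hw⟩
  rw [h1]
  exact ⟨(g _).2, congrArg Subtype.val (LinearMap.congr_fun hg ⟨w, Submodule.mem_sup_left hw⟩)⟩

/-- A contracting homotopy of the kernel of a trivial fibration. -/
theorem DGFunctor.IsTrivialFibration.exists_contraction {P : DGFunctor E E'}
    (hP : P.IsTrivialFibration) (x y : E.Obj) : ∃ H : E.Tot x y →ₗ[k] E.Tot x y,
      (∀ t, P.tmap t = 0 → P.tmap (H t) = 0 ∧ td (H t) + H (td t) = t) ∧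
      ∀ t p, (∀ n, n ≠ p → t n = 0) → ∀ n, n + 1 ≠ p → H t n = 0 := by
  have key : ∀ n : ℤ, ∃ S : E.Hom x y (n + 1) →ₗ[k] E.Hom x y n, ∀ a,
      E.d (n + 1) (n + 1 + 1) rfl a = 0 → P.map a = 0 → P.map (S a) = 0 ∧ E.d n _ rfl (S a) = a := by
    intro n
    obtain ⟨S, hS⟩ := LinearMap.exists_section_on (E.d (x := x) (y := y) n _ rfl)
      (LinearMap.ker P.map) (LinearMap.ker (E.d (n + 1) (n + 1 + 1) rfl) ⊓ LinearMap.ker P.map)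
      (fun w hw => hP.ker_acyclic x y n _ _ rfl rfl w hw.1 hw.2)
    exact ⟨S, fun a h h' => hS a ⟨h, h'⟩⟩
  choose S hS using key
  -- With `S` a linear choice of primitives of cycles of the kernel, take H = S(1 - S d). On the
  -- kernel 1 - S d has values in cycles, so d H + H d = (1 - S d) + S d = 1.
  refine ⟨LinearMap.pi fun n => S n ∘ₗ (LinearMap.proj (n + 1) -
    S (n + 1) ∘ₗ E.d (n + 1) (n + 1 + 1) rfl ∘ₗ LinearMap.proj (n + 1)), fun t ht => ?_,
    fun t p ht n hn => ?_⟩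
  · have h1 : ∀ n, P.map (S n (E.d n _ rfl (t n))) = 0 ∧
        E.d n _ rfl (S n (E.d n _ rfl (t n))) = E.d n _ rfl (t n) := fun n =>
      hS n _ (E.d_d _ _ _ _ _ _) (by rw [P.map_d]; exact (congrArg _ (congrFun ht n)).trans (map_zero _))
    have h2 : ∀ n, P.map (S n (t (n + 1) - S (n + 1) (E.d _ _ rfl (t (n + 1))))) = 0 ∧
        E.d n _ rfl (S n (t (n + 1) - S (n + 1) (E.d _ _ rfl (t (n + 1))))) =
          t (n + 1) - S (n + 1) (E.d _ _ rfl (t (n + 1))) := fun n =>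
      hS n _ (by rw [map_sub, (h1 _).2, sub_self])
        (by rw [map_sub, (h1 _).1, sub_zero]; exact congrFun ht (n + 1))
    refine ⟨funext fun n => (h2 n).1, funext fun n => ?_⟩
    obtain ⟨n, rfl⟩ : ∃ l, n = l + 1 := ⟨n - 1, by omega⟩
    rw [Pi.add_apply, td_apply rfl]
    change E.d n _ rfl (S n (t (n + 1) - S (n + 1) (E.d _ _ rfl (t (n + 1))))) +
      S (n + 1) (td t (n + 1 + 1) - S (n + 1 + 1) (E.d _ _ rfl (td t (n + 1 + 1)))) = _
    rw [(h2 n).2, td_apply rfl, E.d_d, map_zero, sub_zero]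
    abel
  · change S n (t (n + 1) - S (n + 1) (E.d _ _ rfl (t (n + 1)))) = 0
    rw [ht _ hn, map_zero, map_zero, sub_zero, map_zero]

/-- The number of morphisms in a chain. -/
def Chain.length : {x y : D.Obj} → Chain D x y → ℕ
  | _, _, .nil _ => 0
  | _, _, .cons _ s => s.length + 1

@[simp] theorem Chain.length_nil (y : D.Obj) : (Chain.nil y : Chain D y y).length = 0 := rfl

@[simp] theorem Chain.length_cons {x y z : D.Obj} {m : ℤ} (g : D.Hom x y m) (s : Chain D y z) :
    (Chain.cons g s).length = s.length + 1 := rfl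

@[simp] theorem Chain.length_append {x y z : D.Obj} (s : Chain D x y) (t : Chain D y z) :
    (s.append t).length = s.length + t.length := by
  induction s with
  | nil => simp [Chain.append]
  | cons g s ih => simp [Chain.append, ih]; omega

namespace Fnl

variable {F G : DGFunctor D E}

theorem act_eq_zero {e : E.Obj} {x y : D.Obj} {N m : ℤ} {θ : Fnl D E G.obj e x}
    (h : ∀ {z : D.Obj} (s : Chain D x z), s.length < N → θ z s = 0) (g : D.Hom x y m) {z : D.Obj}
    (s : Chain D y z) (hs : s.length < N) : act G g θ z s = 0 := by
  cases s with
  | nil => rw [act_nil, h _ hs, map_zero]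
  | cons l s => exact h _ hs

theorem diff_eq_zero {e : E.Obj} {x : D.Obj} {N : ℤ} {θ : Fnl D E G.obj e x}
    (h : ∀ {z : D.Obj} (s : Chain D x z), s.length < N → θ z s = 0) {z : D.Obj}
    (s : Chain D x z) (hs : s.length < N) : diff G θ z s = 0 := by
  induction s generalizing N with
  | nil => rw [diff_nil, h _ hs, map_zero]
  | cons g s ih =>
    simp only [Chain.length_cons, Nat.cast_add, Nat.cast_one] at hs
    rw [diff_cons _ rfl, h _ (by simpa using hs), act_eq_zero h g s (by omega),
      ih (N := N - 1) (θ := sh g θ) (fun s hs => h (.cons g s) (by simp only [Chain.length_cons, Nat.cast_add, Nat.cast_one]; omega)) (by omega)]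
    simp

/-- The differential at a chain only uses values at chains which are not longer, so it respects the
filtration by length. -/
theorem cdiff_eq_zero {p N : ℤ} {η : ∀ y, Fnl D E G.obj (F.obj y) y}
    (h : ∀ {x z : D.Obj} (s : Chain D x z), s.length < N → η x z s = 0) {x z : D.Obj}
    (s : Chain D x z) (hs : s.length < N) : cdiff p η x z s = 0 := by
  rw [cdiff, Pi.add_apply, Pi.add_apply, diff_eq_zero h s hs, zero_add]
  cases s with
  | nil => rfl
  | cons g s => 
    simp only [Chain.length_cons, Nat.cast_add, Nat.cast_one] at hs
    rw [front_cons, h s (by omega), map_zero, LinearMap.zero_apply, smul_zero]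

/-- Each condition concerns finitely many chains of bounded length, and can be tested on an
approximation. -/
theorem IsNormalized.of_approx {p : ℤ} {o : D.Obj → E.Obj} {e : E.Obj} {y : D.Obj} {θ : Fnl D E o e y}
    (h : ∀ N : ℕ, ∃ θ' : Fnl D E o e y, IsNormalized p θ' ∧
      ∀ {z} (s : Chain D y z), s.length < N → θ z s = θ' z s) : IsNormalized p θ where
  lin a r g g' b := by
    obtain ⟨θ', h', h''⟩ := h (a.length + b.length + 2)
    rw [h'' _ (by simp; omega), h'' _ (by simp; omega), h'' _ (by simp; omega), h'.lin]
  homog s n hn := by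
    obtain ⟨θ', h', h''⟩ := h (s.length + 1)
    rw [h'' _ (by omega), h'.homog s n hn]
  one a b := by
    obtain ⟨θ', h', h''⟩ := h (a.length + b.length + 2)
    rw [h'' _ (by simp; omega), h'.one]

/-- The functional obtained by applying a homotopy, with a sign, to the values. -/
noncomputable def homotopy {o : D.Obj → E.Obj} {e : E.Obj}
    (H : ∀ x y : E.Obj, E.Tot x y →ₗ[k] E.Tot x y) {y : D.Obj} (θ : Fnl D E o e y) : Fnl D E o e y :=
  fun z s => sg k s.deg • H e (o z) (θ z s)

variable {H : ∀ x y : E.Obj, E.Tot x y →ₗ[k] E.Tot x y}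

theorem IsNormalized.homotopy
    (hH : ∀ x y t p, (∀ n, n ≠ p → t n = 0) → ∀ n, n + 1 ≠ p → H x y t n = 0) {p q : ℤ}
    (hp : p + 1 = q) {o : D.Obj → E.Obj} {e : E.Obj} {y : D.Obj} {θ : Fnl D E o e y} (h : IsNormalized q θ) :
    IsNormalized p (homotopy H θ) where
  lin a r g g' b := by
    simp only [Fnl.homotopy, h.lin, map_add, map_smul, Chain.deg_append, Chain.deg_cons]
    module
  homog s n hn := by
    change sg k s.deg • H e (o _) (θ _ s) n = 0
    rw [hH _ _ _ _ (h.homog s) n (by omega), smul_zero]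
  one a b := by rw [Fnl.homotopy, h.one, map_zero, smul_zero]

/-- At chains of length at most `N`, terms which shorten the chain vanish. Terms which differentiate
a member of the chain cancel, thanks to the sign in `homotopy`, and d H + H d = 1 on the values
remains. -/
theorem diff_homotopy {P : DGFunctor E E'}
    (hH : ∀ x y t, P.tmap t = 0 → P.tmap (H x y t) = 0 ∧ td (H x y t) + H x y (td t) = t)
    {e : E.Obj} {x : D.Obj} {N : ℤ} {θ : Fnl D E G.obj e x}
    (h : ∀ {z : D.Obj} (s : Chain D x z), s.length < N → θ z s = 0)
    (hP : ∀ {z : D.Obj} (s : Chain D x z), P.tmap (θ z s) = 0) {z : D.Obj}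
    (s : Chain D x z) (hs : s.length ≤ N) :
    diff G (homotopy H θ) z s + sg k s.deg • H _ _ (diff G θ z s) = θ z s := by
  induction s generalizing N with
  | nil y =>
    rw [diff_nil, diff_nil, homotopy, Chain.deg_nil]
    simpa [sg] using (hH _ _ _ (hP (.nil y))).2
  | @cons x y z m g s ih =>
    simp only [Chain.length_cons, Nat.cast_add, Nat.cast_one] at hs
    have h1 : sh g (homotopy H θ) = sg k (m - 1) • homotopy H (sh g θ) := by
      funext w t
      change sg k (Chain.cons g t).deg • H _ _ (θ w (.cons g t)) = sg k (m - 1) • sg k t.deg • H _ _ (θ w (.cons g t))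
      rw [smul_smul, Chain.deg_cons, sg_add]
    have h2 : homotopy H θ z (.cons (D.d m (m + 1) rfl g) s) =
        sg k (m + s.deg) • H _ _ (θ z (.cons (D.d m (m + 1) rfl g) s)) := by
      rw [homotopy, Chain.deg_cons]
      congr 3
      omega
    have h0 : ∀ {z : D.Obj} (s : Chain D x z), s.length < N → homotopy H θ z s = 0 :=
      fun s hs => by rw [homotopy, h s hs, map_zero, smul_zero]
    have ih := ih (N := N - 1) (θ := sh g θ) (fun s hs => h _ (by simp; omega)) (fun s => hP _)
      (by omega)
    rw [diff_cons _ rfl, diff_cons _ rfl, act_eq_zero h g s (by omega), act_eq_zero h0 g s (by omega),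
      h1, h2, map_smul, add_zero, add_zero, ← sh_apply g θ, ← ih, Chain.deg_cons]
    simp only [Pi.smul_apply, map_smul, map_add, sg_add, sg_sub, sg_one]
    by_cases hm : Even m <;> by_cases hs : Even s.deg <;> simp [sg, hm, hs] <;> abel

end Fnl

/-- In this range of lengths the source terms vanish, so closedness gives `diff` equal to zero and
the term `H` ∘ `diff` of `diff_homotopy` drops out. -/
theorem coherent.cdiff_homotopy {P : DGFunctor E E'} {F G : DGFunctor D E}
    {H : ∀ x y : E.Obj, E.Tot x y →ₗ[k] E.Tot x y}
    (hH : ∀ x y t, P.tmap t = 0 → P.tmap (H x y t) = 0 ∧ td (H x y t) + H x y (td t) = t)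
    {p q : ℤ} {N : ℕ} {η : ∀ y, Fnl D E G.obj (F.obj y) y}
    (hd : Fnl.cdiff (F := F) q η = 0) (hP : ∀ {x z} (s : Chain D x z), P.tmap (η x z s) = 0)
    (h : ∀ {x z : D.Obj} (s : Chain D x z), s.length < N → η x z s = 0)
    {x z : D.Obj} (s : Chain D x z) (hs : s.length < N + 1) :
    Fnl.cdiff (F := F) (G := G) p (fun y => Fnl.homotopy H (η y)) x z s = η x z s := by
  have hf : ∀ (q : ℤ) (η : ∀ y, Fnl D E G.obj (F.obj y) y),
      (∀ {x z : D.Obj} (s : Chain D x z), s.length < N → η x z s = 0) →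
      Fnl.front (F := F) (G := G) q η x z s = 0 := by
    intro q η h
    cases s with
    | nil => rfl
    | cons g s =>
      simp only [Chain.length_cons] at hs
      rw [Fnl.front_cons, h s (by omega), map_zero, LinearMap.zero_apply, smul_zero]
  have h1 : Fnl.diff G (η x) z s = 0 := by
    have := congrFun (congrFun (congrFun hd x) z) s
    rwa [Fnl.cdiff, Pi.add_apply, Pi.add_apply, hf q η h, add_zero] at this
  have h2 := Fnl.diff_homotopy (G := G) hH (N := N) (θ := η x) (fun s hs => h s (by exact_mod_cast hs))
    (fun s => hP s) s (by omega)
  rw [h1, map_zero, smul_zero, add_zero] at h2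
  rw [Fnl.cdiff, Pi.add_apply, Pi.add_apply, h2, hf, add_zero]
  intro x z s hs
  rw [Fnl.homotopy, h s hs, map_zero, smul_zero]

/-- Successive approximation along the length of chains: if `e` bounds `ζ` on chains shorter than
`N`, adding the homotopy applied to the defect ζ - d e bounds it on length `N` too. The correction
vanishes on shorter chains, so the values stabilize. -/
theorem coherent.map_ker_acyclic {P : DGFunctor E E'} (hP : P.IsTrivialFibration)
    (F G : DGFunctor D E) {l n : ℤ} (hl : l + 1 = n)
    (ζ : coherentHom F G n) (hζ : Fnl.cdiff (F := F) n ζ.1 = 0)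
    (hPζ : ∀ {x z} (s : Chain D x z), P.tmap (ζ.1 x z s) = 0) :
    ∃ η : coherentHom F G l, (∀ {x z} (s : Chain D x z), P.tmap (η.1 x z s) = 0) ∧
      Fnl.cdiff (F := F) l η.1 = ζ.1 := by
  choose H hH hH' using hP.exists_contraction
  have hsub : ∀ e : coherentHom F G l, Fnl.cdiff (F := F) n (ζ.1 - Fnl.cdiff (F := F) l e.1) = 0 := by
    intro e
    have h1 := Fnl.cdiff_lin (F := F) (p := n) (-1 : k) (Fnl.cdiff (F := F) l e.1) ζ.1
    have h2 : Fnl.cdiff (F := F) n (Fnl.cdiff (F := F) l e.1) = 0 :=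
      funext (Fnl.cdiff_cdiff hl fun y => (e.2 y).toIsMulti)
    rw [h2, hζ, smul_zero, add_zero] at h1
    rwa [neg_one_smul, neg_add_eq_sub] at h1
  let step : coherentHom F G l → coherentHom F G l := fun e =>
    e + ⟨fun y => Fnl.homotopy H (ζ.1 y - Fnl.cdiff (F := F) l e.1 y), fun y => by
      refine Fnl.IsNormalized.homotopy hH' hl ?_
      rw [sub_eq_neg_add, ← neg_one_smul k]
      exact ((Fnl.IsNormalized.cdiff hl e.2 y).smul _).add (ζ.2 y)⟩
  let e : ℕ → coherentHom F G l := fun N => step^[N] 0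
  have he : ∀ N, e (N + 1) = step (e N) := fun N => Function.iterate_succ_apply' _ _ _
  -- Composition with `P` commutes with the differential, so cochains with values in the kernel form
  -- a subcomplex.
  have hPd : ∀ η : coherentHom F G l, (∀ {x z} (s : Chain D x z), P.tmap (η.1 x z s) = 0) →
      ∀ {x z} (s : Chain D x z), P.tmap (Fnl.cdiff (F := F) l η.1 x z s) = 0 := by
    intro η h x z s
    have h1 := P.pushFnl_cdiff (F := F) l η.1 x
    have h2 : (fun y => P.pushFnl (η.1 y)) = 0 := by
      funext y z s
      exact h s
    rw [h2] at h1
    refine (congrFun (congrFun h1 z) s).trans ?_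
    exact Fnl.cdiff_eq_zero (F := F.comp P) (G := G.comp P) (N := s.length + 1) (fun _ _ => rfl) s
      (by omega)
  have key : ∀ N, (∀ {x z} (s : Chain D x z), P.tmap ((e N).1 x z s) = 0) ∧
      ∀ {x z} (s : Chain D x z), s.length < N → ζ.1 x z s - Fnl.cdiff (F := F) l (e N).1 x z s = 0 := by
    intro N
    induction N with
    | zero => exact ⟨fun s => map_zero _, fun s hs => absurd hs (Nat.not_lt_zero _)⟩
    | succ N ih =>
      have hP' : ∀ {x z} (s : Chain D x z),
          P.tmap ((ζ.1 - Fnl.cdiff (F := F) l (e N).1) x z s) = 0 := fun s => by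
        change P.tmap (_ - _) = 0
        rw [map_sub, hPζ, hPd _ ih.1, sub_zero]
      constructor
      · intro x z s
        rw [he]
        change P.tmap (_ + _ • _) = 0
        rw [map_add, ih.1, map_smul]
        refine (congrArg (0 + sg k s.deg • ·) (hH _ _ _ (hP' s)).1).trans ?_
        rw [smul_zero, add_zero]
      · intro x z s hs
        rw [he]
        have h1 := Fnl.cdiff_lin (F := F) (p := l) (1 : k) (e N).1
          (fun y => Fnl.homotopy H ((ζ.1 - Fnl.cdiff (F := F) l (e N).1) y))
        rw [one_smul, one_smul] at h1
        have h2 := coherent.cdiff_homotopy (p := l) hH (hsub (e N)) hP' ih.2 s hs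
        have h3 := congrFun (congrFun (congrFun h1 x) z) s
        refine (congrArg (ζ.1 x z s - ·) h3).trans ?_
        rw [Pi.add_apply, Pi.add_apply, Pi.add_apply, h2]
        simp only [Pi.sub_apply]
        abel
  have hstab : ∀ N M, N ≤ M → ∀ {x z} (s : Chain D x z), s.length < N →
      (e M).1 x z s = (e N).1 x z s := by
    intro N M hNM x z s hs
    induction M, hNM using Nat.le_induction with
    | base => rfl
    | succ M hNM ih =>
      rw [he, ← ih]
      change _ + _ • H _ _ (_ - _) = _
      rw [(key M).2 s (by omega), map_zero, smul_zero, add_zero]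
  -- The limit is read off at each chain from an approximation which is already stable there.
  refine ⟨⟨fun x z s => (e (s.length + 1)).1 x z s, fun x => .of_approx fun N =>
    ⟨(e N).1 x, (e N).2 x, fun s hs => (hstab _ _ hs s (by omega)).symm⟩⟩,
    fun s => (key _).1 s, ?_⟩
  funext x z s
  refine Eq.trans ?_ (sub_eq_zero.1 ((key (s.length + 1)).2 s (by omega))).symm
  rw [← sub_eq_zero]
  have h1 := Fnl.cdiff_lin (F := F) (p := l) (-1 : k) (e (s.length + 1)).1
    (fun x z s => (e (s.length + 1)).1 x z s)
  have h2 := congrFun (congrFun (congrFun h1 x) z) s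
  rw [neg_one_smul, neg_one_smul, neg_add_eq_sub, neg_add_eq_sub] at h2
  refine h2.symm.trans (Fnl.cdiff_eq_zero (N := s.length + 1) (fun t ht => ?_) s (by omega))
  change (e (t.length + 1)).1 _ _ t - (e (s.length + 1)).1 _ _ t = 0
  rw [hstab (t.length + 1) (s.length + 1) (by omega) t (by omega), sub_self]

/-- Applying a linear section of `P` to the values keeps multilinearity and normalization; it need
not respect differentials. -/
theorem coherent.map_surjective {P : DGFunctor E E'} (hP : P.IsTrivialFibration)
    (F G : DGFunctor D E) {n : ℤ} (b : coherentHom (F.comp P) (G.comp P) n) :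
    ∃ a : coherentHom F G n, ∀ x z (s : Chain D x z), P.tmap (a.1 x z s) = b.1 x z s := by
  have : ∀ (x y : E.Obj) (n : ℤ), ∃ S : E'.Hom (P.obj x) (P.obj y) n →ₗ[k] E.Hom x y n,
      ∀ b, P.map (S b) = b := fun x y n => by
    obtain ⟨S, hS⟩ := LinearMap.exists_rightInverse_of_surjective (P.map (x := x) (y := y) (n := n))
      (LinearMap.range_eq_top.2 (hP.map_surj x y n))
    exact ⟨S, LinearMap.congr_fun hS⟩
  choose S hS using this
  refine ⟨⟨fun x z s i => S _ _ i (b.1 x z s i), fun x => ⟨⟨fun a r g g' c => ?_⟩, fun s i hi => ?_,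
    fun a c => ?_⟩⟩, fun x z s => funext fun i => hS _ _ _ _⟩
  · funext i
    refine (congrArg (S _ _ i) (congrFun ((b.2 x).lin a r g g' c) i)).trans ?_
    exact (map_add _ _ _).trans (congrArg (· + _) (map_smul _ _ _))
  · exact (congrArg (S _ _ i) ((b.2 x).homog s i hi)).trans (map_zero _)
  · funext i
    exact (congrArg (S _ _ i) (congrFun ((b.2 x).one a c) i)).trans (map_zero _)

/-- Composition with a trivial fibration is a trivial fibration on dg categories of dg functors
out of a cofibrant dg category. -/
theorem coherent.map_isTrivialFibration (hD : D.IsCofibrant) {P : DGFunctor E E'}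
    (hP : P.IsTrivialFibration) : (coherent.map D P).IsTrivialFibration where
  obj_surj G := DGCat.isCofibrant_iff.1 hD E E' P G hP
  map_surj F G n b := by
    obtain ⟨a, ha⟩ := coherent.map_surjective hP F G b
    exact ⟨a, Subtype.ext (funext fun x => funext fun z => funext fun s => ha x z s)⟩
  ker_acyclic F G l n m hl hm ζ hζ hPζ := by
    obtain ⟨η, h, h'⟩ := coherent.map_ker_acyclic hP F G hl ζ (congrArg Subtype.val hζ)
      (fun s => congrFun (congrFun (congrFun (congrArg Subtype.val hPζ) _) _) s)
    exact ⟨η, Subtype.ext (funext fun x => funext fun z => funext fun s => h s), Subtype.ext h'⟩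

/-- The transposed lifting problem is one for `C` against composition with `P`, a trivial fibration
because `D` is cofibrant. -/
theorem twistedTensor_isCofibrant (hC : C.IsCofibrant) (hD : D.IsCofibrant) :
    (twistedTensor C D).IsCofibrant := by
  refine DGCat.isCofibrant_iff.2 fun E E' P F hP => ?_
  obtain ⟨Φ, hΦ⟩ := DGCat.isCofibrant_iff.1 hC _ _ _ ((twistedUniversal C D).map F).toCoherent
    (coherent.map_isTrivialFibration hD hP)
  refine ⟨twistedLift (TwistedData.ofCoherent Φ), twistedTensor_functor_ext ?_⟩
  change (TwistedData.ofCoherent Φ).toTwistedPreData.map P = _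
  rw [← TwistedData.ofCoherent_map, hΦ, TwistedData.ofCoherent_toCoherent]
  rfl

end Lifting

/-! ### Transfinite construction of morphisms out of relative cell complexes -/

section RelativeCellComplexes

open HomotopicalAlgebra

theorem HomotopicalAlgebra.AttachCells.basicCell_cell {C : Type*} [Category C] {α : Type*}
    {A B : α → C} {g : ∀ a, A a ⟶ B a} {X₁ X₂ : C} {f : X₁ ⟶ X₂} (c : AttachCells g f) (i : c.ι) :
    g (c.π i) ≫ c.cell i = (c.cofan₁.inj i ≫ c.g₁) ≫ f := by
  rw [AttachCells.cell_def, ← Category.assoc, ← c.hm, Category.assoc, Category.assoc, c.isPushout.w]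

theorem HomotopicalAlgebra.AttachCells.exists_desc {C : Type*} [Category C] {α : Type*}
    {A B : α → C} {g : ∀ a, A a ⟶ B a} {X₁ X₂ : C} {f : X₁ ⟶ X₂} (c : AttachCells g f) {Z : C}
    (φ : X₁ ⟶ Z) (G : ∀ i, B (c.π i) ⟶ Z)
    (h : ∀ i, g (c.π i) ≫ G i = (c.cofan₁.inj i ≫ c.g₁) ≫ φ) :
    ∃ ψ : X₂ ⟶ Z, f ≫ ψ = φ ∧ ∀ i, c.cell i ≫ ψ = G i := by
  have hG : ∀ i, c.cofan₂.inj i ≫ Limits.Cofan.IsColimit.desc c.isColimit₂ G = G i :=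
    Limits.Cofan.IsColimit.fac c.isColimit₂ G
  have w : c.g₁ ≫ φ = c.m ≫ Limits.Cofan.IsColimit.desc c.isColimit₂ G := by
    refine Limits.Cofan.IsColimit.hom_ext c.isColimit₁ _ _ fun i => ?_
    rw [← Category.assoc, ← h, ← Category.assoc, c.hm, Category.assoc, hG]
  exact ⟨c.isPushout.desc φ _ w, c.isPushout.inl_desc _ _ w, fun i => by
    rw [AttachCells.cell_def, Category.assoc, c.isPushout.inr_desc, hG]⟩

namespace HomotopicalAlgebra.RelativeCellComplex

universe w w' t v u'

variable {C : Type u'} [Category.{v} C] {J : Type w'} [LinearOrder J] [OrderBot J] [SuccOrder J]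
  [WellFoundedLT J] {α : J → Type t} {A B : (j : J) → α j → C}
  {basicCell : (j : J) → (i : α j) → A j i ⟶ B j i} {X Y : C} {f : X ⟶ Y}
  {c : RelativeCellComplex.{w} basicCell f}

/-- The inclusion of a cell in the next stage. -/
def Cells.top (γ : c.Cells) : B γ.j γ.i ⟶ c.F.obj (Order.succ γ.j) :=
  (c.attachCells γ.j γ.hj).cell γ.k

/-- The inclusion of a cell in the later stages. -/
def Cells.stage (γ : c.Cells) {j : J} (h : γ.j < j) : B γ.j γ.i ⟶ c.F.obj j :=
  γ.top ≫ c.F.map (homOfLE (Order.succ_le_of_lt h))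

/-- The attaching map of a cell. -/
def Cells.attach (γ : c.Cells) : A γ.j γ.i ⟶ c.F.obj γ.j :=
  (c.attachCells γ.j γ.hj).cofan₁.inj γ.k ≫ (c.attachCells γ.j γ.hj).g₁

theorem Cells.basicCell_top (γ : c.Cells) :
    basicCell γ.j γ.i ≫ γ.top = γ.attach ≫ c.F.map (homOfLE (Order.le_succ γ.j)) :=
  (c.attachCells γ.j γ.hj).basicCell_cell γ.k

theorem Cells.stage_map (γ : c.Cells) {j j' : J} (h : γ.j < j) (h' : γ.j < j') (hj : j ≤ j') :
    γ.stage h ≫ c.F.map (homOfLE hj) = γ.stage h' := by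
  rw [stage, stage, Category.assoc, ← Functor.map_comp]
  rfl

theorem Cells.stage_incl (γ : c.Cells) {j : J} (h : γ.j < j) :
    γ.stage h ≫ c.incl.app j = γ.ι := by
  rw [stage, Category.assoc, c.incl.naturality]
  exact congrArg (γ.top ≫ ·) (Category.comp_id _)

theorem Cells.basicCell_stage (γ : c.Cells) {j : J} (h : γ.j < j) :
    basicCell γ.j γ.i ≫ γ.stage h = γ.attach ≫ c.F.map (homOfLE h.le) := by
  rw [stage, ← Category.assoc, γ.basicCell_top, Category.assoc, ← Functor.map_comp]
  rfl

theorem Cells.stage_succ (γ : c.Cells) (h : γ.j < Order.succ γ.j) : γ.stage h = γ.top :=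
  (congrArg (γ.top ≫ ·) (c.F.map_id _)).trans (Category.comp_id _)

theorem Cells.basicCell_ι (γ : c.Cells) : basicCell γ.j γ.i ≫ γ.ι = γ.attach ≫ c.incl.app γ.j := by
  rw [← γ.stage_incl (Order.lt_succ_of_not_isMax γ.hj), ← Category.assoc, γ.basicCell_stage,
    Category.assoc, c.incl.naturality]
  exact congrArg (γ.attach ≫ ·) (Category.comp_id _)

variable (c) in
/-- The map from the source of the cell complex to a stage. -/
def toStage (j : J) : X ⟶ c.F.obj j := c.isoBot.inv ≫ c.F.map (homOfLE bot_le)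

theorem toStage_map {i j : J} (h : i ≤ j) : c.toStage i ≫ c.F.map (homOfLE h) = c.toStage j := by
  rw [toStage, toStage, Category.assoc, ← Functor.map_comp]
  rfl

theorem toStage_incl (j : J) : c.toStage j ≫ c.incl.app j = f := by
  rw [toStage, Category.assoc, c.incl.naturality]
  exact (congrArg _ (Category.comp_id _)).trans c.fac

/-- Transfinite induction: an isomorphism at the bottom, a pushout at successors, a colimit at limit
stages. -/
theorem stage_hom_ext {Z : C} {j : J} {φ φ' : c.F.obj j ⟶ Z}
    (h₀ : c.toStage j ≫ φ = c.toStage j ≫ φ')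
    (h : ∀ (γ : c.Cells) (hγ : γ.j < j), γ.stage hγ ≫ φ = γ.stage hγ ≫ φ') : φ = φ' := by
  induction j using SuccOrder.limitRecOn with
  | isMin j hj =>
    obtain rfl := hj.eq_bot
    have e : c.toStage ⊥ = c.isoBot.inv := by
      rw [toStage]
      exact (congrArg _ (c.F.map_id _)).trans (Category.comp_id _)
    rwa [e, cancel_epi] at h₀
  | succ j hj ih =>
    refine (c.attachCells j hj).hom_ext (ih ?_ fun γ hγ => ?_) fun i => ?_
    · rw [← Category.assoc, ← Category.assoc, toStage_map]
      exact h₀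
    · rw [← Category.assoc, ← Category.assoc, γ.stage_map hγ (hγ.trans_le (Order.le_succ j))]
      exact h γ _
    · have := h ⟨j, hj, i⟩ (Order.lt_succ_of_not_isMax hj)
      rwa [Cells.stage_succ] at this
  | isSuccLimit j hj ih =>
    refine (c.F.isColimitOfIsWellOrderContinuous j hj).hom_ext fun ⟨i, hi⟩ => ?_
    refine ih i hi ?_ fun γ hγ => ?_
    · change c.toStage i ≫ c.F.map (homOfLE (le_of_lt hi)) ≫ _ =
        c.toStage i ≫ c.F.map (homOfLE (le_of_lt hi)) ≫ _
      rw [← Category.assoc, ← Category.assoc, toStage_map]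
      exact h₀
    · change γ.stage hγ ≫ c.F.map (homOfLE (le_of_lt hi)) ≫ _ =
        γ.stage hγ ≫ c.F.map (homOfLE (le_of_lt hi)) ≫ _
      rw [← Category.assoc, ← Category.assoc, γ.stage_map hγ (hγ.trans hi)]
      exact h γ _

variable {Z : C} {φ₀ : X ⟶ Z} {Q : ∀ γ : c.Cells, (B γ.j γ.i ⟶ Z) → Prop}

variable (φ₀ Q) in
/-- The morphisms from a stage which satisfy given conditions on the cells. -/
structure StageDesc {j : J} (φ : c.F.obj j ⟶ Z) : Prop where
  bot : c.toStage j ≫ φ = φ₀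
  cell : ∀ (γ : c.Cells) (h : γ.j < j), Q γ (γ.stage h ≫ φ)

theorem StageDesc.restrict {i j : J} (h : i ≤ j) {φ : c.F.obj j ⟶ Z} (hφ : StageDesc φ₀ Q φ) :
    StageDesc φ₀ Q (c.F.map (homOfLE h) ≫ φ) where
  bot := by rw [← Category.assoc, toStage_map, hφ.bot]
  cell γ hγ := by
    rw [← Category.assoc, γ.stage_map hγ (hγ.trans_le h)]
    exact hφ.cell γ _

/-- Once two morphisms agree on the stage where a cell is attached, uniqueness of the extension
forces agreement on the cell. -/
theorem StageDesc.unique {j : J} {φ φ' : c.F.obj j ⟶ Z} (h : StageDesc φ₀ Q φ)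
    (h' : StageDesc φ₀ Q φ')
    (H : ∀ γ : c.Cells, γ.j < j → ∀ φ : c.F.obj γ.j ⟶ Z, StageDesc φ₀ Q φ →
      ∃! G, basicCell γ.j γ.i ≫ G = γ.attach ≫ φ ∧ Q γ G) : φ = φ' := by
  have : ∀ i (hi : i ≤ j), c.F.map (homOfLE hi) ≫ φ = c.F.map (homOfLE hi) ≫ φ' := by
    intro i
    induction i using WellFoundedLT.induction with
    | ind i ih =>
      intro hi
      refine stage_hom_ext ?_ fun γ hγ => ?_
      · rw [(h.restrict hi).bot, (h'.restrict hi).bot]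
      · rw [← Category.assoc, ← Category.assoc, γ.stage_map hγ (hγ.trans_le hi)]
        refine (H γ (hγ.trans_le hi) _ (h.restrict (hγ.le.trans hi))).unique
          ⟨?_, h.cell γ _⟩ ⟨?_, h'.cell γ _⟩
        · rw [← Category.assoc, γ.basicCell_stage, Category.assoc]
        · rw [← Category.assoc, γ.basicCell_stage, Category.assoc, ih _ hγ]
  have h1 := this j le_rfl
  have e : c.F.map (homOfLE (le_refl j)) = 𝟙 _ := c.F.map_id _
  rwa [e, Category.id_comp, Category.id_comp] at h1

/-- Because extensions to cells are unique, independently chosen morphisms on earlier stages are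
automatically compatible, and so glue at limit stages. -/
theorem exists_stageDesc (j : J)
    (H : ∀ γ : c.Cells, γ.j < j → ∀ φ : c.F.obj γ.j ⟶ Z, StageDesc φ₀ Q φ →
      ∃! G, basicCell γ.j γ.i ≫ G = γ.attach ≫ φ ∧ Q γ G) :
    ∃ φ : c.F.obj j ⟶ Z, StageDesc φ₀ Q φ := by
  induction j using SuccOrder.limitRecOn with
  | isMin j hj =>
    obtain rfl := hj.eq_bot
    refine ⟨c.isoBot.hom ≫ φ₀, ?_, fun γ hγ => absurd hγ not_lt_bot⟩
    have e : c.toStage ⊥ = c.isoBot.inv := by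
      rw [toStage]
      exact (congrArg _ (c.F.map_id _)).trans (Category.comp_id _)
    rw [e, Iso.inv_hom_id_assoc]
  | succ j hj ih =>
    have hlt := Order.lt_succ_of_not_isMax hj
    obtain ⟨φ, hφ⟩ := ih fun γ hγ => H γ (hγ.trans hlt)
    choose G hG using fun i => (H ⟨j, hj, i⟩ hlt φ hφ).exists
    obtain ⟨ψ, hψ, hψ'⟩ := (c.attachCells j hj).exists_desc φ G fun i => (hG i).1
    refine ⟨ψ, ?_, fun γ hγ => ?_⟩
    · rw [← toStage_map hlt.le, Category.assoc, hψ, hφ.bot]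
    · rcases (Order.lt_succ_iff_of_not_isMax hj).1 hγ |>.lt_or_eq with h | h
      · rw [← γ.stage_map h hγ hlt.le, Category.assoc, hψ]
        exact hφ.cell γ h
      · rcases γ with ⟨_, hj', i⟩
        obtain rfl := h
        rw [Cells.stage_succ]
        exact (hψ' i).symm ▸ (hG i).2
  | isSuccLimit j hj ih =>
    choose φ hφ using fun (i : Set.Iio j) => ih i i.2 fun γ hγ => H γ (hγ.trans i.2)
    let s : Limits.Cocone ((Set.principalSegIio j).monotone.functor ⋙ c.F) :=
      { pt := Z
        ι :=
          { app := φ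
            naturality := fun i i' h => by
              have hi : i.1 ≤ i'.1 := leOfHom h
              change c.F.map (homOfLE hi) ≫ φ i' = φ i ≫ 𝟙 Z
              rw [Category.comp_id]
              exact StageDesc.unique ((hφ i').restrict hi) (hφ i) fun γ hγ => H γ (hγ.trans i.2) } }
    obtain ⟨ψ, hψ⟩ : ∃ ψ : c.F.obj j ⟶ Z, ∀ (i : J) (hi : i < j),
        c.F.map (homOfLE hi.le) ≫ ψ = φ ⟨i, hi⟩ :=
      ⟨(c.F.isColimitOfIsWellOrderContinuous j hj).desc s, fun i hi =>
        (c.F.isColimitOfIsWellOrderContinuous j hj).fac s ⟨i, hi⟩⟩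
    refine ⟨ψ, ?_, fun γ hγ => ?_⟩
    · have h0 : (⊥ : J) < j := bot_lt_iff_ne_bot.2 fun h => hj.1 (h ▸ isMin_bot)
      rw [← toStage_map h0.le, Category.assoc, hψ _ h0]
      exact (hφ ⟨⊥, h0⟩).bot
    · rw [← γ.stage_map (Order.lt_succ_of_not_isMax γ.hj) hγ (hj.succ_lt hγ).le, Category.assoc,
        hψ _ (hj.succ_lt hγ)]
      exact (hφ ⟨_, hj.succ_lt hγ⟩).cell γ _

/-- Existence of morphisms out of a relative cell complex which satisfy given conditions on the
cells, if these conditions determine the extensions to a cell. -/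
theorem exists_desc (H : ∀ γ : c.Cells, ∀ φ : c.F.obj γ.j ⟶ Z, StageDesc φ₀ Q φ →
      ∃! G, basicCell γ.j γ.i ≫ G = γ.attach ≫ φ ∧ Q γ G) :
    ∃ φ : Y ⟶ Z, f ≫ φ = φ₀ ∧ (∀ γ : c.Cells, Q γ (γ.ι ≫ φ)) := by
  choose φ hφ using fun j : J => exists_stageDesc j fun γ _ => H γ
  let s : Limits.Cocone c.F :=
    { pt := Z
      ι :=
        { app := φ
          naturality := fun i i' h => by
            change c.F.map (homOfLE (leOfHom h)) ≫ φ i' = φ i ≫ 𝟙 Z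
            rw [Category.comp_id]
            exact StageDesc.unique ((hφ i').restrict _) (hφ i) fun γ _ => H γ } }
  obtain ⟨ψ, hψ⟩ : ∃ ψ : Y ⟶ Z, ∀ j, c.incl.app j ≫ ψ = φ j :=
    ⟨c.isColimit.desc s, fun j => c.isColimit.fac s j⟩
  refine ⟨ψ, ?_, fun γ => ?_⟩
  · have h1 := congrArg (· ≫ ψ) (toStage_incl (c := c) ⊥)
    simp only [Category.assoc, hψ, (hφ ⊥).bot] at h1
    exact h1.symm
  · rw [← γ.stage_incl (Order.lt_succ_of_not_isMax γ.hj), Category.assoc, hψ]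
    exact (hφ _).cell γ _

end HomotopicalAlgebra.RelativeCellComplex

end RelativeCellComplexes

/-! ### Dg functors out of spheres and disks -/

section FunctorsOutOfCells

variable {k : Type u} [Field k] {A B C Z : DGCat.{u} k}

open DGCat

namespace DGCat.Mor

theorem mk_inj {x y : A.Obj} {n : ℤ} {f g : A.Hom x y n} :
    (⟨x, y, n, f⟩ : A.Mor) = ⟨x, y, n, g⟩ ↔ f = g := by
  simp

theorem exists_eq (m : A.Mor) {x y : A.Obj} {n : ℤ} (hx : m.src = x) (hy : m.tgt = y)
    (hn : m.deg = n) : ∃ f : A.Hom x y n, m = ⟨x, y, n, f⟩ := by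
  subst hx; subst hy; subst hn
  exact ⟨m.hom, rfl⟩

/-- The differential. -/
def d (m : A.Mor) : A.Mor := ⟨m.src, m.tgt, m.deg + 1, A.d _ _ rfl m.hom⟩

/-- Scalar multiplication. -/
def smul (r : k) (m : A.Mor) : A.Mor := ⟨m.src, m.tgt, m.deg, r • m.hom⟩

end DGCat.Mor

namespace DGFunctor

/-- The action of a dg functor on morphisms, with their sources, targets and degrees. -/
def mapMor (F : DGFunctor A B) (m : A.Mor) : B.Mor := ⟨F.obj m.src, F.obj m.tgt, m.deg, F.map m.hom⟩

theorem mapMor_comp (F : DGFunctor A B) (G : DGFunctor B C) (m : A.Mor) :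
    (F.comp G).mapMor m = G.mapMor (F.mapMor m) := rfl

theorem mapMor_d (F : DGFunctor A B) (m : A.Mor) : F.mapMor m.d = (F.mapMor m).d :=
  Mor.mk_inj.2 (F.map_d _ _ _ _)

theorem mapMor_smul (F : DGFunctor A B) (r : k) (m : A.Mor) :
    F.mapMor (m.smul r) = (F.mapMor m).smul r :=
  Mor.mk_inj.2 (map_smul _ _ _)

theorem ext_obj {F G : DGFunctor A B} (h : ∀ x, F.obj x = G.obj x)
    (h' : ∀ m : A.Mor, F.mapMor m = G.mapMor m) : F = G := by
  rcases F with ⟨o, φ, h₁, h₂, h₃⟩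
  rcases G with ⟨o', ψ, h₁', h₂', h₃'⟩
  obtain rfl : o = o' := funext h
  exact DGFunctor.mk_congr o (fun f => Mor.mk_inj.1 (h' ⟨_, _, _, f⟩)) _ _ _ _ _ _

theorem ext_mor {F G : DGFunctor A B} (h : ∀ m : A.Mor, F.mapMor m = G.mapMor m) : F = G :=
  ext_obj (fun x => congrArg Mor.src (h ⟨x, x, 0, A.one x⟩)) h

theorem mapMor_zero {F G : DGFunctor A B} {x y : A.Obj} (hx : F.obj x = G.obj x)
    (hy : F.obj y = G.obj y) (n : ℤ) : F.mapMor ⟨x, y, n, 0⟩ = G.mapMor ⟨x, y, n, 0⟩ := by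
  have : ∀ (x x' y y' : B.Obj), x = x' → y = y' → (⟨x, y, n, 0⟩ : B.Mor) = ⟨x', y', n, 0⟩ := by
    rintro x _ y _ rfl rfl
    rfl
  exact (Mor.mk_inj.2 (map_zero _)).trans ((this _ _ _ _ hx hy).trans (Mor.mk_inj.2 (map_zero _).symm))

theorem mapMor_one {F G : DGFunctor A B} {x : A.Obj} (hx : F.obj x = G.obj x) :
    F.mapMor ⟨x, x, 0, A.one x⟩ = G.mapMor ⟨x, x, 0, A.one x⟩ := by
  have : ∀ (x x' : B.Obj), x = x' → (⟨x, x, 0, B.one x⟩ : B.Mor) = ⟨x', x', 0, B.one x'⟩ := by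
    rintro x _ rfl
    rfl
  exact (Mor.mk_inj.2 (F.map_one _)).trans ((this _ _ hx).trans (Mor.mk_inj.2 (G.map_one _).symm))

end DGFunctor

section Thin

variable {O : Type u} {S δ : O → O → ℤ → Prop} {h1 : ∀ x, S x x 0}
    {hc : ∀ x y z i j, S x y i → S y z j → S x z (j + i)}
    {hδ : ∀ x y n, δ x y n → S x y n ∧ S x y (n + 1) ∧ ¬ δ x y (n + 1)}
    {hl : ∀ x y z i j, S x y i → S y z j →
      (δ x z (j + i) ↔ δ y z j ∨ (δ x y i ∧ j = 0)) ∧ ¬ (δ y z j ∧ δ x y i) ∧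
        (δ x y i → j = 0)}

/-- The dg functor out of a dg category of lines given by the images of the generators of these
lines. -/
noncomputable def DGCat.thinLift (o : O → A.Obj) (e : ∀ x y n, A.Hom (o x) (o y) n)
    (e_one : ∀ x, e x x 0 = A.one (o x))
    (e_comp : ∀ x y z j i n (h : j + i = n), S x y i → S y z j →
      A.comp h (e y z j) (e x y i) = e x z n)
    (e_d : ∀ x y n m (h : n + 1 = m), δ x y n → A.d n m h (e x y n) = e x y m)
    (e_d_zero : ∀ x y n m (h : n + 1 = m), S x y n → ¬ δ x y n → A.d n m h (e x y n) = 0) :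
    DGFunctor (DGCat.thin k O S δ h1 hc hδ hl) A where
  obj := o
  map {x y n} := LinearMap.toSpanSingleton k _ (e x y n) ∘ₗ
    Submodule.subtype (p := DGCat.thinHom k S x y n)
  map_d {x y} n m h f := by
    classical
    rcases f with ⟨f, hf⟩
    change (if δ x y n then f else 0) • e x y m = A.d n m h (f • e x y n)
    rw [map_smul]
    by_cases hd : δ x y n
    · rw [if_pos hd, e_d _ _ _ _ h hd]
    · rw [if_neg hd, zero_smul]
      by_cases hS : S x y n
      · rw [e_d_zero _ _ _ _ h hS hd, smul_zero]
      · rw [hf hS, zero_smul]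
  map_one x := by
    exact (one_smul k _).trans (e_one x)
  map_comp {x y z j i n} h g f := by
    rcases f with ⟨f, hf⟩
    rcases g with ⟨g, hg⟩
    change (g * f) • e x z n = A.comp h (g • e y z j) (f • e x y i)
    rw [map_smul, map_smul, LinearMap.smul_apply, smul_smul, mul_comm f]
    by_cases hS : S x y i
    · by_cases hS' : S y z j
      · rw [e_comp x y z j i n h hS hS']
      · rw [hg hS', zero_mul, zero_smul, zero_smul]
    · rw [hf hS, mul_zero, zero_smul, zero_smul]

variable (k) in
/-- The generator of a line. -/
def DGCat.thinOne {x y : O} {n : ℤ} (h : S x y n) : DGCat.thinHom k S x y n :=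
  ⟨1, fun h' => absurd h h'⟩

theorem DGCat.thin_functor_ext {F G : DGFunctor (DGCat.thin k O S δ h1 hc hδ hl) A}
    (hobj : ∀ x, F.obj x = G.obj x)
    (h : ∀ (x y : O) (n : ℤ) (hS : S x y n), F.mapMor (Mor.mk (A := DGCat.thin k O S δ h1 hc hδ hl)
      x y n (thinOne k hS)) = G.mapMor ⟨x, y, n, thinOne k hS⟩) : F = G := by
  refine DGFunctor.ext_obj hobj fun ⟨x, y, n, f⟩ => ?_
  by_cases hS : S x y n
  · have : (⟨x, y, n, f⟩ : (DGCat.thin k O S δ h1 hc hδ hl).Mor) =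
        Mor.smul f.1 (Mor.mk (A := DGCat.thin k O S δ h1 hc hδ hl) x y n (thinOne k hS)) :=
      Mor.mk_inj.2 (Subtype.ext (mul_one f.1).symm)
    rw [this, F.mapMor_smul, G.mapMor_smul]
    exact congrArg _ (h x y n hS)
  · have : f = 0 := Subtype.ext (f.2 hS)
    rw [this]
    exact DGFunctor.mapMor_zero (hobj x) (hobj y) n

end Thin

theorem DGCat.unit_functor_ext {F G : DGFunctor (DGCat.unit k) A}
    (h : F.obj PUnit.unit = G.obj PUnit.unit) : F = G := by
  refine thin_functor_ext (fun _ => h) ?_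
  rintro ⟨⟩ ⟨⟩ n rfl
  exact DGFunctor.mapMor_one h

theorem DGCat.exists_unit_functor (x : A.Obj) :
    ∃ F : DGFunctor (DGCat.unit k) A, F.obj PUnit.unit = x := by
  refine ⟨thinLift (fun _ => x) (fun _ _ n => (tone x : A.Tot x x) n) (fun _ => ?_) ?_ ?_ ?_, rfl⟩
  · rw [tone, single_same]
  · rintro - - - j i n h rfl rfl
    obtain rfl : n = 0 := by omega
    rw [tone, single_same, A.one_comp]
  · exact fun _ _ _ _ _ h => h.elim
  · rintro - - n m h rfl -
    rw [tone, single_same, A.d_one]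

variable (k) in
/-- The generator of degree `1 - n` of `C(n)(a, b)`. -/
noncomputable def DGCat.sphereBot (n : ℤ) : (DGCat.sphere.{u} k n).Mor :=
  ⟨TwoObj.a, TwoObj.b, -n + 1, DGCat.thinOne k (S := sphereSupport n) (x := .a) (y := .b) rfl⟩

variable (k) in
/-- The generator of degree `-n` of `P(n)(a, b)`, with its source, target and degree. -/
noncomputable def DGCat.diskTopMor (n : ℤ) : (DGCat.disk.{u} k n).Mor :=
  ⟨TwoObj.a, TwoObj.b, -n, diskTop k n⟩

theorem DGCat.sphereBot_d (n : ℤ) :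
    (DGCat.sphere.{u} k n).d _ _ rfl (sphereBot k n).hom = 0 := by
  classical
  refine Subtype.ext ?_
  change (@ite k False (Classical.propDecidable False) 1 0) = 0
  rw [if_neg not_false]

/-- Attaching a cell along s(n) thus adjoins a primitive of the image of `sphereBot`. -/
theorem DGCat.mapMor_sphereBot (n : ℤ) :
    DGFunctor.mapMor (A := DGCat.sphere.{u} k n) (sphereToDisk k n) (sphereBot k n) =
      (diskTopMor k n).d := by
  refine Mor.mk_inj.2 (Subtype.ext ?_)
  classical
  exact (if_pos (c := diskDiff n .a .b (-n)) (t := (1 : k)) (e := 0) rfl).symm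

theorem DGCat.sphere_functor_ext {n : ℤ} {F G : DGFunctor (DGCat.sphere.{u} k n) A}
    (h : F.mapMor (sphereBot k n) = G.mapMor (sphereBot k n)) : F = G := by
  have hobj : ∀ x : TwoObj, F.obj x = G.obj x := by
    rintro (_ | _)
    · exact congrArg Mor.src h
    · exact congrArg Mor.tgt h
  refine thin_functor_ext hobj ?_
  rintro (_ | _) (_ | _) m hS
  · obtain rfl : m = 0 := hS
    exact DGFunctor.mapMor_one (hobj _)
  · obtain rfl : m = -n + 1 := hS
    exact h
  · exact hS.elim
  · obtain rfl : m = 0 := hS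
    exact DGFunctor.mapMor_one (hobj _)

/-- The line of degree 1 - n is spanned by the differential of the generator of degree -n, so that
generator decides. -/
theorem DGCat.disk_functor_ext {n : ℤ} {F G : DGFunctor (DGCat.disk.{u} k n) A}
    (h : F.mapMor (diskTopMor k n) = G.mapMor (diskTopMor k n)) : F = G := by
  have hobj : ∀ x : TwoObj, F.obj x = G.obj x := by
    rintro (_ | _)
    · exact congrArg Mor.src h
    · exact congrArg Mor.tgt h
  refine thin_functor_ext hobj ?_
  rintro (_ | _) (_ | _) m hS
  · obtain rfl : m = 0 := hS
    exact DGFunctor.mapMor_one (hobj _)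
  · by_cases hm : m = -n
    · subst hm
      exact h
    · obtain rfl : m = -n + 1 := hS.resolve_left hm
      have e : Mor.mk (A := DGCat.disk.{u} k n) .a .b (-n + 1) (thinOne k hS) = (diskTopMor k n).d :=
        mapMor_sphereBot n
      refine (congrArg F.mapMor e).trans (Eq.trans ?_ (congrArg G.mapMor e).symm)
      rw [F.mapMor_d, G.mapMor_d, h]
  · exact hS.elim
  · obtain rfl : m = 0 := hS
    exact DGFunctor.mapMor_one (hobj _)

theorem DGCat.exists_disk_functor (n : ℤ) {x y : A.Obj} (w : A.Hom x y (-n)) :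
    ∃ F : DGFunctor (DGCat.disk.{u} k n) A, F.mapMor (diskTopMor k n) = ⟨x, y, -n, w⟩ := by
  let o : TwoObj.{u} → A.Obj := fun t => match t with
    | .a => x
    | .b => y
  let e : ∀ s t n, A.Hom (o s) (o t) n := fun s t => match s, t with
    | .a, .a => (tone x : A.Tot x x)
    | .b, .b => (tone y : A.Tot y y)
    | .a, .b => (single (-n) w + single (-n + 1) (A.d (-n) (-n + 1) rfl w) : A.Tot x y)
    | .b, .a => (0 : A.Tot y x)
  have e0 : e .a .b (-n) = w := by
    change (single (-n) w : A.Tot x y) (-n) + (single _ _ : A.Tot x y) (-n) = w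
    rw [single_same, single_of_ne (by omega), add_zero]
  have e1 : e .a .b (-n + 1) = A.d (-n) (-n + 1) rfl w := by
    change (single (-n) w : A.Tot x y) (-n + 1) + (single _ _ : A.Tot x y) (-n + 1) = _
    rw [single_same, single_of_ne (by omega), zero_add]
  have ea : e .a .a 0 = A.one x := single_same _ _
  have eb : e .b .b 0 = A.one y := single_same _ _
  refine ⟨thinLift o e ?_ ?_ ?_ ?_, Mor.mk_inj.2 ((one_smul _ _).trans e0)⟩
  · rintro (_ | _)
    · exact ea
    · exact eb
  · rintro (_ | _) (_ | _) (_ | _) j i l h hi hj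
    · obtain rfl : i = 0 := hi
      obtain rfl : j = 0 := hj
      obtain rfl : l = 0 := by omega
      rw [ea]
      exact A.comp_one _ _
    · obtain rfl : i = 0 := hi
      obtain rfl : l = j := by omega
      rw [ea]
      exact A.comp_one _ _
    · exact hj.elim
    · obtain rfl : j = 0 := hj
      obtain rfl : l = i := by omega
      rw [eb]
      exact A.one_comp _ _
    · exact hi.elim
    · exact hi.elim
    · exact hj.elim
    · obtain rfl : i = 0 := hi
      obtain rfl : j = 0 := hj
      obtain rfl : l = 0 := by omega
      rw [eb]
      exact A.comp_one _ _
  · rintro (_ | _) (_ | _) i j h hδ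
    · exact hδ.elim
    · obtain rfl : i = -n := hδ
      obtain rfl := h
      rw [e0, e1]
    · exact hδ.elim
    · exact hδ.elim
  · rintro (_ | _) (_ | _) i j h hS hδ
    · obtain rfl : i = 0 := hS
      rw [ea]
      exact A.d_one _ _
    · obtain rfl : i = -n + 1 := hS.resolve_left hδ
      rw [e1]
      exact A.d_d _ _ _ _ _ _
    · exact hS.elim
    · obtain rfl : i = 0 := hS
      rw [eb]
      exact A.d_one _ _

theorem CellKind.generator_comp (i : CellKind) (F : CellKind.target.{u} k i ⟶ A) (G : DGFunctor A B) :
    CellKind.generator i (F ≫ G) = (CellKind.generator i F).map G.mapMor := by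
  cases i <;> rfl

/-- A dg functor on the sphere is a closed morphism and an extension to the disk is a primitive of
it. The conditions on objects place both in the complexes of morphisms to which `hU` applies. -/
theorem DGCat.existsUnique_disk_functor (n : ℤ) (ι : DGFunctor (DGCat.disk.{u} k n) C)
    (o : C.Obj → Z.Obj) (U : Z.Mor → Prop)
    (hU : ∀ z : Z.Hom (o (ι.mapMor (diskTopMor k n)).src) (o (ι.mapMor (diskTopMor k n)).tgt)
        ((ι.mapMor (diskTopMor k n)).deg + 1),
      Z.d _ _ rfl z = 0 → ∃! w, U ⟨_, _, _, w⟩ ∧ Z.d _ _ rfl w = z)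
    (H : DGFunctor (DGCat.sphere.{u} k n) Z)
    (hH : ∀ x : TwoObj, H.obj x = o (ι.obj x)) :
    ∃! G : DGFunctor (DGCat.disk.{u} k n) Z,
      DGFunctor.comp (A := DGCat.sphere.{u} k n) (sphereToDisk k n) G = H ∧
      (∀ x : TwoObj, G.obj x = o (ι.obj x)) ∧ U (G.mapMor (diskTopMor k n)) := by
  obtain ⟨z, hz⟩ := (H.mapMor (sphereBot k n)).exists_eq (hH TwoObj.a) (hH TwoObj.b) rfl
  have hz' : Z.d _ _ rfl z = 0 := by
    have h1 : ∀ m m' : Z.Mor, m = m' → Z.d _ _ rfl m.hom = 0 → Z.d _ _ rfl m'.hom = 0 := by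
      rintro m _ rfl h
      exact h
    exact h1 _ _ hz ((H.map_d _ _ rfl (sphereBot k n).hom).symm.trans
      ((congrArg H.map (sphereBot_d n)).trans (map_zero _)))
  obtain ⟨w, ⟨hw, hw'⟩, huniq⟩ := hU z hz'
  have key : ∀ G : DGFunctor (DGCat.disk.{u} k n) Z,
      (DGFunctor.comp (A := DGCat.sphere.{u} k n) (sphereToDisk k n) G).mapMor (sphereBot k n) =
        (G.mapMor (diskTopMor k n)).d := fun G => by
    rw [← DGFunctor.mapMor_d, ← mapMor_sphereBot]
    rfl
  obtain ⟨G, hG⟩ := exists_disk_functor n w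
  refine ⟨G, ⟨sphere_functor_ext ?_, ?_, ?_⟩, ?_⟩
  · refine (key G).trans (Eq.trans ?_ hz.symm)
    rw [hG]
    exact Mor.mk_inj.2 hw'
  · rintro (_ | _)
    · exact congrArg Mor.src hG
    · exact congrArg Mor.tgt hG
  · rw [hG]
    exact hw
  · rintro G' ⟨h1, h2, h4⟩
    obtain ⟨w', hw''⟩ := (G'.mapMor (diskTopMor k n)).exists_eq (h2 TwoObj.a) (h2 TwoObj.b) rfl
    rw [hw''] at h4
    have h5 := key G'
    rw [h1, hw'', hz] at h5
    obtain rfl := huniq w' ⟨h4, (Mor.mk_inj.1 h5).symm⟩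
    exact disk_functor_ext (hw''.trans hG.symm)

/-- Extensions of a dg functor to a cell, with given values on objects and a given condition on the
generator. -/
theorem CellKind.existsUnique_extension (i : CellKind) (ι : CellKind.target.{u} k i ⟶ C)
    (o : C.Obj → Z.Obj) (U : Z.Mor → Prop)
    (hU : ∀ m ∈ CellKind.generator i ι, ∀ z : Z.Hom (o m.src) (o m.tgt) (m.deg + 1),
      Z.d _ _ rfl z = 0 → ∃! w, U ⟨_, _, _, w⟩ ∧ Z.d _ _ rfl w = z)
    (H : CellKind.source.{u} k i ⟶ Z)
    (hH : ∀ x, DGFunctor.obj H x = o (DGFunctor.obj ι (DGFunctor.obj (generatingCofibration.{u} k i) x))) :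
    ∃! G : CellKind.target.{u} k i ⟶ Z, generatingCofibration k i ≫ G = H ∧
      (∀ x, DGFunctor.obj G x = o (DGFunctor.obj ι x)) ∧ ∀ m ∈ CellKind.generator i G, U m := by
  cases i with
  | obj =>
    obtain ⟨G, hG⟩ := exists_unit_functor (k := k) (o (DGFunctor.obj ι PUnit.unit))
    refine ⟨G, ⟨empty_functor_ext _ _, fun x => hG, fun m hm => by cases hm⟩, ?_⟩
    rintro G' ⟨-, hG', -⟩
    exact unit_functor_ext ((hG' PUnit.unit).trans hG.symm)
  | mor n =>
    obtain ⟨G, ⟨h1, h2, h3⟩, hG⟩ := existsUnique_disk_functor n ι o U (hU _ rfl) H hH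
    refine ⟨G, ⟨h1, h2, fun m hm => Option.some.inj hm ▸ h3⟩, ?_⟩
    rintro G' ⟨h1, h2, h3⟩
    exact hG G' ⟨h1, h2, h3 _ rfl⟩

end FunctorsOutOfCells

/-! ### Extension and generation properties of I-cell complexes -/

section CellComplexes

variable {k : Type u} [Field k] {A B C Z : DGCat.{u} k}

open DGCat HomotopicalAlgebra

variable (k) in
/-- The dg category with a given set of objects whose morphisms are all zero. -/
def DGCat.codiscrete (O : Type u) : DGCat.{u} k where
  Obj := O
  Hom _ _ _ := PUnit
  d _ _ _ := 0
  one _ := PUnit.unit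
  comp _ := 0
  d_d _ _ _ _ _ _ := rfl
  one_comp _ _ := rfl
  comp_one _ _ := rfl
  assoc _ _ _ _ _ _ _ := rfl
  leibniz _ _ _ _ _ _ _ _ := rfl

/-- A map from the set of objects, as a dg functor to a codiscrete dg category. -/
def DGCat.toCodiscrete {O : Type u} (o : A.Obj → O) : DGFunctor A (DGCat.codiscrete k O) where
  obj := o
  map := 0
  map_d _ _ _ _ := rfl
  map_one _ := rfl
  map_comp _ _ _ := rfl

theorem DGCat.codiscrete_functor_ext {O : Type u} {F G : DGFunctor A (DGCat.codiscrete k O)}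
    (h : ∀ x, F.obj x = G.obj x) : F = G := by
  refine DGFunctor.ext_obj h fun m => ?_
  have : ∀ (x x' y y' : O), x = x' → y = y' → ∀ n f f',
      (⟨x, y, n, f⟩ : (DGCat.codiscrete k O).Mor) = ⟨x', y', n, f'⟩ := by
    rintro x _ y _ rfl rfl n f f'
    rfl
  exact this _ _ _ _ (h _) (h _) _ _ _

namespace ICellComplex

variable (c : ICellComplex C)

/-- A map on objects is a dg functor to a codiscrete dg category, so equality of such maps can be
tested on cells. -/
theorem obj_eq_of_stageDesc {o : C.Obj → Z.Obj}
    {Q : ∀ γ : c.complex.Cells, (CellKind.target.{u} k γ.i ⟶ Z) → Prop}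
    (hQ : ∀ γ G, Q γ G → ∀ x, DGFunctor.obj G x = o (DGFunctor.obj γ.ι x)) {φ₀ : DGCat.empty k ⟶ Z}
    {j : c.J} {φ : c.complex.F.obj j ⟶ Z} (hφ : RelativeCellComplex.StageDesc φ₀ Q φ)
    (x : (c.complex.F.obj j).Obj) :
    DGFunctor.obj φ x = o (DGFunctor.obj (A := c.complex.F.obj j) (c.complex.incl.app j) x) := by
  have : DGFunctor.comp φ (toCodiscrete id) =
      DGFunctor.comp (c.complex.incl.app j) (toCodiscrete o) := by
    refine RelativeCellComplex.stage_hom_ext (c := c.complex)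
      (by exact empty_functor_ext _ _) fun γ hγ => ?_
    refine codiscrete_functor_ext fun x => (hQ _ _ (hφ.cell γ hγ) x).trans ?_
    rw [← γ.stage_incl hγ]
    rfl
  exact congrFun (congrArg DGFunctor.obj this) x

/-- A dg functor out of an `I`-cell complex exists for given values on objects, if for given closed
morphisms there are unique morphisms which bound them and satisfy given conditions. -/
theorem exists_functor (o : C.Obj → Z.Obj) (U : c.Gen → Z.Mor → Prop)
    (hU : ∀ (γ : c.Gen) (z : Z.Hom (o (c.gen γ).src) (o (c.gen γ).tgt) ((c.gen γ).deg + 1)),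
      Z.d _ _ rfl z = 0 → ∃! w, U γ ⟨_, _, _, w⟩ ∧ Z.d _ _ rfl w = z) :
    ∃ Φ : DGFunctor C Z, (∀ x, Φ.obj x = o x) ∧ ∀ γ, U γ (Φ.mapMor (c.gen γ)) := by
  -- The values on objects are part of the condition, so that the morphism to be bounded at each
  -- later cell has the source and target required by `hU`.
  let Q : ∀ γ : c.complex.Cells, (CellKind.target.{u} k γ.i ⟶ Z) → Prop := fun γ G =>
    (∀ x, DGFunctor.obj G x = o (DGFunctor.obj γ.ι x)) ∧
      ∀ m ∈ CellKind.generator γ.i G, ∀ h, U ⟨γ, h⟩ m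
  obtain ⟨Φ, -, hΦ⟩ := RelativeCellComplex.exists_desc (c := c.complex) (φ₀ := Z.emptyTo) (Q := Q)
    fun γ φ hφ => by
      refine CellKind.existsUnique_extension γ.i γ.ι o (fun m => ∀ h, U ⟨γ, h⟩ m) ?_ _ fun x => ?_
      · intro m hm z hz
        have hs : (CellKind.generator γ.i γ.ι).isSome := Option.isSome_iff_exists.2 ⟨m, hm⟩
        obtain rfl : c.gen ⟨γ, hs⟩ = m := Option.get_of_mem _ hm
        obtain ⟨w, ⟨hw, hw'⟩, huniq⟩ := hU ⟨γ, hs⟩ z hz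
        exact ⟨w, ⟨fun h => hw, hw'⟩, fun w' ⟨h1, h2⟩ => huniq w' ⟨h1 hs, h2⟩⟩
      · refine (obj_eq_of_stageDesc c (fun γ G hG => hG.1) hφ _).trans (congrArg o ?_)
        exact congrFun (congrArg DGFunctor.obj γ.basicCell_ι.symm) x
  refine ⟨Φ, fun x => ?_, fun γ => (hΦ γ.1).2 _ ?_ _⟩
  · have : DGFunctor.comp Φ (toCodiscrete id) = toCodiscrete o :=
      c.complex.hom_ext (empty_functor_ext _ _) fun γ => codiscrete_functor_ext (hΦ γ).1
    exact congrFun (congrArg DGFunctor.obj this) x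
  · rw [CellKind.generator_comp]
    exact Option.mem_map_of_mem _ (Option.get_mem _)

end ICellComplex

/-- The morphisms obtained from given ones by composition and linear combinations. -/
inductive DGCat.Closure (G : Set A.Mor) : ∀ {x y : A.Obj} {n : ℤ}, A.Hom x y n → Prop
  | gen {x y : A.Obj} {n : ℤ} (f : A.Hom x y n) (h : ⟨x, y, n, f⟩ ∈ G) : Closure G f
  | one (x : A.Obj) : Closure G (A.one x)
  | comp {x y z : A.Obj} {j i n : ℤ} (h : j + i = n) {g : A.Hom y z j} {f : A.Hom x y i}
      (hg : Closure G g) (hf : Closure G f) : Closure G (A.comp h g f)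
  | zero (x y : A.Obj) (n : ℤ) : Closure G (0 : A.Hom x y n)
  | add {x y : A.Obj} {n : ℤ} {f g : A.Hom x y n} (hf : Closure G f) (hg : Closure G g) :
      Closure G (f + g)
  | smul {x y : A.Obj} {n : ℤ} (r : k) {f : A.Hom x y n} (hf : Closure G f) : Closure G (r • f)

namespace DGCat.Closure

theorem mono {G G' : Set A.Mor} (h : G ⊆ G') {x y : A.Obj} {n : ℤ} {f : A.Hom x y n}
    (hf : Closure G f) : Closure G' f := by
  induction hf with
  | gen f hf => exact .gen f (h hf)
  | one => exact .one _
  | comp h _ _ ih ih' => exact .comp h ih ih'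
  | zero => exact .zero _ _ _
  | add _ _ ih ih' => exact .add ih ih'
  | smul r _ ih => exact .smul r ih

theorem sg_smul {G : Set A.Mor} {x y : A.Obj} {n : ℤ} {f : A.Hom x y n} (hf : Closure G f) (p : ℤ) :
    Closure G (p.negOnePow • f) := by
  rw [negOnePow_smul_eq_sg (k := k)]
  exact .smul _ hf

/-- By the Leibniz rule it is enough to differentiate the generators. -/
theorem d {G : Set A.Mor} (hG : ∀ m ∈ G, Closure G m.d.hom) {x y : A.Obj} {n m : ℤ} (hm : n + 1 = m)
    {f : A.Hom x y n} (hf : Closure G f) : Closure G (A.d n m hm f) := by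
  induction hf generalizing m with
  | gen f hf => subst hm; exact hG _ hf
  | one => rw [A.d_one]; exact .zero _ _ _
  | comp h hg hf ih ih' =>
    rw [A.leibniz h hm rfl rfl (by omega) (by omega)]
    exact .add (.comp _ (ih _) hf) (.sg_smul (.comp _ hg (ih' _)) _)
  | zero => rw [map_zero]; exact .zero _ _ _
  | add _ _ ih ih' => rw [map_add]; exact .add (ih _) (ih' _)
  | smul r _ ih => rw [map_smul]; exact .smul r (ih _)

end DGCat.Closure

/-- A dg subcategory, given by a set of objects and a subcomplex of each complex of morphisms. -/
structure DGCat.Sub (A : DGCat.{u} k) where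
  objs : Set A.Obj
  homs : ∀ x y n, Submodule k (A.Hom x y n)
  one_mem : ∀ x, A.one x ∈ homs x x 0
  comp_mem : ∀ {x y z : A.Obj} {j i n : ℤ} (h : j + i = n) {g : A.Hom y z j} {f : A.Hom x y i},
    g ∈ homs y z j → f ∈ homs x y i → A.comp h g f ∈ homs x z n
  d_mem : ∀ {x y : A.Obj} {n m : ℤ} (h : n + 1 = m) {f : A.Hom x y n}, f ∈ homs x y n →
    A.d n m h f ∈ homs x y m

namespace DGCat.Sub

variable (T : A.Sub)

/-- A dg subcategory, as a dg category. -/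
def toDGCat : DGCat.{u} k where
  Obj := T.objs
  Hom x y n := T.homs x y n
  d n m h := (A.d n m h).restrict fun _ hf => T.d_mem h hf
  one x := ⟨A.one x, T.one_mem x⟩
  comp {x y z j i n} h := LinearMap.mk₂ k
    (fun (g : T.homs y.1 z.1 j) (f : T.homs x.1 y.1 i) =>
      (⟨A.comp h g.1 f.1, T.comp_mem h g.2 f.2⟩ : T.homs x.1 z.1 n))
    (fun _ _ _ => Subtype.ext (by simp)) (fun _ _ _ => Subtype.ext (by simp))
    (fun _ _ _ => Subtype.ext (by simp)) (fun _ _ _ => Subtype.ext (by simp))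
  d_d n m l h h' f := Subtype.ext (A.d_d n m l h h' _)
  one_comp h f := Subtype.ext (A.one_comp h _)
  comp_one h f := Subtype.ext (A.comp_one h _)
  assoc h₁ h₂ h₃ h₄ a b c := Subtype.ext (A.assoc h₁ h₂ h₃ h₄ _ _ _)
  leibniz h hn hj hi h₁ h₂ g f := Subtype.ext (by
    rw [negOnePow_smul_eq_sg (k := k)]
    refine (A.leibniz h hn hj hi h₁ h₂ _ _).trans ?_
    rw [negOnePow_smul_eq_sg (k := k)]
    rfl)

/-- The inclusion of a dg subcategory. -/
def incl : DGFunctor T.toDGCat A where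
  obj x := x.1
  map {x y n} := (T.homs x.1 y.1 n).subtype
  map_d _ _ _ _ := rfl
  map_one _ := rfl
  map_comp _ _ _ := rfl

/-- The factorization of a dg functor through a dg subcategory. -/
def lift (F : DGFunctor B A) (h : ∀ x, F.obj x ∈ T.objs)
    (h' : ∀ {x y : B.Obj} {n : ℤ} (f : B.Hom x y n), F.map f ∈ T.homs _ _ n) :
    DGFunctor B T.toDGCat where
  obj x := ⟨F.obj x, h x⟩
  map := F.map.codRestrict _ h'
  map_d n m h f := Subtype.ext (F.map_d n m h f)
  map_one x := Subtype.ext (F.map_one x)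
  map_comp h g f := Subtype.ext (F.map_comp h g f)

theorem incl_mapMor_injective : Function.Injective T.incl.mapMor := by
  rintro ⟨⟨x, hx⟩, ⟨y, hy⟩, n, ⟨f, hf⟩⟩ ⟨⟨x', hx'⟩, ⟨y', hy'⟩, n', ⟨f', hf'⟩⟩ h
  change (⟨x, y, n, f⟩ : A.Mor) = ⟨x', y', n', f'⟩ at h
  cases h
  rfl

theorem incl_cancel {F G : DGFunctor B T.toDGCat} (h : F.comp T.incl = G.comp T.incl) : F = G :=
  DGFunctor.ext_mor fun m => T.incl_mapMor_injective
    (congrArg (fun H : DGFunctor B A => H.mapMor m) h)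

theorem map_mem_of_comp_incl {F : DGFunctor B T.toDGCat} {G : DGFunctor B A} (h : F.comp T.incl = G)
    {x y : B.Obj} {n : ℤ} (f : B.Hom x y n) : G.map f ∈ T.homs _ _ n := by
  subst h
  exact (F.map f).2

/-- The dg subcategory generated by given morphisms. -/
def closure (objs : Set A.Obj) (G : Set A.Mor) (hG : ∀ m ∈ G, Closure G m.d.hom) : A.Sub where
  objs := objs
  homs _ _ _ :=
    { carrier := {f | Closure G f}
      add_mem' := .add
      zero_mem' := .zero _ _ _
      smul_mem' := fun r _ => .smul r }
  one_mem := .one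
  comp_mem := .comp
  d_mem := .d hG

/-- A cell of a dg category whose generator is in a dg subcategory is a cell of that subcategory. -/
theorem exists_cell_lift (i : CellKind) (ι : CellKind.target.{u} k i ⟶ A)
    (h : ∀ x, DGFunctor.obj ι x ∈ T.objs)
    (h' : ∀ m ∈ CellKind.generator i ι, m.hom ∈ T.homs _ _ _) :
    ∃ G : CellKind.target.{u} k i ⟶ T.toDGCat, DGFunctor.comp G T.incl = ι := by
  cases i with
  | obj =>
    obtain ⟨G, hG⟩ := exists_unit_functor (A := T.toDGCat) ⟨_, h PUnit.unit⟩
    exact ⟨G, unit_functor_ext (congrArg Subtype.val hG)⟩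
  | mor n =>
    obtain ⟨G, hG⟩ := exists_disk_functor (A := T.toDGCat) n (x := ⟨_, h TwoObj.a⟩)
      (y := ⟨_, h TwoObj.b⟩) ⟨_, h' _ rfl⟩
    exact ⟨G, disk_functor_ext (congrArg T.incl.mapMor hG)⟩

end DGCat.Sub

/-- The differential of the generator of P(n) comes from C(n), hence from the attaching map. -/
theorem CellKind.generator_d_mem (i : CellKind) (ι : CellKind.target.{u} k i ⟶ A)
    (P : A.Mor → Prop) (h : ∀ m : (CellKind.source.{u} k i).Mor,
      P (DGFunctor.mapMor (generatingCofibration.{u} k i ≫ ι) m)) (m : A.Mor)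
    (hm : m ∈ CellKind.generator i ι) : P m.d := by
  cases i with
  | obj => cases hm
  | mor n =>
    obtain rfl := Option.some.inj hm
    have h1 := h (sphereBot k n)
    have h2 : DGFunctor.mapMor ι (diskTopMor k n).d = (DGFunctor.mapMor ι (diskTopMor k n)).d :=
      DGFunctor.mapMor_d _ _
    change P (DGFunctor.mapMor ι (diskTopMor k n)).d
    rw [← h2, ← mapMor_sphereBot]
    exact h1

namespace ICellComplex

variable (c : ICellComplex C)

theorem eq_gen {γ : c.complex.Cells} {m : C.Mor} (hm : m ∈ CellKind.generator γ.i γ.ι) :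
    ∃ h, c.gen ⟨γ, h⟩ = m :=
  ⟨Option.isSome_iff_exists.2 ⟨m, hm⟩, Option.get_of_mem _ hm⟩

/-- The inclusion of a dg subcategory is a monomorphism, so lifts of cells are unique, as
`exists_stageDesc` demands. -/
theorem exists_stage_lift (T : C.Sub) (j : c.J) (hT : T.objs = Set.univ)
    (h : ∀ γ : c.Gen, γ.1.j < j → (c.gen γ).hom ∈ T.homs _ _ _) :
    ∃ φ : c.complex.F.obj j ⟶ T.toDGCat, DGFunctor.comp φ T.incl = c.complex.incl.app j := by
  let Q : ∀ γ : c.complex.Cells, (CellKind.target.{u} k γ.i ⟶ T.toDGCat) → Prop := fun γ G =>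
    DGFunctor.comp G T.incl = γ.ι
  have key : ∀ {i : c.J} {φ : c.complex.F.obj i ⟶ T.toDGCat},
      RelativeCellComplex.StageDesc T.toDGCat.emptyTo Q φ →
      DGFunctor.comp φ T.incl = c.complex.incl.app i := fun hφ =>
    RelativeCellComplex.stage_hom_ext (c := c.complex) (by exact empty_functor_ext _ _) fun γ hγ =>
      (hφ.cell γ hγ).trans (γ.stage_incl hγ).symm
  obtain ⟨φ, hφ⟩ := RelativeCellComplex.exists_stageDesc (c := c.complex)
    (φ₀ := T.toDGCat.emptyTo) (Q := Q) j fun γ hγ φ hφ => by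
      obtain ⟨G, hG⟩ := T.exists_cell_lift γ.i γ.ι (fun x => hT ▸ Set.mem_univ _) fun m hm => by
        obtain ⟨hs, rfl⟩ := c.eq_gen hm
        exact h _ hγ
      refine ⟨G, ⟨T.incl_cancel ?_, hG⟩, fun G' h => T.incl_cancel (h.2.trans hG.symm)⟩
      have h1 : generatingCofibration k γ.i ≫ γ.ι = γ.attach ≫ c.complex.incl.app γ.j :=
        γ.basicCell_ι
      have h2 := key hφ
      rw [← hG, ← h2] at h1
      exact h1
  exact ⟨φ, key hφ⟩

/-- The generators of the stages before a given one. -/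
def genBefore (j : c.J) : Set C.Mor := {m | ∃ γ : c.Gen, γ.1.j < j ∧ c.gen γ = m}

/-- The differential of a generator comes from an earlier stage, so inductively it lies in the
closure of earlier generators. The closure is then a dg subcategory and the stage factors through
it. -/
theorem closure_stage (j : c.J) (m : (c.complex.F.obj j).Mor) :
    Closure (c.genBefore j) (DGFunctor.mapMor (c.complex.incl.app j) m).hom := by
  induction j using WellFoundedLT.induction with
  | ind j ih =>
    have hG : ∀ m ∈ c.genBefore j, Closure (c.genBefore j) m.d.hom := by
      rintro m ⟨γ, hγ, rfl⟩
      refine CellKind.generator_d_mem γ.1.i γ.1.ι (fun m => Closure (c.genBefore j) m.hom) ?_ _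
        (Option.get_mem _)
      intro m
      have h1 : generatingCofibration k γ.1.i ≫ γ.1.ι = γ.1.attach ≫ c.complex.incl.app γ.1.j :=
        γ.1.basicCell_ι
      rw [h1]
      refine (ih _ hγ (DGFunctor.mapMor γ.1.attach m)).mono ?_
      rintro _ ⟨γ', h, rfl⟩
      exact ⟨γ', h.trans hγ, rfl⟩
    obtain ⟨φ, hφ⟩ := c.exists_stage_lift (Sub.closure Set.univ _ hG) j rfl fun γ hγ =>
      .gen _ ⟨γ, hγ, rfl⟩
    exact Sub.map_mem_of_comp_incl _ hφ m.hom

/-- The differential of a generator is in the closure of the generators of smaller stages. -/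
theorem closure_gen_d (γ : c.Gen) : Closure (c.genBefore γ.1.j) (c.gen γ).d.hom := by
  refine CellKind.generator_d_mem γ.1.i γ.1.ι (fun m => Closure (c.genBefore γ.1.j) m.hom) ?_ _
    (Option.get_mem _)
  intro m
  have h1 : generatingCofibration k γ.1.i ≫ γ.1.ι = γ.1.attach ≫ c.complex.incl.app γ.1.j :=
    γ.1.basicCell_ι
  rw [h1]
  exact c.closure_stage _ (DGFunctor.mapMor γ.1.attach m)

/-- The morphisms of an `I`-cell complex are linear combinations of composites of generators. -/
theorem closure_gen {x y : C.Obj} {n : ℤ} (f : C.Hom x y n) : Closure (Set.range c.gen) f := by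
  have hG : ∀ m ∈ Set.range c.gen, Closure (Set.range c.gen) m.d.hom := by
    rintro _ ⟨γ, rfl⟩
    refine (c.closure_gen_d γ).mono ?_
    rintro _ ⟨γ', -, rfl⟩
    exact ⟨γ', rfl⟩
  let T := Sub.closure Set.univ _ hG
  choose φ hφ using fun j => c.exists_stage_lift T j rfl fun γ hγ => .gen _ ⟨γ, rfl⟩
  let s : Limits.Cocone c.complex.F :=
    { pt := T.toDGCat
      ι :=
        { app := φ
          naturality := fun i i' h => T.incl_cancel (by
            have h1 := c.complex.incl.naturality h
            have h2 := hφ i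
            have h3 := hφ i'
            rw [← h2, ← h3] at h1
            exact h1) } }
  -- The identity of `C` factors through `T`, so `T` contains every morphism.
  have h1 : DGFunctor.comp (c.complex.isColimit.desc s) T.incl = 𝟙 C :=
    c.complex.isColimit.hom_ext fun j => by
      have h1 := c.complex.isColimit.fac s j
      have h2 : (c.complex.incl.app j ≫ c.complex.isColimit.desc s) ≫ T.incl =
        c.complex.incl.app j := (congrArg (fun F => DGFunctor.comp F T.incl) h1).trans (hφ j)
      exact h2
  exact T.map_mem_of_comp_incl h1 f

end ICellComplex

end CellComplexes

/-! ### Graded functors and dg subcategories generated by morphisms -/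

section GradedFunctors

variable {k : Type u} [Field k] {A B C Z : DGCat.{u} k}

open DGCat

/-- The functors of graded categories which underlie dg functors with given values on objects. -/
structure GradedFunctor (A B : DGCat.{u} k) (o : A.Obj → B.Obj) where
  map : ∀ {x y : A.Obj} {n : ℤ}, A.Hom x y n →ₗ[k] B.Hom (o x) (o y) n
  map_one : ∀ x : A.Obj, map (A.one x) = B.one (o x)
  map_comp : ∀ {x y z : A.Obj} {j i n : ℤ} (h : j + i = n) (g : A.Hom y z j) (f : A.Hom x y i),
    map (A.comp h g f) = B.comp h (map g) (map f)

/-- The underlying graded functor of a dg functor. -/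
def DGFunctor.toGraded (F : DGFunctor A B) : GradedFunctor A B F.obj where
  map := F.map
  map_one := F.map_one
  map_comp := F.map_comp

namespace GradedFunctor

variable {o : A.Obj → Z.Obj}

/-- The action on morphisms, with their sources, targets and degrees. -/
def mapMor (Ψ : GradedFunctor A Z o) (m : A.Mor) : Z.Mor := ⟨o m.src, o m.tgt, m.deg, Ψ.map m.hom⟩

theorem map_zero_hom (Ψ : GradedFunctor A Z o) (x y : A.Obj) (n : ℤ) :
    Ψ.map (0 : A.Hom x y n) = 0 := map_zero _

theorem map_add_hom (Ψ : GradedFunctor A Z o) {x y : A.Obj} {n : ℤ} (f g : A.Hom x y n) :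
    Ψ.map (f + g) = Ψ.map f + Ψ.map g := map_add _ _ _

theorem map_smul_hom (Ψ : GradedFunctor A Z o) {x y : A.Obj} {n : ℤ} (r : k) (f : A.Hom x y n) :
    Ψ.map (r • f) = r • Ψ.map f := map_smul _ _ _

/-- Composition of a dg functor with a graded functor. -/
def precomp (Ψ : GradedFunctor A Z o) (F : DGFunctor B A) :
    GradedFunctor B Z (fun x => o (F.obj x)) where
  map := Ψ.map ∘ₗ F.map
  map_one x := (congrArg Ψ.map (F.map_one x)).trans (Ψ.map_one _)
  map_comp h g f := (congrArg Ψ.map (F.map_comp h g f)).trans (Ψ.map_comp _ _ _)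

/-- Both sides obey the same Leibniz rule along `Ψ`, so agreement on generators suffices. -/
theorem map_d_of_closure (Ψ : GradedFunctor A Z o) {G : Set A.Mor}
    (h : ∀ m ∈ G, Ψ.mapMor m.d = (Ψ.mapMor m).d) {x y : A.Obj} {n m : ℤ} (hm : n + 1 = m)
    {f : A.Hom x y n} (hf : Closure G f) : Ψ.map (A.d n m hm f) = Z.d n m hm (Ψ.map f) := by
  induction hf generalizing m with
  | gen f hf => subst hm; exact Mor.mk_inj.1 (h _ hf)
  | one => rw [A.d_one, Ψ.map_one, Z.d_one, map_zero]
  | comp h' hg hf ih ih' =>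
    rw [A.leibniz h' hm rfl rfl (by omega) (by omega), Ψ.map_comp,
      Z.leibniz h' hm rfl rfl (by omega) (by omega), map_add, negOnePow_smul_eq_sg (k := k),
      negOnePow_smul_eq_sg (k := k), map_smul, Ψ.map_comp, Ψ.map_comp, ih, ih']
  | zero => simp
  | add _ _ ih ih' => simp only [map_add, ih, ih']
  | smul r _ ih => simp only [map_smul, ih]

/-- The restriction of a graded functor to a dg functor on a dg subcategory generated by morphisms
on which the graded functor is compatible with differentials. -/
def restrict (Ψ : GradedFunctor A Z o) (objs : Set A.Obj) {G : Set A.Mor}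
    (hG : ∀ m ∈ G, Closure G m.d.hom) (h : ∀ m ∈ G, Ψ.mapMor m.d = (Ψ.mapMor m).d) :
    DGFunctor (Sub.closure objs G hG).toDGCat Z where
  obj x := o x.1
  map := (Ψ.precomp (Sub.closure objs G hG).incl).map
  map_d _ _ hm f := Ψ.map_d_of_closure h hm f.2
  map_one := (Ψ.precomp (Sub.closure objs G hG).incl).map_one
  map_comp := (Ψ.precomp (Sub.closure objs G hG).incl).map_comp

/-- The generating morphisms of a dg subcategory. -/
def _root_.DGCat.Sub.closureGen (objs : Set A.Obj) {G : Set A.Mor}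
    (hG : ∀ m ∈ G, Closure G m.d.hom) (hobjs : ∀ x, x ∈ objs) (m : A.Mor) (hm : m ∈ G) :
    (Sub.closure objs G hG).toDGCat.Mor :=
  ⟨⟨m.src, hobjs _⟩, ⟨m.tgt, hobjs _⟩, m.deg, ⟨m.hom, .gen _ hm⟩⟩

theorem closure_ext {objs : Set A.Obj} {G : Set A.Mor} {hG : ∀ m ∈ G, Closure G m.d.hom}
    (hobjs : ∀ x, x ∈ objs) {o : (Sub.closure objs G hG).toDGCat.Obj → Z.Obj}
    (Φ Ψ : GradedFunctor (Sub.closure objs G hG).toDGCat Z o)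
    (h : ∀ m hm, Φ.mapMor (Sub.closureGen objs hG hobjs m hm) =
      Ψ.mapMor (Sub.closureGen objs hG hobjs m hm))
    {x y : (Sub.closure objs G hG).toDGCat.Obj} {n : ℤ}
    (f : (Sub.closure objs G hG).toDGCat.Hom x y n) : Φ.map f = Ψ.map f := by
  have key : ∀ (x y : A.Obj) (n : ℤ) (f : A.Hom x y n) (hf : Closure G f),
      Φ.map (x := ⟨x, hobjs x⟩) (y := ⟨y, hobjs y⟩) (n := n) ⟨f, hf⟩ =
        Ψ.map (x := ⟨x, hobjs x⟩) (y := ⟨y, hobjs y⟩) (n := n) ⟨f, hf⟩ := by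
    intro x y n f hf
    induction hf with
    | gen f hf => exact Mor.mk_inj.1 (h _ hf)
    | one x => exact (Φ.map_one ⟨x, hobjs x⟩).trans (Ψ.map_one ⟨x, hobjs x⟩).symm
    | @comp x y z j i n e g f hg hf ih ih' =>
      refine (Φ.map_comp (x := ⟨x, hobjs x⟩) (y := ⟨y, hobjs y⟩) (z := ⟨z, hobjs z⟩) e ⟨g, hg⟩
        ⟨f, hf⟩).trans (Eq.trans ?_ (Ψ.map_comp (x := ⟨x, hobjs x⟩) (y := ⟨y, hobjs y⟩)
          (z := ⟨z, hobjs z⟩) e ⟨g, hg⟩ ⟨f, hf⟩).symm)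
      rw [ih, ih']
    | zero x y n =>
      exact (Φ.map_zero_hom ⟨x, hobjs x⟩ ⟨y, hobjs y⟩ n).trans
        (Ψ.map_zero_hom ⟨x, hobjs x⟩ ⟨y, hobjs y⟩ n).symm
    | @add x y n f g hf hg ih ih' =>
      refine (Φ.map_add_hom (x := ⟨x, hobjs x⟩) (y := ⟨y, hobjs y⟩) ⟨f, hf⟩ ⟨g, hg⟩).trans
        (Eq.trans ?_ (Ψ.map_add_hom (x := ⟨x, hobjs x⟩) (y := ⟨y, hobjs y⟩) ⟨f, hf⟩ ⟨g, hg⟩).symm)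
      rw [ih, ih']
    | @smul x y n r f hf ih =>
      refine (Φ.map_smul_hom (x := ⟨x, hobjs x⟩) (y := ⟨y, hobjs y⟩) r ⟨f, hf⟩).trans
        (Eq.trans ?_ (Ψ.map_smul_hom (x := ⟨x, hobjs x⟩) (y := ⟨y, hobjs y⟩) r ⟨f, hf⟩).symm)
      rw [ih]
  exact key _ _ _ _ f.2

end GradedFunctor

theorem DGCat.Sub.closure_functor_ext {objs : Set A.Obj} {G : Set A.Mor}
    {hG : ∀ m ∈ G, Closure G m.d.hom} (hobjs : ∀ x, x ∈ objs)
    {F F' : DGFunctor (Sub.closure objs G hG).toDGCat Z} (hobj : ∀ x, F.obj x = F'.obj x)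
    (h : ∀ m hm, F.mapMor (Sub.closureGen objs hG hobjs m hm) =
      F'.mapMor (Sub.closureGen objs hG hobjs m hm)) : F = F' := by
  rcases F with ⟨o, φ, h₁, h₂, h₃⟩
  rcases F' with ⟨o', ψ, h₁', h₂', h₃'⟩
  obtain rfl : o = o' := funext hobj
  exact DGFunctor.mk_congr o (fun f => GradedFunctor.closure_ext hobjs
    (DGFunctor.toGraded ⟨o, φ, h₁, h₂, h₃⟩) (DGFunctor.toGraded ⟨o, ψ, h₁', h₂', h₃'⟩) h f) _ _ _ _ _ _

/-- The inclusion of dg subcategories. -/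
def DGCat.Sub.ofLE {T T' : A.Sub} (h : T.objs ⊆ T'.objs) (h' : ∀ x y n, T.homs x y n ≤ T'.homs x y n) :
    DGFunctor T.toDGCat T'.toDGCat :=
  T'.lift T.incl (fun x => h x.2) fun f => h' _ _ _ f.2

end GradedFunctors

/-! ### Semifree dg categories and their filtration by stages -/

section Recognition

variable {k : Type u} [Field k] {A B C Z : DGCat.{u} k}

open DGCat HomotopicalAlgebra Limits

theorem DGCat.exists_sphere_functor (n : ℤ) {x y : A.Obj} (z : A.Hom x y (-n + 1))
    (hz : A.d _ _ rfl z = 0) :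
    ∃ F : DGFunctor (DGCat.sphere.{u} k n) A, F.mapMor (sphereBot k n) = ⟨x, y, -n + 1, z⟩ := by
  let o : TwoObj.{u} → A.Obj := fun t => match t with
    | .a => x
    | .b => y
  let e : ∀ s t n, A.Hom (o s) (o t) n := fun s t => match s, t with
    | .a, .a => (tone x : A.Tot x x)
    | .b, .b => (tone y : A.Tot y y)
    | .a, .b => (single (-n + 1) z : A.Tot x y)
    | .b, .a => (0 : A.Tot y x)
  have e1 : e .a .b (-n + 1) = z := single_same _ _
  have ea : e .a .a 0 = A.one x := single_same _ _
  have eb : e .b .b 0 = A.one y := single_same _ _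
  refine ⟨thinLift o e ?_ ?_ ?_ ?_, Mor.mk_inj.2 ((one_smul _ _).trans e1)⟩
  · rintro (_ | _)
    · exact ea
    · exact eb
  · rintro (_ | _) (_ | _) (_ | _) j i l h hi hj
    · obtain rfl : i = 0 := hi
      obtain rfl : j = 0 := hj
      obtain rfl : l = 0 := by omega
      rw [ea]
      exact A.comp_one _ _
    · obtain rfl : i = 0 := hi
      obtain rfl : l = j := by omega
      rw [ea]
      exact A.comp_one _ _
    · exact hj.elim
    · obtain rfl : j = 0 := hj
      obtain rfl : l = i := by omega
      rw [eb]
      exact A.one_comp _ _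
    · exact hi.elim
    · exact hi.elim
    · exact hj.elim
    · obtain rfl : i = 0 := hi
      obtain rfl : j = 0 := hj
      obtain rfl : l = 0 := by omega
      rw [eb]
      exact A.comp_one _ _
  · exact fun _ _ _ _ _ h => h.elim
  · rintro (_ | _) (_ | _) i j h hS -
    · obtain rfl : i = 0 := hS
      rw [ea]
      exact A.d_one _ _
    · obtain rfl : i = -n + 1 := hS
      obtain rfl := h
      rw [e1]
      exact hz
    · exact hS.elim
    · obtain rfl : i = 0 := hS
      rw [eb]
      exact A.d_one _ _

/-- A dg category which is freely generated, as a graded category, by a well-ordered family of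
morphisms such that the differential of each of them is in the graded subcategory generated by the
previous ones. -/
structure DGCat.IsSemifree {Γ : Type u} [LinearOrder Γ] (gen : Γ → A.Mor) : Prop where
  exists_graded : ∀ (Z : DGCat.{u} k) (o : A.Obj → Z.Obj)
    (m : ∀ γ, Z.Hom (o (gen γ).src) (o (gen γ).tgt) (gen γ).deg),
    ∃ Ψ : GradedFunctor A Z o, ∀ γ, Ψ.map (gen γ).hom = m γ
  closure : ∀ {x y : A.Obj} {n : ℤ} (f : A.Hom x y n), Closure (Set.range gen) f
  closure_d : ∀ γ, Closure {m | ∃ γ' < γ, gen γ' = m} (gen γ).d.hom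

/-- An exhaustion of a well-ordered set by the elements of another one. -/
structure IsExhaustion {Γ J : Type u} [LinearOrder Γ] [LinearOrder J] [OrderBot J] [OrderTop J]
    (lvl : Γ → J) : Prop where
  strictMono : StrictMono lvl
  bot_lt : ∀ γ, ⊥ < lvl γ
  lt_top : ∀ γ, lvl γ < ⊤
  bot_lt_top : (⊥ : J) < ⊤
  eq_bot_or : ∀ j : J, j < ⊤ → j = ⊥ ∨ ∃ γ, lvl γ = j

namespace DGCat.IsSemifree

variable {Γ J : Type u} [LinearOrder Γ] [LinearOrder J] [OrderBot J] [OrderTop J] {gen : Γ → A.Mor}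
  (H : IsSemifree gen) {lvl : Γ → J} (L : IsExhaustion lvl)

/-- The dg subcategory generated by the generators before a given level. -/
def stage (j : J) : A.Sub :=
  -- The bottom stage has no objects and every later stage has all of them: the first step attaches
  -- all object cells.
  Sub.closure {_x | ⊥ < j} {m | ∃ γ, lvl γ < j ∧ gen γ = m} (by
    rintro _ ⟨γ, hγ, rfl⟩
    refine (H.closure_d γ).mono ?_
    rintro _ ⟨γ', h, rfl⟩
    exact ⟨γ', (L.strictMono h).trans hγ, rfl⟩)

/-- A generator, as a morphism of a stage. -/
def genIn {γ : Γ} {j : J} (h : lvl γ < j) : (H.stage L j).toDGCat.Mor :=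
  Sub.closureGen _ _ (fun _ => (L.bot_lt γ).trans h) (gen γ) ⟨γ, h, rfl⟩

/-- The differential of a generator, as a morphism of a stage. -/
def genD (γ : Γ) : (H.stage L (lvl γ)).toDGCat.Mor :=
  ⟨⟨(gen γ).src, L.bot_lt γ⟩, ⟨(gen γ).tgt, L.bot_lt γ⟩, (gen γ).deg + 1, ⟨(gen γ).d.hom, by
    refine (H.closure_d γ).mono ?_
    rintro _ ⟨γ', h, rfl⟩
    exact ⟨γ', L.strictMono h, rfl⟩⟩⟩

/-- The inclusions of stages. -/
def stageMap {i j : J} (h : i ≤ j) : DGFunctor (H.stage L i).toDGCat (H.stage L j).toDGCat :=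
  Sub.ofLE (fun _ hx => lt_of_lt_of_le hx h) fun x y n f hf => by
    refine Closure.mono ?_ hf
    rintro _ ⟨γ, hγ, rfl⟩
    exact ⟨γ, hγ.trans_le h, rfl⟩

/-- The stages, as a functor. -/
def stages : J ⥤ DGCat.{u} k where
  obj j := (H.stage L j).toDGCat
  map h := H.stageMap L (leOfHom h)
  map_id _ := rfl
  map_comp _ _ := rfl

theorem stage_functor_ext {j : J} {F F' : DGFunctor (H.stage L j).toDGCat Z}
    (hobj : ∀ x, F.obj x = F'.obj x)
    (h : ∀ γ (hγ : lvl γ < j), F.mapMor (H.genIn L hγ) = F'.mapMor (H.genIn L hγ)) : F = F' := by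
  by_cases hj : ⊥ < j
  · refine Sub.closure_functor_ext (fun x => hj) hobj ?_
    rintro _ ⟨γ, hγ, rfl⟩
    exact h γ hγ
  · exact DGFunctor.ext_obj hobj fun m => absurd m.src.2 hj

/-- Dg functors out of a stage exist if they exist on the differentials of its generators. -/
theorem exists_stage_functor (j : J) (o : A.Obj → Z.Obj)
    (m : ∀ γ, Z.Hom (o (gen γ).src) (o (gen γ).tgt) (gen γ).deg)
    (φ : ∀ γ, lvl γ < j → DGFunctor (H.stage L (lvl γ)).toDGCat Z)
    (hφ : ∀ γ h x, (φ γ h).obj x = o x.1)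
    (hm : ∀ γ h γ' (h' : lvl γ' < lvl γ), (φ γ h).mapMor (H.genIn L h') = ⟨_, _, _, m γ'⟩)
    (hd : ∀ γ h, (φ γ h).mapMor (H.genD L γ) = Mor.d ⟨_, _, _, m γ⟩) :
    ∃ ψ : DGFunctor (H.stage L j).toDGCat Z, (∀ x, ψ.obj x = o x.1) ∧
      ∀ γ (h : lvl γ < j), ψ.mapMor (H.genIn L h) = ⟨_, _, _, m γ⟩ := by
  obtain ⟨Ψ, hΨ⟩ := H.exists_graded Z o m
  -- On the stage below `γ` the given dg functor and the free graded functor agree on generators,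
  -- hence everywhere. So the graded functor respects the differential of each generator.
  have key : ∀ γ (h : lvl γ < j) (f : (H.stage L (lvl γ)).toDGCat.Mor),
      (φ γ h).mapMor f = Ψ.mapMor ((H.stage L (lvl γ)).incl.mapMor f) := by
    intro γ h f
    have h1 := hφ γ h
    have h2 := hm γ h
    generalize φ γ h = F at h1 h2
    rcases F with ⟨o', φ', e₁, e₂, e₃⟩
    obtain rfl : o' = fun x => o x.1 := funext h1
    refine Mor.mk_inj.2 (GradedFunctor.closure_ext (fun x => L.bot_lt γ)
      (DGFunctor.toGraded ⟨_, φ', e₁, e₂, e₃⟩) (Ψ.precomp (H.stage L (lvl γ)).incl) ?_ f.hom)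
    rintro _ ⟨γ', h', rfl⟩
    exact (h2 γ' h').trans (Mor.mk_inj.2 (hΨ γ').symm)
  refine ⟨Ψ.restrict _ _ ?_, fun x => rfl, fun γ h => Mor.mk_inj.2 (hΨ γ)⟩
  rintro _ ⟨γ, h, rfl⟩
  refine (key γ h (H.genD L γ)).symm.trans ((hd γ h).trans ?_)
  rw [← hΨ]
  rfl

end DGCat.IsSemifree

end Recognition

/-! ### Consecutive stages are pushouts, limit stages are colimits -/

section Presentation

variable {k : Type u} [Field k] {A B C Z : DGCat.{u} k}

open DGCat HomotopicalAlgebra Limits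

namespace DGCat.IsSemifree

variable {Γ J : Type u} [LinearOrder Γ] [LinearJ : LinearOrder J] [OrderBot J] [OrderTop J]
  {gen : Γ → A.Mor} (H : IsSemifree gen) {lvl : Γ → J} (L : IsExhaustion lvl)

theorem exists_attach (γ : Γ) :
    ∃ g : DGFunctor (DGCat.sphere.{u} k (-(gen γ).deg)) (H.stage L (lvl γ)).toDGCat,
      g.mapMor (sphereBot k _) = H.genD L γ := by
  -- The cell has index -deg, so its generator lives in degree - -deg, which equals deg only
  -- propositionally.
  obtain ⟨f, hf⟩ := (H.genD L γ).exists_eq (n := - -(gen γ).deg + 1) rfl rfl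
    (by rw [neg_neg]; rfl)
  rw [hf]
  refine exists_sphere_functor _ f ?_
  have h1 : ∀ m m' : (H.stage L (lvl γ)).toDGCat.Mor, m = m' →
      DGCat.d _ _ _ rfl m.hom = 0 → DGCat.d _ _ _ rfl m'.hom = 0 := by
    rintro m _ rfl h
    exact h
  exact h1 _ _ hf (Subtype.ext (A.d_d _ _ _ _ _ _))

theorem exists_cell (γ : Γ) {j : J} (h : lvl γ < j) :
    ∃ g : DGFunctor (DGCat.disk.{u} k (-(gen γ).deg)) (H.stage L j).toDGCat,
      g.mapMor (diskTopMor k _) = H.genIn L h := by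
  obtain ⟨f, hf⟩ := (H.genIn L h).exists_eq (n := - -(gen γ).deg) rfl rfl (by rw [neg_neg]; rfl)
  rw [hf]
  exact exists_disk_functor _ f

/-- The attaching map of the cell of a generator. -/
noncomputable def attachMap (γ : Γ) :
    DGCat.sphere.{u} k (-(gen γ).deg) ⟶ (H.stage L (lvl γ)).toDGCat :=
  (H.exists_attach L γ).choose

/-- The cell of a generator. -/
noncomputable def cellMap (γ : Γ) {j : J} (h : lvl γ < j) :
    DGCat.disk.{u} k (-(gen γ).deg) ⟶ (H.stage L j).toDGCat :=
  (H.exists_cell L γ h).choose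

theorem mapMor_attachMap (γ : Γ) :
    DGFunctor.mapMor (A := DGCat.sphere.{u} k _) (H.attachMap L γ) (sphereBot k _) = H.genD L γ :=
  (H.exists_attach L γ).choose_spec

theorem mapMor_cellMap (γ : Γ) {j : J} (h : lvl γ < j) :
    DGFunctor.mapMor (A := DGCat.disk.{u} k _) (H.cellMap L γ h) (diskTopMor k _) = H.genIn L h :=
  (H.exists_cell L γ h).choose_spec

theorem comp_cellMap (γ : Γ) {j : J} (h : lvl γ < j) :
    DGFunctor.comp (A := DGCat.sphere.{u} k _) (H.attachMap L γ) (H.stageMap L h.le) =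
      DGFunctor.comp (A := DGCat.sphere.{u} k _) (sphereToDisk k _) (H.cellMap L γ h) := by
  refine sphere_functor_ext ?_
  rw [DGFunctor.mapMor_comp, DGFunctor.mapMor_comp, mapMor_attachMap, mapMor_sphereBot,
    DGFunctor.mapMor_d, mapMor_cellMap]
  rfl

/-- By `hj`, `γ` is the last generator of the stage `j`. Its value comes from `G` and those of the
earlier ones from `φ`; generators outside the stage get the irrelevant value 0. -/
theorem exists_pushout_desc (γ : Γ) {j : J} (h : lvl γ < j) (hj : ∀ γ', lvl γ' < j → γ' ≤ γ)
    (φ : DGFunctor (H.stage L (lvl γ)).toDGCat Z)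
    (G : DGFunctor (DGCat.disk.{u} k (-(gen γ).deg)) Z)
    (hG : DGFunctor.comp (A := DGCat.sphere.{u} k _) (H.attachMap L γ) φ =
      DGFunctor.comp (A := DGCat.sphere.{u} k _) (sphereToDisk k _) G) :
    ∃ ψ : DGFunctor (H.stage L j).toDGCat Z, (H.stageMap L h.le).comp ψ = φ ∧
      DGFunctor.comp (A := DGCat.disk.{u} k _) (H.cellMap L γ h) ψ = G := by
  let o : A.Obj → Z.Obj := fun x => φ.obj ⟨x, L.bot_lt γ⟩
  have hd : (G.mapMor (diskTopMor k _)).d = φ.mapMor (H.genD L γ) := by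
    rw [← DGFunctor.mapMor_d, ← mapMor_sphereBot, ← mapMor_attachMap]
    exact congrArg (fun F : DGFunctor (DGCat.sphere.{u} k _) Z => F.mapMor (sphereBot k _)) hG.symm
  obtain ⟨w, hw⟩ := (G.mapMor (diskTopMor k _)).exists_eq (x := o (gen γ).src) (y := o (gen γ).tgt)
    (n := (gen γ).deg) (congrArg Mor.src hd) (congrArg Mor.tgt hd) (neg_neg _)
  have hm : ∀ γ', ∃ m : Z.Hom (o (gen γ').src) (o (gen γ').tgt) (gen γ').deg,
      (∀ h : lvl γ' < lvl γ, φ.mapMor (H.genIn L h) = ⟨_, _, _, m⟩) ∧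
        (γ' = γ → G.mapMor (diskTopMor k _) = ⟨_, _, _, m⟩) := by
    intro γ'
    by_cases h1 : γ' = γ
    · subst h1
      exact ⟨w, fun h => absurd h (lt_irrefl _), fun _ => hw⟩
    · by_cases h2 : lvl γ' < lvl γ
      · exact ⟨φ.map (H.genIn L h2).hom, fun _ => rfl, fun h => absurd h h1⟩
      · exact ⟨0, fun h => absurd h h2, fun h => absurd h h1⟩
  choose m hm₁ hm₂ using hm
  have hle : ∀ {γ'}, lvl γ' < j → lvl γ' ≤ lvl γ := fun h' => L.strictMono.monotone (hj _ h')
  obtain ⟨ψ, hψo, hψ⟩ := H.exists_stage_functor L j o m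
    (fun γ' h' => (H.stageMap L (hle h')).comp φ) (fun _ _ _ => rfl)
    (fun γ' h' γ'' h'' => hm₁ γ'' (h''.trans_le (hle h'))) (by
      intro γ' h'
      rcases (hj _ h').eq_or_lt with rfl | h''
      · rw [← hm₂ _ rfl, hd]
        rfl
      · rw [← hm₁ _ (L.strictMono h''), ← DGFunctor.mapMor_d]
        rfl)
  refine ⟨ψ, H.stage_functor_ext L (fun x => hψo _) fun γ' h' => ?_, disk_functor_ext ?_⟩
  · exact (hψ γ' (h'.trans h)).trans (hm₁ _ h').symm
  · rw [DGFunctor.mapMor_comp, mapMor_cellMap]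
    exact (hψ γ h).trans (hm₂ _ rfl).symm

theorem pushout_hom_ext (γ : Γ) {j : J} (h : lvl γ < j) (hj : ∀ γ', lvl γ' < j → γ' ≤ γ)
    {F F' : DGFunctor (H.stage L j).toDGCat Z}
    (h1 : (H.stageMap L h.le).comp F = (H.stageMap L h.le).comp F')
    (h2 : DGFunctor.comp (A := DGCat.disk.{u} k _) (H.cellMap L γ h) F =
      DGFunctor.comp (A := DGCat.disk.{u} k _) (H.cellMap L γ h) F') : F = F' := by
  refine H.stage_functor_ext L (fun x => ?_) fun γ' h' => ?_
  · exact congrFun (congrArg DGFunctor.obj h1) ⟨x.1, L.bot_lt γ⟩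
  · rcases (hj _ h').eq_or_lt with rfl | h''
    · rw [← mapMor_cellMap]
      exact congrArg (fun F : DGFunctor (DGCat.disk.{u} k _) Z => F.mapMor (diskTopMor k _)) h2
    · exact congrArg (fun F : DGFunctor (H.stage L (lvl γ)).toDGCat Z =>
        F.mapMor (H.genIn L (L.strictMono h''))) h1

theorem isPushout (γ : Γ) {j : J} (h : lvl γ < j) (hj : ∀ γ', lvl γ' < j → γ' ≤ γ) :
    IsPushout (H.attachMap L γ) (sphereToDisk k _) ((H.stages L).map (homOfLE h.le))
      (H.cellMap L γ h) where
  w := H.comp_cellMap L γ h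
  isColimit' := ⟨by
    choose ψ h1 h2 using fun s : PushoutCocone (H.attachMap L γ) (sphereToDisk.{u} k _) =>
      H.exists_pushout_desc L γ h hj s.inl s.inr s.condition
    exact PushoutCocone.IsColimit.mk _ ψ h1 h2 fun s m e e' =>
      H.pushout_hom_ext L γ h hj (e.trans (h1 s).symm) (e'.trans (h2 s).symm)⟩

/-- The value at a generator is read off at any stage strictly between its level and `j`;
compatibility makes the choice immaterial. -/
theorem exists_limit_desc {j : J} (hj : ⊥ < j) (hlim : ∀ i < j, ∃ i' < j, i < i')
    (φ : ∀ i < j, DGFunctor (H.stage L i).toDGCat Z)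
    (hφ : ∀ i i' (hi : i < j) (hi' : i' < j) (h : i ≤ i'),
      (H.stageMap L h).comp (φ i' hi') = φ i hi) :
    ∃ ψ : DGFunctor (H.stage L j).toDGCat Z,
      ∀ i (hi : i < j), (H.stageMap L hi.le).comp ψ = φ i hi := by
  obtain ⟨i₁, hi₁, hb⟩ := hlim ⊥ hj
  let o : A.Obj → Z.Obj := fun x => (φ i₁ hi₁).obj ⟨x, hb⟩
  have ho : ∀ i (hi : i < j) (x : (H.stage L i).toDGCat.Obj), (φ i hi).obj x = o x.1 := by
    intro i hi x
    rcases le_total i i₁ with h | h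
    · exact (congrFun (congrArg DGFunctor.obj (hφ i i₁ hi hi₁ h)) x).symm
    · exact congrFun (congrArg DGFunctor.obj (hφ i₁ i hi₁ hi h)) ⟨x.1, hb⟩
  have hm : ∀ γ, ∃ m : Z.Hom (o (gen γ).src) (o (gen γ).tgt) (gen γ).deg,
      ∀ i (hi : i < j) (h : lvl γ < i), (φ i hi).mapMor (H.genIn L h) = ⟨_, _, _, m⟩ := by
    intro γ
    by_cases hγ : lvl γ < j
    · obtain ⟨i', hi', h'⟩ := hlim _ hγ
      obtain ⟨m, hm⟩ := ((φ i' hi').mapMor (H.genIn L h')).exists_eq (x := o (gen γ).src)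
        (y := o (gen γ).tgt) (n := (gen γ).deg) (ho _ _ _) (ho _ _ _) rfl
      refine ⟨m, fun i hi h => Eq.trans ?_ hm⟩
      rcases le_total i i' with e | e
      · rw [← hφ i i' hi hi' e]
        rfl
      · rw [← hφ i' i hi' hi e]
        rfl
    · exact ⟨0, fun i hi h => absurd (h.trans hi) hγ⟩
  choose m hm using hm
  obtain ⟨ψ, hψo, hψ⟩ := H.exists_stage_functor L j o m (fun γ h => φ _ h) (fun γ h => ho _ h)
    (fun γ h γ' h' => hm γ' _ h h') (by
      intro γ h
      obtain ⟨i', hi', h'⟩ := hlim _ h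
      rw [← hm γ i' hi' h', ← DGFunctor.mapMor_d, ← hφ _ _ h hi' h'.le]
      rfl)
  refine ⟨ψ, fun i hi => H.stage_functor_ext L (fun x => (hψo _).trans (ho i hi x).symm) ?_⟩
  exact fun γ h => (hψ γ (h.trans hi)).trans (hm γ i hi h).symm

theorem limit_hom_ext {j : J} (hj : ⊥ < j) (hlim : ∀ i < j, ∃ i' < j, i < i')
    {F F' : DGFunctor (H.stage L j).toDGCat Z}
    (h : ∀ i (hi : i < j), (H.stageMap L hi.le).comp F = (H.stageMap L hi.le).comp F') :
    F = F' := by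
  obtain ⟨i₁, hi₁, hb⟩ := hlim ⊥ hj
  refine H.stage_functor_ext L (fun x => ?_) fun γ hγ => ?_
  · exact congrFun (congrArg DGFunctor.obj (h i₁ hi₁)) ⟨x.1, hb⟩
  · obtain ⟨i', hi', h'⟩ := hlim _ hγ
    exact congrArg (fun F : DGFunctor (H.stage L i').toDGCat Z => F.mapMor (H.genIn L h')) (h i' hi')

theorem isWellOrderContinuous : (H.stages L).IsWellOrderContinuous where
  nonempty_isColimit j hj := by
    have hj' : ⊥ < j := hj.bot_lt
    have hlim : ∀ i < j, ∃ i' < j, i < i' := fun i hi => by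
      obtain ⟨i', h1, h2⟩ := hj.lt_iff_exists_lt.1 hi
      exact ⟨i', h1, h2⟩
    choose ψ hψ using fun s : Cocone ((Set.principalSegIio j).monotone.functor ⋙ H.stages L) =>
      H.exists_limit_desc L hj' hlim (fun i hi => s.ι.app ⟨i, hi⟩)
        (fun i i' hi hi' h => s.w (homOfLE h : (⟨i, hi⟩ : Set.Iio j) ⟶ ⟨i', hi'⟩))
    exact ⟨{ desc := ψ
             fac := fun s i => hψ s i.1 i.2
             uniq := fun s m hm => H.limit_hom_ext L hj' hlim fun i hi =>
              (hm ⟨i, hi⟩).trans (hψ s i hi).symm }⟩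

theorem bot_functor_ext {F F' : DGFunctor (H.stage L ⊥).toDGCat Z} : F = F' :=
  H.stage_functor_ext L (fun x => absurd x.2 (lt_irrefl _)) fun _ h => absurd h not_lt_bot

theorem exists_bot_functor (Z : DGCat.{u} k) :
    Nonempty (DGFunctor (H.stage L ⊥).toDGCat Z) :=
  ⟨{ obj := fun x => absurd x.2 (lt_irrefl _)
     map := fun {x} => absurd x.2 (lt_irrefl _)
     map_d := fun {x} => absurd x.2 (lt_irrefl _)
     map_one := fun x => absurd x.2 (lt_irrefl _)
     map_comp := fun {x} => absurd x.2 (lt_irrefl _) }⟩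

theorem exists_object_cells {j : J} (hj : ⊥ < j) :
    ∃ g : A.Obj → DGFunctor (DGCat.unit k) (H.stage L j).toDGCat,
      ∀ x, (g x).obj PUnit.unit = ⟨x, hj⟩ := by
  choose g hg using fun x : (H.stage L j).toDGCat.Obj => exists_unit_functor x
  exact ⟨fun x => g ⟨x, hj⟩, fun x => hg _⟩

/-- The cells of the objects. -/
noncomputable def objectCell {j : J} (hj : ⊥ < j) (x : A.Obj) :
    DGCat.unit k ⟶ (H.stage L j).toDGCat :=
  (H.exists_object_cells L hj).choose x

theorem objectCell_obj {j : J} (hj : ⊥ < j) (x : A.Obj) :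
    DGFunctor.obj (A := DGCat.unit k) (H.objectCell L hj x) PUnit.unit = ⟨x, hj⟩ :=
  (H.exists_object_cells L hj).choose_spec x

theorem exists_objects_desc {j : J} (hj : ⊥ < j) (hγ : ∀ γ, ¬ lvl γ < j)
    (G : A.Obj → DGFunctor (DGCat.unit k) Z) :
    ∃ ψ : DGFunctor (H.stage L j).toDGCat Z, ∀ x,
      DGFunctor.comp (A := DGCat.unit k) (H.objectCell L hj x) ψ = G x := by
  obtain ⟨ψ, hψ, -⟩ := H.exists_stage_functor L j (fun x => (G x).obj PUnit.unit) (fun _ => 0)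
    (fun γ h => absurd h (hγ γ)) (fun γ h => absurd h (hγ γ)) (fun γ h => absurd h (hγ γ))
    (fun γ h => absurd h (hγ γ))
  exact ⟨ψ, fun x => unit_functor_ext ((congrArg ψ.obj (H.objectCell_obj L hj x)).trans (hψ _))⟩

theorem objects_hom_ext {j : J} (hj : ⊥ < j) (hγ : ∀ γ, ¬ lvl γ < j)
    {F F' : DGFunctor (H.stage L j).toDGCat Z}
    (h : ∀ x, DGFunctor.comp (A := DGCat.unit k) (H.objectCell L hj x) F =
      DGFunctor.comp (A := DGCat.unit k) (H.objectCell L hj x) F') : F = F' := by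
  refine H.stage_functor_ext L (fun x => ?_) fun γ h => absurd h (hγ γ)
  have := congrFun (congrArg DGFunctor.obj (h x.1)) PUnit.unit
  refine Eq.trans (congrArg F.obj ?_) (this.trans (congrArg F'.obj ?_))
  · exact (H.objectCell_obj L hj x.1).symm
  · exact H.objectCell_obj L hj x.1

end DGCat.IsSemifree

end Presentation

/-! ### A semifree dg category is an I-cell complex -/

section Complex

variable {k : Type u} [Field k] {A : DGCat.{u} k}

open DGCat HomotopicalAlgebra Limits

namespace DGCat.IsSemifree

variable {Γ J : Type u} [LinearOrder Γ] [LinearOrder J] [OrderBot J] [OrderTop J]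
  {gen : Γ → A.Mor} (H : IsSemifree gen) {lvl : Γ → J} (L : IsExhaustion lvl)

/-- The inclusions of the stages. -/
def stageIncl : H.stages L ⟶ (Functor.const J).obj A where
  app j := (H.stage L j).incl
  naturality _ _ _ := rfl

/-- Every level lies below `⊤`, so the stage at `⊤` is all of `A`, and a diagram indexed by a set
with a greatest element has its value there as colimit. -/
theorem exists_isColimit_stageIncl : Nonempty (IsColimit (Cocone.mk A (H.stageIncl L))) := by
  have hG : ∀ {x y : A.Obj} {n : ℤ} (f : A.Hom x y n),
      Closure {m | ∃ γ, lvl γ < ⊤ ∧ gen γ = m} f := fun f =>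
    (H.closure f).mono (by rintro _ ⟨γ, rfl⟩; exact ⟨γ, L.lt_top γ, rfl⟩)
  let r : A ⟶ (H.stages L).obj ⊤ := (H.stage L ⊤).lift (𝟙 A) (fun _ => L.bot_lt_top) hG
  have hr : r ≫ (H.stageIncl L).app ⊤ = 𝟙 A := rfl
  have hr' : (H.stageIncl L).app ⊤ ≫ r = 𝟙 _ := rfl
  refine ⟨{ desc := fun s => r ≫ s.ι.app ⊤, fac := fun s j => ?_, uniq := fun s m hm => ?_ }⟩
  · have h1 := s.w (homOfLE (le_top : j ≤ ⊤))
    rw [← h1]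
    have h2 : (H.stageIncl L).app j = (H.stages L).map (homOfLE (le_top : j ≤ ⊤)) ≫
      (H.stageIncl L).app ⊤ := rfl
    change (H.stageIncl L).app j ≫ r ≫ s.ι.app ⊤ = _
    rw [h2, Category.assoc, ← Category.assoc _ r, hr', Category.id_comp]
  · rw [← hm ⊤]
    change m = r ≫ (H.stageIncl L).app ⊤ ≫ m
    rw [← Category.assoc, hr, Category.id_comp]

/-- The attachment of the cells of all objects. -/
noncomputable def attachObjects {j : J} (hj : ⊥ < j) (hγ : ∀ γ, ¬ lvl γ < j) :
    AttachCells.{u} (generatingCofibration.{u} k) ((H.stages L).map (homOfLE hj.le)) where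
  ι := A.Obj
  π _ := .obj
  cofan₁ := Cofan.mk (P := (H.stages L).obj ⊥) (f := fun _ : A.Obj => DGCat.empty k)
    fun _ => emptyTo _
  cofan₂ := Cofan.mk (P := (H.stages L).obj j) (f := fun _ : A.Obj => DGCat.unit k)
    (H.objectCell L hj)
  isColimit₁ := Cofan.IsColimit.mk _ (fun s => (H.exists_bot_functor L s.pt).some)
    (fun _ _ => empty_functor_ext _ _) (fun _ _ _ => H.bot_functor_ext L)
  isColimit₂ := Cofan.IsColimit.mk _ (fun s => (H.exists_objects_desc L hj hγ s.inj).choose)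
    (fun s => (H.exists_objects_desc L hj hγ s.inj).choose_spec)
    (fun s _ hm => H.objects_hom_ext L hj hγ fun x =>
      (hm x).trans ((H.exists_objects_desc L hj hγ s.inj).choose_spec x).symm)
  m := (H.stages L).map (homOfLE hj.le)
  hm _ := empty_functor_ext _ _
  g₁ := 𝟙 _
  g₂ := 𝟙 _
  isPushout := IsPushout.of_id_fst

/-- The attachment of the cell of a generator. -/
noncomputable def attachGenerator (γ : Γ) {j : J} (h : lvl γ < j)
    (hj : ∀ γ', lvl γ' < j → γ' ≤ γ) :
    AttachCells.{u} (generatingCofibration.{u} k) ((H.stages L).map (homOfLE h.le)) where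
  ι := PUnit
  π _ := .mor (-(gen γ).deg)
  cofan₁ := Cofan.mk (P := DGCat.sphere.{u} k (-(gen γ).deg)) (f := fun _ : PUnit => _)
    fun _ => 𝟙 (DGCat.sphere.{u} k (-(gen γ).deg))
  cofan₂ := Cofan.mk (P := DGCat.disk.{u} k (-(gen γ).deg)) (f := fun _ : PUnit => _)
    fun _ => 𝟙 (DGCat.disk.{u} k (-(gen γ).deg))
  isColimit₁ := Cofan.IsColimit.mk _ (fun s => s.inj PUnit.unit) (fun _ _ => rfl)
    (fun _ _ hm => hm PUnit.unit)
  isColimit₂ := Cofan.IsColimit.mk _ (fun s => s.inj PUnit.unit) (fun _ _ => rfl)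
    (fun _ _ hm => hm PUnit.unit)
  m := sphereToDisk k _
  hm _ := rfl
  g₁ := H.attachMap L γ
  g₂ := H.cellMap L γ h
  isPushout := H.isPushout L γ h hj

/-- The step at `⊥` attaches object cells only, and the step at `lvl γ` attaches one cell with
generator `gen γ`. The three clauses yield the bijection between cells with generator and `Γ`. -/
theorem exists_attachCells [SuccOrder J] (j : J) (hj : ¬ IsMax j) :
    ∃ a : AttachCells.{u} (generatingCofibration.{u} k)
        ((H.stages L).map (homOfLE (Order.le_succ j))),
      (∀ γ, lvl γ = j → ∃ i,
        gen γ ∈ CellKind.generator (a.π i) (a.cell i ≫ (H.stageIncl L).app _)) ∧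
      (∀ i, ∀ m ∈ CellKind.generator (a.π i) (a.cell i ≫ (H.stageIncl L).app _),
        ∃ γ, lvl γ = j ∧ gen γ = m) ∧
      (∀ i i', (CellKind.generator (a.π i) (a.cell i ≫ (H.stageIncl L).app _)).isSome →
        (CellKind.generator (a.π i') (a.cell i' ≫ (H.stageIncl L).app _)).isSome → i = i') := by
  have hlt : j < Order.succ j := Order.lt_succ_of_not_isMax hj
  rcases L.eq_bot_or j (not_isMax_iff_lt_top.1 hj) with rfl | ⟨γ, rfl⟩
  · refine ⟨H.attachObjects L hlt fun γ h => ?_, fun γ h => ?_, ?_, ?_⟩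
    · exact (L.bot_lt γ).not_ge ((Order.lt_succ_iff_of_not_isMax hj).1 h)
    · exact absurd h (L.bot_lt γ).ne'
    · rintro i m ⟨⟩
    · rintro i i' ⟨⟩
  · have hle : ∀ γ', lvl γ' < Order.succ (lvl γ) → γ' ≤ γ := fun γ' h =>
      L.strictMono.le_iff_le.1 ((Order.lt_succ_iff_of_not_isMax hj).1 h)
    have key : (H.stage L (Order.succ (lvl γ))).incl.mapMor
        (DGFunctor.mapMor (A := DGCat.disk.{u} k _) (H.cellMap L γ hlt) (diskTopMor k _)) =
        gen γ := by
      rw [mapMor_cellMap]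
      rfl
    refine ⟨H.attachGenerator L γ hlt hle, fun γ' h => ⟨PUnit.unit, ?_⟩, fun i m hm => ⟨γ, rfl, ?_⟩,
      fun _ _ _ _ => rfl⟩
    · obtain rfl := L.strictMono.injective h
      exact congrArg some key
    · exact key.symm.trans (Option.some.inj hm)

theorem exists_iCellComplex_of_isExhaustion [SuccOrder J] [WellFoundedLT J] (H : IsSemifree gen)
    (L : IsExhaustion lvl) :
    ∃ (e : ICellComplex A) (φ : e.Gen ≃ Γ), ∀ γ, e.gen γ = gen (φ γ) := by
  choose a ha₁ ha₂ ha₃ using H.exists_attachCells L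
  let e : ICellComplex A :=
    { J := J
      complex :=
        { F := H.stages L
          isoBot :=
            { hom := (H.exists_bot_functor L _).some
              inv := emptyTo _
              hom_inv_id := H.bot_functor_ext L
              inv_hom_id := empty_functor_ext _ _ }
          isWellOrderContinuous := H.isWellOrderContinuous L
          incl := H.stageIncl L
          isColimit := (H.exists_isColimit_stageIncl L).some
          fac := empty_functor_ext _ _
          attachCells := a } }
  have hp : ∀ g : e.Gen, ∃ γ, lvl γ = g.1.j ∧ gen γ = e.gen g := fun g =>
    ha₂ g.1.j g.1.hj g.1.k _ (Option.get_mem g.2)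
  choose p hp hp' using hp
  refine ⟨e, Equiv.ofBijective p ⟨?_, fun γ => ?_⟩, fun γ => (hp' γ).symm⟩
  · rintro ⟨⟨j, hj, i⟩, h⟩ ⟨⟨j', hj', i'⟩, h'⟩ hh
    obtain rfl : j = j' := (hp _).symm.trans ((congrArg lvl hh).trans (hp _))
    obtain rfl : i = i' := ha₃ j hj i i' h h'
    rfl
  · obtain ⟨i, hi⟩ := ha₁ (lvl γ) (not_isMax_iff_lt_top.2 (L.lt_top γ)) γ rfl
    let g : e.Gen := ⟨⟨lvl γ, not_isMax_iff_lt_top.2 (L.lt_top γ), i⟩,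
      Option.isSome_iff_exists.2 ⟨_, hi⟩⟩
    exact ⟨g, L.strictMono.injective (hp g)⟩

/-- A dg category which is semifree on a family of morphisms is an `I`-cell complex with these
free generators. -/
theorem exists_iCellComplex [WellFoundedLT Γ] (H : IsSemifree gen) :
    ∃ (e : ICellComplex A) (φ : e.Gen ≃ Γ), ∀ γ, e.gen γ = gen (φ γ) := by
  -- The added bottom element is the step which attaches the objects, and the added top is the final
  -- stage.
  let _ : SuccOrder (WithBot (WithTop Γ)) := SuccOrder.ofLinearWellFoundedLT _
  refine H.exists_iCellComplex_of_isExhaustion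
    (lvl := fun γ => ((γ : WithTop Γ) : WithBot (WithTop Γ))) ?_
  refine ⟨fun γ γ' h => ?_, fun γ => WithBot.bot_lt_coe _, fun γ => ?_, WithBot.bot_lt_coe _, ?_⟩
  · exact WithBot.coe_lt_coe.2 (WithTop.coe_lt_coe.2 h)
  · exact WithBot.coe_lt_coe.2 (WithTop.coe_lt_top γ)
  · intro j hj
    induction j with
    | bot => exact Or.inl rfl
    | coe j =>
      induction j with
      | top => exact absurd hj (lt_irrefl _)
      | coe γ => exact Or.inr ⟨γ, rfl⟩

end DGCat.IsSemifree

end Complex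

/-! ### Thickening by k[ε]: graded functors as dg functors -/

section Thickening

variable {k : Type u} [Field k] {A B C Z : DGCat.{u} k}

open DGCat

/-- The identity map of a graded piece, between the same degree written in two ways. -/
def DGCat.castHom {x y : Z.Obj} {n m : ℤ} (h : n = m) : Z.Hom x y n →ₗ[k] Z.Hom x y m :=
  h ▸ LinearMap.id

/-- The tensor product of the underlying graded category of a dg category with the dg algebra
`k[ε]`, where `ε` has degree `-1` and `dε = 1`. -/
noncomputable def DGCat.thickening (Z : DGCat.{u} k) : DGCat.{u} k where
  Obj := Z.Obj
  Hom x y n := Z.Hom x y n × Z.Hom x y (n + 1)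
  d {x y} n m h := LinearMap.inl k _ _ ∘ₗ castHom (Z := Z) h ∘ₗ LinearMap.snd k _ _
  one x := (Z.one x, 0)
  comp {x y z j i n} h := LinearMap.mk₂ k
    (fun (g : Z.Hom y z j × Z.Hom y z (j + 1)) (f : Z.Hom x y i × Z.Hom x y (i + 1)) =>
      ((Z.comp h g.1 f.1, Z.comp (by omega) g.2 f.1 + sg k j • Z.comp (by omega) g.1 f.2) :
        Z.Hom x z n × Z.Hom x z (n + 1)))
    (fun _ _ _ => Prod.ext (by simp) (by simp; abel))
    (fun _ _ _ => Prod.ext (by simp) (by simp [smul_add, smul_comm (sg k j)]))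
    (fun _ _ _ => Prod.ext (by simp) (by simp; abel))
    (fun _ _ _ => Prod.ext (by simp) (by simp [smul_add, smul_comm (sg k j)]))
  d_d n m l h h' f := by
    subst h; subst h'
    exact Prod.ext rfl rfl
  one_comp {x y n} h f := Prod.ext (Z.one_comp _ _) (by
    change Z.comp _ 0 f.1 + sg k 0 • Z.comp _ (Z.one y) f.2 = f.2
    rw [map_zero, LinearMap.zero_apply, Z.one_comp]
    simp [sg])
  comp_one {x y n} h f := Prod.ext (Z.comp_one _ _) (by
    change Z.comp _ f.2 (Z.one x) + sg k n • Z.comp _ f.1 0 = f.2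
    rw [map_zero, Z.comp_one, smul_zero, add_zero])
  assoc {x y z w p q r pq qr n} h₁ h₂ h₃ h₄ a b c := Prod.ext (Z.assoc _ _ _ _ _ _ _) (by
    subst h₁ h₂ h₃
    change Z.comp _ (Z.comp _ a.2 b.1 + sg k p • Z.comp _ a.1 b.2) c.1 +
      sg k (p + q) • Z.comp _ (Z.comp _ a.1 b.1) c.2 =
      Z.comp _ a.2 (Z.comp _ b.1 c.1) +
        sg k p • Z.comp _ a.1 (Z.comp _ b.2 c.1 + sg k q • Z.comp _ b.1 c.2)
    simp only [map_add, LinearMap.add_apply, map_smul, LinearMap.smul_apply, smul_add, smul_smul,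
      sg_add]
    rw [Z.assoc (p := p + 1) (q := q) (r := r) (qr := q + r) _ _ rfl (by omega),
      Z.assoc (p := p) (q := q + 1) (r := r) (qr := q + r + 1) _ _ (by omega) (by omega),
      Z.assoc (p := p) (q := q) (r := r + 1) (qr := q + r + 1) _ _ (by omega) (by omega)]
    exact add_assoc _ _ _)
  leibniz {x y z j i n j' i' n'} h hn hj hi h₁ h₂ g f := by
    subst h hn hj hi
    rw [negOnePow_smul_eq_sg (k := k)]
    refine Prod.ext ?_ ?_
    · change Z.comp _ g.2 f.1 + sg k j • Z.comp _ g.1 f.2 = Z.comp _ g.2 f.1 + sg k j • Z.comp _ g.1 f.2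
      rfl
    · change (0 : Z.Hom x z (j + i + 1 + 1)) = Z.comp _ 0 f.1 + sg k (j + 1) • Z.comp _ g.2 f.2 +
        sg k j • (Z.comp _ g.2 f.2 + sg k j • Z.comp _ g.1 0)
      simp [sg_add, sg_one]

namespace DGCat.thickening

/-- An object of the thickening, as an object of the original dg category. -/
def base (x : Z.thickening.Obj) : Z.Obj := x

/-- The projection to the underlying graded category. -/
def fst : GradedFunctor Z.thickening Z base where
  map {x y n} := LinearMap.fst k (Z.Hom (base x) (base y) n) (Z.Hom (base x) (base y) (n + 1))
  map_one _ := rfl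
  map_comp _ _ _ := rfl

/-- As d(u, v) = (v, 0), a primitive of a closed (z, 0) has second component `z`, and its first
component is free. -/
theorem existsUnique_d_eq {n : ℤ} {x y : Z.thickening.Obj} (w : Z.Hom (base x) (base y) n)
    (z : Z.thickening.Hom x y (n + 1)) (hz : Z.thickening.d _ _ rfl z = 0) :
    ∃! f : Z.thickening.Hom x y n, f.1 = w ∧ Z.thickening.d _ _ rfl f = z := by
  have h : z.2 = (0 : Z.Hom (base x) (base y) (n + 1 + 1)) := congrArg Prod.fst hz
  refine ⟨(w, z.1), ⟨rfl, Prod.ext rfl h.symm⟩, ?_⟩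
  rintro f ⟨rfl, rfl⟩
  rfl

/-- The homotopy `(u, v) ↦ (0, u)`. -/
def homotopy (x y : Z.thickening.Obj) : Z.thickening.Tot x y →ₗ[k] Z.thickening.Tot x y where
  toFun t n := ((0, (t (n + 1)).1) : Z.Hom (base x) (base y) n × Z.Hom (base x) (base y) (n + 1))
  map_add' _ _ := funext fun _ => Prod.ext (add_zero _).symm rfl
  map_smul' _ _ := funext fun _ => Prod.ext (smul_zero _).symm rfl

variable {x y z : Z.thickening.Obj}

/-- The kernel of the homotopy consists of the multiples of `ε`, which are stable under composition
on both sides. -/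
theorem homotopy_eq_zero {t : Z.thickening.Tot x y} :
    homotopy x y t = 0 ↔ ∀ n, fst.map (t n) = 0 := by
  refine ⟨fun h n => ?_, fun h => funext fun n => Prod.ext rfl (h _)⟩
  obtain ⟨n, rfl⟩ : ∃ l, n = l + 1 := ⟨n - 1, by omega⟩
  exact congrArg Prod.snd (congrFun h n)

theorem homotopy_homotopy (t : Z.thickening.Tot x y) : homotopy x y (homotopy x y t) = 0 := rfl

theorem homotopy_td {t : Z.thickening.Tot x y} (h : homotopy x y t = 0) :
    homotopy x y (td t) = t := by
  funext n
  have e : td t (n + 1) = Z.thickening.d n (n + 1) rfl (t n) := td_apply rfl t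
  exact Prod.ext (homotopy_eq_zero.1 h n).symm (congrArg Prod.fst e)

theorem homotopy_tcomp_left (p : ℤ) (a : Z.thickening.Tot y z) {t : Z.thickening.Tot x y}
    (h : homotopy x y t = 0) : homotopy x z (tcomp p a t) = 0 := by
  rw [homotopy_eq_zero] at h ⊢
  intro n
  change Z.comp (x := base x) (y := base y) (z := base z) _ (fst.map (a p)) (fst.map (t (n - p))) = 0
  rw [h, map_zero]

theorem homotopy_tcomp_right (p : ℤ) (a : Z.thickening.Tot x y) {t : Z.thickening.Tot y z}
    (h : homotopy y z t = 0) : homotopy x z (tcomp p t a) = 0 := by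
  rw [homotopy_eq_zero] at h ⊢
  intro n
  change Z.comp (x := base x) (y := base y) (z := base z) _ (fst.map (t p)) (fst.map (a (n - p))) = 0
  rw [h, map_zero, LinearMap.zero_apply]

theorem homotopy_homog (t : Z.thickening.Tot x y) (p : ℤ) (h : ∀ n, n ≠ p → t n = 0) (n : ℤ)
    (hn : n + 1 ≠ p) : homotopy x y t n = 0 :=
  Prod.ext rfl (congrArg Prod.fst (h (n + 1) hn))

end DGCat.thickening

namespace Fnl

variable {D E : DGCat.{u} k} {F G : DGFunctor D E} {H : ∀ x y : E.Obj, E.Tot x y →ₗ[k] E.Tot x y}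

/-- If `H` kills all values of `θ`, it kills every term of `diff` except the differentials of the
values, and there it recovers them. -/
theorem homotopy_diff (h₁ : ∀ {x y} {t : E.Tot x y}, H x y t = 0 → H x y (td t) = t)
    (h₂ : ∀ {x y z} (p : ℤ) (a : E.Tot y z) {t : E.Tot x y}, H x y t = 0 → H x z (tcomp p a t) = 0)
    {e : E.Obj} {x z : D.Obj} {θ : Fnl D E G.obj e x}
    (hθ : ∀ {z} (s : Chain D x z), H e _ (θ z s) = 0) (s : Chain D x z) :
    sg k s.deg • H e _ (diff G θ z s) = θ z s := by
  induction s with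
  | nil y => rw [diff_nil, h₁ (hθ _)]; simp [sg]
  | cons g s ih =>
    have h3 : H e _ (act G g θ _ s) = 0 := by
      cases s with
      | nil => exact h₂ _ _ (hθ _)
      | cons l s => exact hθ _
    rw [diff_cons _ rfl, map_smul, map_add, map_add, hθ, h3, add_zero, add_zero, smul_smul]
    rw [← sh_apply g θ, ← ih (θ := sh g θ) fun s => hθ _, Chain.deg_cons]
    congr 1
    rw [mul_comm, sg_add, ← mul_assoc, sg_mul_self, one_mul]

theorem homotopy_cdiff (h₁ : ∀ {x y} {t : E.Tot x y}, H x y t = 0 → H x y (td t) = t)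
    (h₂ : ∀ {x y z} (p : ℤ) (a : E.Tot y z) {t : E.Tot x y}, H x y t = 0 → H x z (tcomp p a t) = 0)
    (h₃ : ∀ {x y z} (p : ℤ) (a : E.Tot x y) {t : E.Tot y z}, H y z t = 0 → H x z (tcomp p t a) = 0)
    {p : ℤ} {η : ∀ y, Fnl D E G.obj (F.obj y) y}
    (hη : ∀ {x z} (s : Chain D x z), H _ _ (η x z s) = 0) :
    (fun x => homotopy H (cdiff (F := F) (G := G) p η x)) = η := by
  funext x z s
  have h4 : H _ _ (front (F := F) (G := G) p η x z s) = 0 := by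
    cases s with
    | nil => exact map_zero _
    | cons g s => rw [front_cons, map_smul, h₃ _ _ (hη s), smul_zero]
  rw [homotopy, cdiff, Pi.add_apply, Pi.add_apply, map_add, h4, add_zero]
  exact homotopy_diff h₁ h₂ (fun s => hη s) s

end Fnl

theorem coherent.d_sub_d {D E : DGCat.{u} k} {F G : DGFunctor D E} {p : ℤ} (ζ : coherentHom F G (p + 1))
    (hζ : Fnl.cdiff (F := F) (p + 1) ζ.1 = 0) (e : coherentHom F G p) :
    Fnl.cdiff (F := F) (p + 1) (ζ.1 - Fnl.cdiff (F := F) p e.1) = 0 := by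
  have h1 := Fnl.cdiff_lin (F := F) (p := p + 1) (-1 : k) (Fnl.cdiff (F := F) p e.1) ζ.1
  have h2 : Fnl.cdiff (F := F) (p + 1) (Fnl.cdiff (F := F) p e.1) = 0 :=
    funext (Fnl.cdiff_cdiff rfl fun y => (e.2 y).toIsMulti)
  rw [h2, hζ, smul_zero, add_zero] at h1
  rwa [neg_one_smul, neg_add_eq_sub] at h1

/-- A graded functor which is compatible with differentials. -/
def GradedFunctor.toDGFunctor {o : A.Obj → B.Obj} (Ψ : GradedFunctor A B o)
    (h : ∀ {x y : A.Obj} (n m : ℤ) (h : n + 1 = m) (f : A.Hom x y n),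
      Ψ.map (A.d n m h f) = B.d n m h (Ψ.map f)) : DGFunctor A B where
  obj := o
  map := Ψ.map
  map_d := h
  map_one := Ψ.map_one
  map_comp := Ψ.map_comp

/-- A dg functor out of an `I`-cell complex exists for given values on objects, if for given closed
morphisms there are unique morphisms which bound them and satisfy given conditions. -/
theorem ICellComplex.exists_dgFunctor (c : ICellComplex C) (o : C.Obj → Z.Obj)
    (U : ∀ γ : c.Gen, Z.Hom (o (c.gen γ).src) (o (c.gen γ).tgt) (c.gen γ).deg → Prop)
    (hU : ∀ (γ : c.Gen) (z : Z.Hom (o (c.gen γ).src) (o (c.gen γ).tgt) ((c.gen γ).deg + 1)),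
      Z.d _ _ rfl z = 0 → ∃! w, U γ w ∧ Z.d _ _ rfl w = z) :
    ∃ Ψ : GradedFunctor C Z o, (∀ {x y : C.Obj} (n m : ℤ) (h : n + 1 = m) (f : C.Hom x y n),
      Ψ.map (C.d n m h f) = Z.d n m h (Ψ.map f)) ∧ ∀ γ, U γ (Ψ.map (c.gen γ).hom) := by
  obtain ⟨Φ, hΦ, hU'⟩ := c.exists_functor o (fun γ m => ∃ w, U γ w ∧ m = ⟨_, _, _, w⟩) fun γ z hz => by
    obtain ⟨w, ⟨h1, h2⟩, h3⟩ := hU γ z hz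
    refine ⟨w, ⟨⟨w, h1, rfl⟩, h2⟩, ?_⟩
    rintro w' ⟨⟨w'', h4, h5⟩, h6⟩
    obtain rfl := Mor.mk_inj.1 h5
    exact h3 _ ⟨h4, h6⟩
  rcases Φ with ⟨o', φ, h1, h2, h3⟩
  obtain rfl : o' = o := funext hΦ
  refine ⟨⟨φ, h2, h3⟩, h1, fun γ => ?_⟩
  obtain ⟨w, hw, hw'⟩ := hU' γ
  obtain rfl := Mor.mk_inj.1 hw'
  exact hw

/-- In a thickening the first components on generators are free parameters, so after projection an
I-cell complex is free as a graded category. -/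
theorem ICellComplex.exists_graded (c : ICellComplex C) (o : C.Obj → Z.Obj)
    (m : ∀ γ : c.Gen, Z.Hom (o (c.gen γ).src) (o (c.gen γ).tgt) (c.gen γ).deg) :
    ∃ Ψ : GradedFunctor C Z.thickening o,
      (∀ {x y : C.Obj} (n m : ℤ) (h : n + 1 = m) (f : C.Hom x y n),
        Ψ.map (C.d n m h f) = Z.thickening.d n m h (Ψ.map f)) ∧
      ∀ γ, (Ψ.map (c.gen γ).hom).1 = m γ :=
  c.exists_dgFunctor (Z := Z.thickening) o (fun γ w => w.1 = m γ) fun γ z hz =>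
    thickening.existsUnique_d_eq (m γ) z hz

end Thickening

/-! ### Words span the morphisms of an I-cell complex -/

section Words

variable {k : Type u} [Field k] {D E : DGCat.{u} k}

open DGCat

theorem DGCat.Mor.comp_congr {x y z : D.Obj} {j j' i i' n n' : ℤ} (h : j + i = n) (h' : j' + i' = n')
    {g : D.Hom y z j} {g' : D.Hom y z j'} {f : D.Hom x y i} {f' : D.Hom x y i'}
    (e : (⟨y, z, j, g⟩ : D.Mor) = ⟨y, z, j', g'⟩) (e' : (⟨x, y, i, f⟩ : D.Mor) = ⟨x, y, i', f'⟩) :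
    (⟨x, z, n, D.comp h g f⟩ : D.Mor) = ⟨x, z, n', D.comp h' g' f'⟩ := by
  cases e
  cases e'
  subst h h'
  rfl

namespace ICellComplex

variable (c : ICellComplex D)

/-- Composable sequences of words, possibly empty. -/
inductive WordList : D.Obj → D.Obj → Type u
  | nil (y : D.Obj) : WordList y y
  | cons {x y z : D.Obj} (w : c.Word x y) (l : WordList y z) : WordList x z

variable {c}

namespace Word

/-- Concatenation of words. -/
noncomputable def append : {x y z : D.Obj} → c.Word x y → c.Word y z → c.Word x z
  | _, _, _, .single γ, w' => .cons γ w'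
  | _, _, _, .cons γ w, w' => .cons γ (w.append w')

/-- The stages of the letters of a word. -/
noncomputable def letters : {x y : D.Obj} → c.Word x y → Multiset c.J
  | _, _, .single γ => {γ.1.j}
  | _, _, .cons γ w => w.letters + {γ.1.j}

theorem letters_append {x y z : D.Obj} (w : c.Word x y) (w' : c.Word y z) :
    (w.append w').letters = w'.letters + w.letters := by
  induction w with
  | single γ => rfl
  | cons γ w ih => rw [append, letters, letters, ih, add_assoc]

theorem letters_ne_zero {x y : D.Obj} (w : c.Word x y) : w.letters ≠ 0 := by
  cases w <;> simp [letters]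

theorem val_append {x y z : D.Obj} (w : c.Word x y) (w' : c.Word y z) {n : ℤ}
    (h : w'.deg + w.deg = n) :
    (⟨x, z, n, D.comp h w'.val w.val⟩ : D.Mor) = ⟨x, z, _, (w.append w').val⟩ := by
  subst h
  induction w with
  | single γ => rfl
  | cons γ w ih =>
    refine Eq.trans (congrArg (Mor.mk _ _ _) ?_) (Mor.comp_congr (n := w'.deg + (cons γ w).deg)
      (add_assoc _ _ _) rfl (ih w') rfl)
    exact (D.assoc rfl (add_assoc _ _ _) rfl rfl _ _ _).symm

end Word

/-- The linear combinations of words whose letters satisfy a condition, and of identities if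
the empty word satisfies it. -/
inductive WordSpan (P : Multiset c.J → Prop) : ∀ {x y : D.Obj} {n : ℤ}, D.Hom x y n → Prop
  | word {x y : D.Obj} (w : c.Word x y) (h : P w.letters) : WordSpan P w.val
  | one {x : D.Obj} (h : P 0) : WordSpan P (D.one x)
  | zero (x y : D.Obj) (n : ℤ) : WordSpan P (0 : D.Hom x y n)
  | add {x y : D.Obj} {n : ℤ} {f g : D.Hom x y n} (hf : WordSpan P f) (hg : WordSpan P g) :
      WordSpan P (f + g)
  | smul {x y : D.Obj} {n : ℤ} (r : k) {f : D.Hom x y n} (hf : WordSpan P f) : WordSpan P (r • f)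

namespace WordSpan

variable {P Q R : Multiset c.J → Prop}

theorem mono (h : ∀ M, P M → Q M) {x y : D.Obj} {n : ℤ} {f : D.Hom x y n} (hf : WordSpan P f) :
    WordSpan Q f := by
  induction hf with
  | word w hw => exact .word w (h _ hw)
  | one h0 => exact .one (h _ h0)
  | zero => exact .zero _ _ _
  | add _ _ ih ih' => exact .add ih ih'
  | smul r _ ih => exact .smul r ih

theorem of_mor_eq {x y : D.Obj} {n : ℤ} {f : D.Hom x y n} {m : D.Mor} (e : m = ⟨x, y, n, f⟩)
    (h : WordSpan P m.hom) : WordSpan P f := by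
  subst e
  exact h

theorem word_comp (hR : ∀ M N, P M → Q N → R (M + N)) {x y z : D.Obj} {i n : ℤ} {w' : c.Word y z}
    (hw' : P w'.letters) (h : w'.deg + i = n) {f : D.Hom x y i} (hf : WordSpan Q f) :
    WordSpan R (D.comp h w'.val f) := by
  induction hf generalizing n with
  | word w hw =>
    refine of_mor_eq (w.val_append w' h).symm (.word _ ?_)
    rw [Word.letters_append]
    exact hR _ _ hw' hw
  | one h0 =>
    obtain rfl : w'.deg = n := by omega
    rw [D.comp_one]
    exact .word w' (by simpa using hR _ _ hw' h0)
  | zero => rw [map_zero]; exact .zero _ _ _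
  | add _ _ ih ih' => rw [map_add]; exact .add (ih hw' _) (ih' hw' _)
  | smul r _ ih => rw [map_smul]; exact .smul r (ih hw' _)

theorem comp (hR : ∀ M N, P M → Q N → R (M + N)) {x y z : D.Obj} {j i n : ℤ} (h : j + i = n)
    {g : D.Hom y z j} {f : D.Hom x y i} (hg : WordSpan P g) (hf : WordSpan Q f) :
    WordSpan R (D.comp h g f) := by
  induction hg generalizing x i n with
  | word w' hw' => exact word_comp hR hw' h hf
  | one h0 =>
    obtain rfl : i = n := by omega
    rw [D.one_comp]
    exact hf.mono fun M hM => by simpa using hR _ _ h0 hM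
  | zero => rw [map_zero, LinearMap.zero_apply]; exact .zero _ _ _
  | add _ _ ih ih' => rw [map_add, LinearMap.add_apply]; exact .add (ih _ hf) (ih' _ hf)
  | smul r _ ih => rw [map_smul, LinearMap.smul_apply]; exact .smul r (ih _ hf)

theorem of_closure (h0 : P 0) (hadd : ∀ M N, P M → P N → P (M + N)) {G : Set D.Mor}
    (hG : ∀ m ∈ G, ∃ γ : c.Gen, c.gen γ = m ∧ P {γ.1.j}) {x y : D.Obj} {n : ℤ} {f : D.Hom x y n}
    (hf : Closure G f) : WordSpan P f := by
  induction hf with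
  | gen f hf =>
    obtain ⟨γ, h, hP⟩ := hG _ hf
    exact of_mor_eq h (.word (.single γ) hP)
  | one x => exact .one h0
  | comp h _ _ ih ih' => exact ih.comp hadd h ih'
  | zero => exact .zero _ _ _
  | add _ _ ih ih' => exact .add ih ih'
  | smul r _ ih => exact .smul r ih

theorem of_hom (c : ICellComplex D) {x y : D.Obj} {n : ℤ} (f : D.Hom x y n) :
    WordSpan (c := c) (fun _ => True) f :=
  of_closure trivial (fun _ _ _ _ => trivial) (by rintro _ ⟨γ, rfl⟩; exact ⟨γ, rfl, trivial⟩)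
    (c.closure_gen f)

end WordSpan

namespace WordList

/-- The chain of monomials given by a sequence of words. -/
noncomputable def toChain : {x y : D.Obj} → c.WordList x y → Chain D x y
  | _, _, .nil y => .nil y
  | _, _, .cons w l => .cons w.val l.toChain

/-- Concatenation. -/
def append : {x y z : D.Obj} → c.WordList x y → c.WordList y z → c.WordList x z
  | _, _, _, .nil _, l => l
  | _, _, _, .cons w l, l' => .cons w (l.append l')

theorem toChain_append {x y z : D.Obj} (l : c.WordList x y) (l' : c.WordList y z) :
    (l.append l').toChain = l.toChain.append l'.toChain := by
  induction l with
  | nil => rfl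
  | cons w l ih => simp only [append, toChain, Chain.append, ih]

/-- Chains are linear combinations of chains of monomials. -/
theorem chain_induction {y : D.Obj} {Q : ∀ {z : D.Obj}, Chain D y z → Prop}
    (add : ∀ {w x z : D.Obj} {m : ℤ} (a : Chain D y w) (g g' : D.Hom w x m) (b : Chain D x z),
      Q (a.append (.cons g b)) → Q (a.append (.cons g' b)) → Q (a.append (.cons (g + g') b)))
    (smul : ∀ {w x z : D.Obj} {m : ℤ} (a : Chain D y w) (r : k) (g : D.Hom w x m) (b : Chain D x z),
      Q (a.append (.cons g b)) → Q (a.append (.cons (r • g) b)))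
    (zero : ∀ {w x z : D.Obj} {m : ℤ} (a : Chain D y w) (b : Chain D x z),
      Q (a.append (.cons (0 : D.Hom w x m) b)))
    (one : ∀ {w z : D.Obj} (a : Chain D y w) (b : Chain D w z), Q (a.append (.cons (D.one w) b)))
    (words : ∀ {z : D.Obj} (l : c.WordList y z), Q l.toChain) {z : D.Obj} (s : Chain D y z) : Q s := by
  -- The list `l` holds the members already replaced by words, and `b` those still to be treated.
  have key : ∀ {w z : D.Obj} (b : Chain D w z) (l : c.WordList y w), Q (l.toChain.append b) := by
    intro w z b
    induction b with
    | nil w => intro l; rw [Chain.append_nil]; exact words l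
    | cons g b ih =>
      intro l
      have hg := WordSpan.of_hom c g
      induction hg with
      | word v _ =>
        have := ih (l.append (.cons v (.nil _)))
        rwa [toChain_append, Chain.append_assoc] at this
      | one => exact one _ _
      | zero => exact zero _ _
      | add _ _ h h' => exact add _ _ _ _ (h b ih) (h' b ih)
      | smul r _ h => exact smul _ _ _ _ (h b ih)
  exact key s (.nil y)

end WordList

end ICellComplex

end Words

/-! ### Linear independence of words, and cochains with prescribed values -/

section Coordinates

variable {k : Type u} [Field k] {A B C D E Z : DGCat.{u} k}

open DGCat

/-- Composition of graded functors. -/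
def GradedFunctor.comp {o : A.Obj → B.Obj} {o' : B.Obj → C.Obj} (Ψ : GradedFunctor A B o)
    (Ψ' : GradedFunctor B C o') : GradedFunctor A C (fun x => o' (o x)) where
  map := Ψ'.map ∘ₗ Ψ.map
  map_one x := (congrArg Ψ'.map (Ψ.map_one x)).trans (Ψ'.map_one _)
  map_comp h g f := (congrArg Ψ'.map (Ψ.map_comp h g f)).trans (Ψ'.map_comp _ _ _)

/-- The dg category of contravariant linear maps between given vector spaces, in all degrees. -/
def DGCat.rep {O : Type u} (M : O → Type u) [∀ x, AddCommGroup (M x)] [∀ x, Module k (M x)] :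
    DGCat.{u} k where
  Obj := O
  Hom x y _ := M y →ₗ[k] M x
  d _ _ _ := 0
  one _ := LinearMap.id
  comp {x y z _ _ _} _ := LinearMap.mk₂ k (fun (g : M z →ₗ[k] M y) (f : M y →ₗ[k] M x) => f ∘ₗ g)
    (fun _ _ _ => LinearMap.comp_add _ _ _) (fun _ _ _ => LinearMap.comp_smul _ _ _)
    (fun _ _ _ => LinearMap.add_comp _ _ _) (fun _ _ _ => LinearMap.smul_comp _ _ _)
  d_d _ _ _ _ _ _ := rfl
  one_comp _ _ := rfl
  comp_one _ _ := rfl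
  assoc _ _ _ _ _ _ _ := rfl
  leibniz _ _ _ _ _ _ g f := by simp

namespace ICellComplex

variable (c : ICellComplex D)

/-- Words, including the empty one, with a given source. -/
abbrev WordFrom (x : D.Obj) : Type u := Option (Σ z, c.Word x z)

variable {c} in
/-- A letter followed by a word. -/
noncomputable def WordFrom.cons (γ : c.Gen) : c.WordFrom (c.gen γ).tgt → c.WordFrom (c.gen γ).src
  | none => some ⟨_, .single γ⟩
  | some w => some ⟨w.1, .cons γ w.2⟩

/-- The coordinates of morphisms with respect to the words. -/
theorem exists_coord : ∃ coord : ∀ x y n, D.Hom x y n →ₗ[k] (c.Word x y →₀ k),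
    (∀ x, coord x x 0 (D.one x) = 0) ∧
    ∀ x y (w : c.Word x y), coord x y w.deg w.val = Finsupp.single w 1 := by
  -- Let `D` act on the spaces spanned by the words with given source, each generator prepending
  -- itself. Applied to the empty word, a monomial returns its own word and an identity returns the
  -- empty word, which the coordinates omit.
  obtain ⟨Ψ', -, hΨ'⟩ := c.exists_graded (Z := rep (k := k) fun x => c.WordFrom x →₀ k) (fun x => x)
    (fun γ => Finsupp.lmapDomain k k (WordFrom.cons γ))
  let Ψ := Ψ'.comp thickening.fst
  let ψ : ∀ {x y : D.Obj} {n : ℤ}, D.Hom x y n →ₗ[k]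
    ((c.WordFrom y →₀ k) →ₗ[k] (c.WordFrom x →₀ k)) := Ψ.map
  have hinj : ∀ x y, Function.Injective (fun w : c.Word x y => (some ⟨y, w⟩ : c.WordFrom x)) :=
    fun x y w w' h => by simpa using h
  have key : ∀ x y (w : c.Word x y),
      ψ w.val (Finsupp.single none 1) = Finsupp.single (some ⟨y, w⟩) 1 := by
    intro x y w
    have hγ : ∀ (γ : c.Gen) (v : c.WordFrom (c.gen γ).tgt),
        ψ (c.gen γ).hom (Finsupp.single v 1) = Finsupp.single (WordFrom.cons γ v) 1 := by
      intro γ v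
      have h : ψ (c.gen γ).hom = Finsupp.lmapDomain k k (WordFrom.cons γ) := hΨ' γ
      rw [h, Finsupp.lmapDomain_apply, Finsupp.mapDomain_single]
    induction w with
    | single γ => exact hγ γ none
    | cons γ w ih =>
      have h : ψ (Word.cons γ w).val = ψ (c.gen γ).hom ∘ₗ ψ w.val := Ψ.map_comp rfl w.val _
      rw [h, LinearMap.comp_apply, ih, hγ]
      rfl
  refine ⟨fun x y n => Finsupp.lcomapDomain _ (hinj x y) ∘ₗ
    LinearMap.applyₗ (Finsupp.single none 1) ∘ₗ ψ, fun x => ?_, fun x y w => ?_⟩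
  · have h : ψ (D.one x) = LinearMap.id := Ψ.map_one x
    rw [LinearMap.comp_apply, LinearMap.comp_apply, h]
    ext w
    change (Finsupp.single none (1 : k) : c.WordFrom x →₀ k) (some ⟨x, w⟩) = 0
    rw [Finsupp.single_apply, if_neg (by simp)]
  · rw [LinearMap.comp_apply, LinearMap.comp_apply, LinearMap.applyₗ_apply_apply, key]
    classical
    ext v
    change (Finsupp.single _ (1 : k) : c.WordFrom x →₀ k) (some ⟨y, v⟩) = _
    rw [Finsupp.single_apply, Finsupp.single_apply]
    simp

section Extension

variable (coord : ∀ x y n, D.Hom x y n →ₗ[k] (c.Word x y →₀ k)) {V : Type*} [AddCommGroup V]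
  [Module k V]

/-- The multilinear extension to chains of a function on sequences of words. -/
noncomputable def extend : {x y : D.Obj} → Chain D x y → (c.WordList x y → V) → V
  | _, _, .nil y, K => K (.nil y)
  | _, _, .cons g s, K =>
      Finsupp.linearCombination k (fun w => extend s fun l => K (.cons w l)) (coord _ _ _ g)

variable {coord}

theorem extend_lin {w x y z : D.Obj} {m : ℤ} (a : Chain D w x) (r : k) (g g' : D.Hom x y m)
    (b : Chain D y z) (K : c.WordList w z → V) :
    c.extend coord (a.append (.cons (r • g + g') b)) K =
      r • c.extend coord (a.append (.cons g b)) K + c.extend coord (a.append (.cons g' b)) K := by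
  induction a with
  | nil x => simp only [Chain.append, extend, map_add, map_smul]
  | cons l a ih =>
    simp only [Chain.append, extend, ih, Finsupp.linearCombination_apply, Finsupp.sum, smul_add,
      Finset.sum_add_distrib, Finset.smul_sum]
    congr 1
    exact Finset.sum_congr rfl fun _ _ => smul_comm _ _ _

theorem extend_one (h : ∀ x, coord x x 0 (D.one x) = 0) {w x z : D.Obj} (a : Chain D w x)
    (b : Chain D x z) (K : c.WordList w z → V) :
    c.extend coord (a.append (.cons (D.one x) b)) K = 0 := by
  induction a with
  | nil x => simp only [Chain.append, extend, h, map_zero]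
  | cons l a ih =>
    simp only [Chain.append, extend, ih, Finsupp.linearCombination_apply, Finsupp.sum, smul_zero,
      Finset.sum_const_zero]

theorem extend_toChain (h : ∀ x y (w : c.Word x y), coord x y w.deg w.val = Finsupp.single w 1)
    {x y : D.Obj} (l : c.WordList x y) (K : c.WordList x y → V) :
    c.extend coord l.toChain K = K l := by
  induction l with
  | nil => rfl
  | cons w l ih =>
    rw [WordList.toChain, extend, h, Finsupp.linearCombination_single, one_smul, ih]

end Extension

/-- A normalized functional is given by arbitrary values on the chains of monomials. -/
theorem exists_functional {G : D.Obj → E.Obj} {e : E.Obj} {y : D.Obj} (p : ℤ)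
    (m : ∀ z (l : c.WordList y z), E.Hom e (G z) (p + l.toChain.deg)) :
    ∃ θ : Fnl D E G e y, Fnl.IsNormalized p θ ∧
      ∀ z (l : c.WordList y z), θ z l.toChain (p + l.toChain.deg) = m z l := by
  obtain ⟨coord, h1, h2⟩ := c.exists_coord
  let K : ∀ z, c.WordList y z → E.Tot e (G z) := fun z l => single (p + l.toChain.deg) (m z l)
  refine ⟨fun z s => single (p + s.deg) (c.extend coord s (K z) (p + s.deg)),
    ⟨⟨fun a r g g' b => ?_⟩, fun s n hn => single_of_ne hn _, fun a b => ?_⟩, fun z l => ?_⟩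
  · have hg : (a.append (.cons g b)).deg = (a.append (.cons (r • g + g') b)).deg := by
      simp only [Chain.deg_append, Chain.deg_cons]
    have hg' : (a.append (.cons g' b)).deg = (a.append (.cons (r • g + g') b)).deg := by
      simp only [Chain.deg_append, Chain.deg_cons]
    rw [c.extend_lin, Pi.add_apply, Pi.smul_apply, map_add, map_smul, hg, hg']
  · rw [c.extend_one h1, Pi.zero_apply, map_zero]
  · beta_reduce
    rw [single_same, c.extend_toChain h2]
    exact single_same _ _

end ICellComplex

end Coordinates

/-! ### Unique primitives of cochains with values in a thickening -/

section Unique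

variable {k : Type u} [Field k] {C D E Z : DGCat.{u} k}

open DGCat

theorem Fnl.IsNormalized.map_eq_zero (c : ICellComplex D) {G : D.Obj → E.Obj} {e : E.Obj} {y : D.Obj}
    {p : ℤ} {θ : Fnl D E G e y} (hθ : Fnl.IsNormalized p θ)
    (H : ∀ x y : E.Obj, E.Tot x y →ₗ[k] E.Tot x y)
    (h : ∀ z (l : c.WordList y z), H _ _ (θ z l.toChain) = 0) {z : D.Obj} (s : Chain D y z) :
    H _ _ (θ z s) = 0 := by
  refine ICellComplex.WordList.chain_induction (c := c) (Q := fun {z} s => H _ _ (θ z s) = 0)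
    (fun a g g' b h h' => ?_) (fun a r g b h => ?_) (fun a b => ?_) (fun a b => ?_) (fun l => h _ l) s
  · have := hθ.lin a 1 g g' b
    rw [one_smul, one_smul] at this
    rw [this, map_add, h, h', add_zero]
  · have := hθ.lin a r g 0 b
    rw [add_zero, hθ.slot_zero, add_zero] at this
    rw [this, map_smul, h, smul_zero]
  · rw [hθ.slot_zero, map_zero]
  · rw [hθ.one, map_zero]

open thickening in
/-- Closed coherent natural transformations with values in a thickening have unique primitives with
given values, up to `ε`, on the chains of monomials. -/
theorem coherent.existsUnique_cdiff_eq (c : ICellComplex D) {F G : DGFunctor D Z.thickening} {p : ℤ}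
    (m : ∀ y z (l : c.WordList y z),
      Z.Hom (base (F.obj y)) (base (G.obj z)) (p + l.toChain.deg))
    (ζ : coherentHom F G (p + 1)) (hζ : Fnl.cdiff (F := F) (p + 1) ζ.1 = 0) :
    ∃! η : coherentHom F G p,
      (∀ y z (l : c.WordList y z), fst.map (η.1 y z l.toChain (p + l.toChain.deg)) = m y z l) ∧
        Fnl.cdiff (F := F) p η.1 = ζ.1 := by
  -- A cochain whose values are multiples of `ε` is recovered from its differential.
  have hcon : ∀ {q : ℤ} {η : ∀ y, Fnl D Z.thickening G.obj (F.obj y) y},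
      (∀ {x z} (s : Chain D x z), homotopy _ _ (η x z s) = 0) →
      (fun x => Fnl.homotopy homotopy (Fnl.cdiff (F := F) (G := G) q η x)) = η :=
    fun h => Fnl.homotopy_cdiff homotopy_td (fun p a _ => homotopy_tcomp_left p a)
      (fun p a _ => homotopy_tcomp_right p a) h
  have hcon0 : ∀ {q : ℤ} {η : ∀ y, Fnl D Z.thickening G.obj (F.obj y) y},
      (∀ {x z} (s : Chain D x z), homotopy _ _ (η x z s) = 0) →
      Fnl.cdiff (F := F) (G := G) q η = 0 → η = 0 := by
    intro q η h h'
    rw [← hcon (q := q) h, h']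
    funext x z s
    exact (congrArg (sg k s.deg • ·) (map_zero _)).trans (smul_zero _)
  have hsub : ∀ {q : ℤ} (η η' : ∀ y, Fnl D Z.thickening G.obj (F.obj y) y),
      Fnl.cdiff (F := F) (G := G) q (η - η') = Fnl.cdiff (F := F) q η - Fnl.cdiff (F := F) q η' := by
    intro q η η'
    have h := Fnl.cdiff_lin (F := F) (p := q) (-1 : k) η' η
    rwa [neg_one_smul, neg_one_smul, neg_add_eq_sub, neg_add_eq_sub] at h
  -- Start with a cochain having the prescribed first components on monomials; the primitive of what
  -- is then missing will consist of multiples of `ε`.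
  choose θ hθ hθm using fun y => c.exists_functional (E := Z.thickening) (G := G.obj) (e := F.obj y) p
    (fun z l => ((m y z l, 0) : Z.Hom (base (F.obj y)) (base (G.obj z)) _ × Z.Hom _ _ _))
  let w : coherentHom F G p := ⟨θ, hθ⟩
  let ζ' := ζ.1 - Fnl.cdiff (F := F) p w.1
  have hζ' : ∀ y, Fnl.IsNormalized (p + 1) (ζ' y) := fun y =>
    Submodule.sub_mem (coherentHom F G (p + 1)) ζ.2 (Fnl.IsNormalized.cdiff rfl hθ) y
  let v : coherentHom F G p := ⟨fun y => Fnl.homotopy homotopy (ζ' y), fun y =>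
    Fnl.IsNormalized.homotopy (fun _ _ t p h n hn => homotopy_homog t p h n hn) rfl (hζ' y)⟩
  have hv : ∀ {x z} (s : Chain D x z), homotopy _ _ (v.1 x z s) = 0 := fun s => by
    change homotopy _ _ (sg k s.deg • _) = 0
    rw [map_smul, homotopy_homotopy, smul_zero]
  -- The defect is closed and all its first components vanish, so it is zero by `hcon0`.
  have hd : Fnl.cdiff (F := F) p v.1 - ζ' = 0 := by
    refine hcon0 (q := p + 1) (fun {x z} s => ?_) ?_
    · have h := congrFun (congrFun (congrFun (hcon (q := p) hv) x) z) s
      have h' : sg k s.deg • homotopy _ _ (Fnl.cdiff (F := F) p v.1 x z s) =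
        sg k s.deg • homotopy _ _ (ζ' x z s) := h
      have h'' := congrArg (sg k s.deg • ·) h'
      simp only [smul_smul, sg_mul_self, one_smul] at h''
      change homotopy _ _ (_ - _) = 0
      rw [map_sub, h'', sub_self]
    · have h1 := coherent.d_sub_d ζ hζ w
      have h2 : Fnl.cdiff (F := F) (p + 1) (Fnl.cdiff (F := F) p v.1) = 0 :=
        funext (Fnl.cdiff_cdiff rfl fun y => (v.2 y).toIsMulti)
      rw [hsub, h1, h2, sub_zero]
  have hfst : ∀ y z (l : c.WordList y z),
      fst.map ((w + v).1 y z l.toChain (p + l.toChain.deg)) = m y z l := fun y z l => by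
    refine (map_add fst.map (w.1 y z l.toChain _) (v.1 y z l.toChain _)).trans ?_
    rw [homotopy_eq_zero.1 (hv l.toChain), add_zero]
    exact congrArg fst.map (hθm y z l)
  have hcd : Fnl.cdiff (F := F) p (w + v).1 = ζ.1 := by
    have h := Fnl.cdiff_lin (F := F) (p := p) (1 : k) w.1 v.1
    rw [one_smul, one_smul, sub_eq_zero.1 hd] at h
    exact h.trans (add_sub_cancel _ _)
  refine ⟨w + v, ⟨hfst, hcd⟩, fun η ⟨h1, h2⟩ => ?_⟩
  -- The difference of two solutions is closed, and its first components vanish on monomials, hence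
  -- on all chains.
  have hn := (η - (w + v)).2
  have h0 : (η - (w + v)).1 = 0 := by
    refine hcon0 (q := p) (fun {x z} s => (hn x).map_eq_zero c homotopy (fun z l => ?_) s) ?_
    · rw [homotopy_eq_zero]
      intro n
      by_cases h : n = p + l.toChain.deg
      · subst h
        refine (map_sub fst.map (η.1 x z l.toChain _) ((w + v).1 x z l.toChain _)).trans ?_
        rw [h1, hfst, sub_self]
      · rw [(hn x).homog _ _ h, map_zero]
    · exact (hsub _ _).trans (by rw [h2, hcd, sub_self])
  exact sub_eq_zero.1 (Subtype.ext h0)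

end Unique

/-! ### The twisted tensor product is free as a graded category -/

section FreeGradedFunctors

variable {k : Type u} [Field k] {C D Z : DGCat.{u} k}

open DGCat

/-- A word followed by a sequence of words. -/
def ICellComplex.WordList.consSeq {d : ICellComplex D} : {x y z : D.Obj} → d.Word x y →
    d.WordList y z → d.WordSeq x z
  | _, _, _, w, .nil _ => .single w
  | _, _, _, w, .cons w' l => .cons w (l.consSeq w')

theorem ICellComplex.WordList.toChain_consSeq {d : ICellComplex D} {x y z : D.Obj} (w : d.Word x y)
    (l : d.WordList y z) : (l.consSeq w).toChain = .cons w.val l.toChain := by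
  induction l generalizing x with
  | nil => rfl
  | cons w' l ih => rw [consSeq, WordSeq.toChain, ih, toChain]

theorem ICellComplex.WordSeq.exists_eq_consSeq {d : ICellComplex D} {x z : D.Obj} (s : d.WordSeq x z) :
    ∃ (y : D.Obj) (w : d.Word x y) (l : d.WordList y z), s = l.consSeq w := by
  induction s with
  | single w => exact ⟨_, w, .nil _, rfl⟩
  | cons w s ih =>
    obtain ⟨_, w', l, rfl⟩ := ih
    exact ⟨_, w, .cons w' l, rfl⟩

variable {c : ICellComplex C} {d : ICellComplex D}

namespace TwistedGen

/-- The generator `ε(f_i; s₁, …, s_n)`, where `n = 0` is allowed. -/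
def ofWords (i : c.Gen) : {y z : D.Obj} → d.WordList y z → TwistedGen c d
  | _, _, .nil y => .left i y
  | _, _, .cons w l => .eps i (l.consSeq w)

theorem ofWords_mor (i : c.Gen) {y z : D.Obj} (l : d.WordList y z) :
    (ofWords i l).mor = ⟨((c.gen i).src, y), ((c.gen i).tgt, z), _,
      (twistedSymbols C D).eps (c.gen i).hom l.toChain _ rfl⟩ := by
  cases l with
  | nil => rfl
  | cons w l =>
    exact congrArg (fun s => (⟨((c.gen i).src, y), ((c.gen i).tgt, z), _,
      (twistedSymbols C D).eps (c.gen i).hom s _ rfl⟩ : (twistedTensor C D).Mor))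
      (ICellComplex.WordList.toChain_consSeq w l)

theorem cases_ofWords {P : TwistedGen c d → Prop} (right : ∀ x j, P (.right x j))
    (ofWords : ∀ (i : c.Gen) {y z : D.Obj} (l : d.WordList y z), P (ofWords i l))
    (γ : TwistedGen c d) : P γ := by
  cases γ with
  | left i y => exact ofWords i (.nil y)
  | right x j => exact right x j
  | eps i s =>
    obtain ⟨_, w, l, rfl⟩ := s.exists_eq_consSeq
    exact ofWords i (.cons w l)

open thickening in
/-- Graded functors out of the twisted tensor product exist for given values on objects and on the
generators. -/
theorem exists_graded (o : (twistedTensor C D).Obj → Z.Obj)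
    (m : ∀ γ : TwistedGen c d, Z.Hom (o γ.mor.src) (o γ.mor.tgt) γ.mor.deg) :
    ∃ Ψ : GradedFunctor (twistedTensor C D) Z o, ∀ γ : TwistedGen c d, Ψ.map γ.mor.hom = m γ := by
  have hval : ∀ {M M' : (twistedTensor C D).Mor}, M = M' → ∀ v : Z.Hom (o M.src) (o M.tgt) M.deg,
      ∃ v' : Z.Hom (o M'.src) (o M'.tgt) M'.deg, ∀ Ψ : GradedFunctor (twistedTensor C D) Z o,
        Ψ.map M'.hom = v' → Ψ.map M.hom = v := by
    rintro M _ rfl v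
    exact ⟨v, fun _ h => h⟩
  choose v hv using fun (i : c.Gen) (y z : D.Obj) (l : d.WordList y z) =>
    hval (ofWords_mor i l) (m (ofWords i l))
  -- For each object of `C`, the values at id ⊗ g_j define a dg functor from `D` to the thickening;
  -- these are the objects to which `C` is sent.
  choose Ψ hΨd hΨ using fun x : C.Obj =>
    d.exists_graded (Z := Z) (fun y => o (x, y)) (fun j => m (.right x j))
  let G : C.Obj → DGFunctor D Z.thickening := fun x => (Ψ x).toDGFunctor (hΨd x)
  -- The extension property of `C` is applied with values in coherent transformations, where unique
  -- primitives exist. The sign is the one between symbols and cochains.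
  obtain ⟨Φ', hΦd, hΦ⟩ := c.exists_dgFunctor (Z := coherent D Z.thickening)
    (fun x => coherent.of (G x))
    (fun i (w : coherentHom (G (c.gen i).src) (G (c.gen i).tgt) _) => ∀ y z (l : d.WordList y z),
      fst.map (w.1 y z l.toChain ((c.gen i).deg + l.toChain.deg)) =
        sg k ((c.gen i).deg * l.toChain.deg) • v i y z l)
    (fun i (ζ : coherentHom (G (c.gen i).src) (G (c.gen i).tgt) _) hζ => by
      obtain ⟨η, ⟨h1, h2⟩, h3⟩ := coherent.existsUnique_cdiff_eq d
        (F := G (c.gen i).src) (G := G (c.gen i).tgt) (p := (c.gen i).deg)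
        (fun y z l => sg k ((c.gen i).deg * l.toChain.deg) • v i y z l) ζ (congrArg Subtype.val hζ)
      exact ⟨η, ⟨h1, Subtype.ext h2⟩, fun η' h => h3 η' ⟨h.1, congrArg Subtype.val h.2⟩⟩)
  let Φ : DGFunctor C (coherent D Z.thickening) := Φ'.toDGFunctor hΦd
  let F : GradedFunctor (twistedTensor C D) Z.thickening o :=
    DGFunctor.toGraded (A := twistedTensor C D) (twistedLift (.ofCoherent Φ))
  refine ⟨F.comp fst, fun γ => ?_⟩
  induction γ using cases_ofWords with
  | right x j => exact hΨ x j
  | ofWords i l =>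
    refine hv i _ _ l _ ?_
    refine (map_smul fst.map (sg k ((c.gen i).deg * l.toChain.deg)) _).trans ?_
    refine (congrArg (sg k ((c.gen i).deg * l.toChain.deg) • ·) (hΦ i _ _ l)).trans ?_
    exact (smul_smul _ _ _).trans
      ((congrArg (· • v i _ _ l) (sg_mul_self _)).trans (one_smul k (v i _ _ l)))

end TwistedGen

end FreeGradedFunctors

/-! ### The differential lowers the rank of generators -/

section Triangularity

variable {k : Type u} [Field k] {C D E : DGCat.{u} k}

open DGCat

theorem Multiset.IsDershowitzMannaLT.add_right {α : Type*} [Preorder α] {M N : Multiset α}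
    (h : M.IsDershowitzMannaLT N) (K : Multiset α) : (M + K).IsDershowitzMannaLT (N + K) := by
  obtain ⟨X, Y, Z, hZ, rfl, rfl, h⟩ := h
  exact ⟨X + K, Y, Z, hZ, add_right_comm _ _ _, add_right_comm _ _ _, h⟩

theorem Multiset.isDershowitzMannaLT_add_right {α : Type*} [Preorder α] (M : Multiset α)
    {N : Multiset α} (h : N ≠ 0) : M.IsDershowitzMannaLT (M + N) :=
  ⟨M, 0, N, h, (add_zero M).symm, rfl, fun _ h => absurd h (Multiset.notMem_zero _)⟩

namespace ICellComplex

variable {d : ICellComplex D}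

/-- The stages of the letters of a sequence of words. -/
noncomputable def WordList.letters : {x y : D.Obj} → d.WordList x y → Multiset d.J
  | _, _, .nil _ => 0
  | _, _, .cons w l => w.letters + l.letters

/-- The number of words. -/
def WordList.length : {x y : D.Obj} → d.WordList x y → ℕ
  | _, _, .nil _ => 0
  | _, _, .cons _ l => l.length + 1

theorem WordList.letters_append {x y z : D.Obj} (l : d.WordList x y) (l' : d.WordList y z) :
    (l.append l').letters = l.letters + l'.letters := by
  induction l with
  | nil => exact (zero_add _).symm
  | cons w l ih => rw [append, letters, letters, ih, add_assoc]

theorem WordList.length_append {x y z : D.Obj} (l : d.WordList x y) (l' : d.WordList y z) :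
    (l.append l').length = l.length + l'.length := by
  induction l with
  | nil => exact (zero_add _).symm
  | cons w l ih => rw [append, length, length, ih, add_right_comm]

/-- The differential lowers the letters of words. -/
theorem WordSpan.d_val {x y : D.Obj} (w : d.Word x y) {n : ℤ} (h : w.deg + 1 = n) :
    WordSpan (c := d) (fun M => M.IsDershowitzMannaLT w.letters) (D.d _ n h w.val) := by
  have hgen : ∀ (γ : d.Gen) {n : ℤ} (h : (d.gen γ).deg + 1 = n),
      WordSpan (c := d) (fun M => M.IsDershowitzMannaLT {γ.1.j}) (D.d _ n h (d.gen γ).hom) := by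
    rintro γ _ rfl
    -- One letter is replaced by any number, possibly zero, of letters of strictly earlier stages;
    -- this is a descent in the Dershowitz–Manna order.
    refine WordSpan.mono (P := fun M => ∀ j ∈ M, j < γ.1.j) (fun M hM => ⟨0, M, {γ.1.j}, by simp,
      (zero_add _).symm, (zero_add _).symm, fun j hj => ⟨_, Multiset.mem_singleton_self _, hM j hj⟩⟩)
      (of_closure (fun j hj => absurd hj (Multiset.notMem_zero _)) (fun M N hM hN j hj =>
        (Multiset.mem_add.1 hj).elim (hM j) (hN j)) ?_ (d.closure_gen_d γ))
    rintro _ ⟨γ', h, rfl⟩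
    exact ⟨γ', rfl, fun j hj => Multiset.mem_singleton.1 hj ▸ h⟩
  induction w generalizing n with
  | single γ => exact hgen γ h
  | cons γ w ih =>
    refine WordSpan.of_mor_eq (m := ⟨_, _, n, _⟩) (congrArg (Mor.mk _ _ _)
      (D.leibniz rfl h rfl rfl (by rw [← h, Word.deg]; ring) (by rw [← h, Word.deg]; ring)
        w.val (d.gen γ).hom).symm) ?_
    rw [negOnePow_smul_eq_sg (k := k)]
    refine .add ((ih rfl).comp (Q := (· = {γ.1.j})) ?_ _ (.word (.single γ) rfl))
      (.smul _ (WordSpan.comp (P := (· = w.letters)) ?_ _ (.word w rfl) (hgen γ rfl)))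
    · rintro M _ hM rfl
      exact hM.add_right _
    · rintro _ N rfl hN
      rw [Word.letters, add_comm _ N, add_comm w.letters]
      exact hN.add_right _

end ICellComplex

namespace TwistedData

variable (T : TwistedData C D E)

theorem eps_slot_zero {c c' : C.Obj} {p : ℤ} {w x y z : D.Obj} {m : ℤ} (f : C.Hom c c' p)
    (a : Chain D w x) (b : Chain D y z) (n : ℤ)
    (h : p + (a.append (.cons (0 : D.Hom x y m) b)).deg = n) :
    T.eps f (a.append (.cons (0 : D.Hom x y m) b)) n h = 0 := by
  have key : ∀ (g : D.Hom x y m) (_ : g = 0) (h : p + (a.append (.cons g b)).deg = n),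
      T.eps f (a.append (.cons g b)) n h = 0 := by
    intro g hg h
    have h1 : g = (0 : k) • g := by rw [zero_smul, hg]
    have h2 : ∀ (g' : D.Hom x y m) (_ : g' = (0 : k) • g)
        (h' : p + (a.append (.cons g' b)).deg = n), T.eps f (a.append (.cons g' b)) n h' = 0 := by
      rintro _ rfl h'
      rw [T.eps_smul f a 0 g b n h' h, zero_smul]
    exact h2 g h1 h
  exact key 0 rfl h

theorem zero_eps {c c' : C.Obj} {p : ℤ} {y z : D.Obj} (s : Chain D y z) (n : ℤ)
    (h : p + s.deg = n) : T.eps (0 : C.Hom c c' p) s n h = 0 := by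
  have := T.eps_smul_left (0 : k) (0 : C.Hom c c' p) s n h
  rwa [smul_zero, zero_smul] at this

variable {T} {S : Set E.Mor}

theorem closure_right {x : C.Obj} {G : Set D.Mor} (hG : ∀ m ∈ G, Closure S (T.right x m.hom))
    {y z : D.Obj} {n : ℤ} {g : D.Hom y z n} (hg : Closure G g) : Closure S (T.right x g) := by
  induction hg with
  | gen g hg => exact hG _ hg
  | one y => rw [T.right_one]; exact .one _
  | comp h _ _ ih ih' => rw [T.right_comp]; exact .comp h ih ih'
  | zero y z n =>
    have := T.right_smul x 0 (0 : D.Hom y z n)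
    rw [zero_smul, zero_smul] at this
    rw [this]
    exact .zero _ _ _
  | add _ _ ih ih' => rw [T.right_add]; exact .add ih ih'
  | smul r _ ih => rw [T.right_smul]; exact .smul r ih

theorem closure_splitSum {c c' c'' : C.Obj} {p₂ p₁ : ℤ} {f₂ : C.Hom c' c'' p₂} {f₁ : C.Hom c c' p₁}
    (h₂ : ∀ {y z : D.Obj} (s : Chain D y z), Closure S (T.eps f₂ s _ rfl))
    (h₁ : ∀ {y z : D.Obj} (s : Chain D y z), Closure S (T.eps f₁ s _ rfl))
    {x y z : D.Obj} (a : Chain D x y) (b : Chain D y z) (n : ℤ)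
    (h : (p₂ + p₁) + (a.deg + b.deg) = n) : Closure S (T.splitSum f₂ f₁ a b n h) := by
  induction b with
  | nil => exact .comp _ (h₂ _) (h₁ _)
  | cons g b ih => exact .add (.sg_smul (.comp _ (h₂ _) (h₁ _)) _) (ih _ _)

/-- Relation 3 expresses a symbol at a composite through symbols of the factors at pieces of the
chain, so `hG` is assumed for all chains. -/
theorem closure_eps {G : Set C.Mor}
    (hG : ∀ m ∈ G, ∀ {y z : D.Obj} (s : Chain D y z), Closure S (T.eps m.hom s _ rfl))
    {c c' : C.Obj} {p : ℤ} {f : C.Hom c c' p} (hf : Closure G f) {y z : D.Obj} (s : Chain D y z)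
    {n : ℤ} (h : p + s.deg = n) : Closure S (T.eps f s n h) := by
  induction hf generalizing y z n with
  | gen f hf => subst h; exact hG _ hf s
  | one c =>
    cases s with
    | nil =>
      obtain rfl : n = 0 := h.symm
      exact cast (congrArg _ (T.left_one c _ h).symm) (.one _)
    | cons g s => rw [T.one_eps]; exact .zero _ _ _
  | comp hp _ _ ih ih' =>
    rw [T.comp_eps hp _ _ s n h (by rw [hp, Chain.deg_nil, zero_add]; exact h)]
    exact closure_splitSum (fun s => ih s rfl) (fun s => ih' s rfl) _ _ _ _
  | zero => rw [T.zero_eps]; exact .zero _ _ _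
  | add _ _ ih ih' => rw [T.eps_add_left]; exact .add (ih _ _) (ih' _ _)
  | smul r _ ih => rw [T.eps_smul_left]; exact .smul r (ih _ _)

section

variable {c c' : C.Obj} {p : ℤ} {f : C.Hom c c' p}

theorem closure_eps_congr {y z : D.Obj} {s s' : Chain D y z} (e : s = s')
    (hs : Closure S (T.eps f s _ rfl)) {n : ℤ} (h : p + s'.deg = n) : Closure S (T.eps f s' n h) := by
  subst e h
  exact hs

variable {d : ICellComplex D}

theorem closure_eps_chain {y : D.Obj}
    (hl : ∀ {z : D.Obj} (l : d.WordList y z), Closure S (T.eps f l.toChain _ rfl)) {z : D.Obj}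
    (s : Chain D y z) : Closure S (T.eps f s _ rfl) := by
  refine ICellComplex.WordList.chain_induction (c := d)
    (Q := fun {z} s => Closure S (T.eps f s _ rfl)) (fun a g g' b h h' => ?_) (fun a r g b h => ?_)
    (fun a b => ?_) (fun a b => ?_) hl s
  · rw [T.eps_add f a g g' b _ _ (by simp) (by simp)]
    exact .add (closure_eps_congr rfl h _) (closure_eps_congr rfl h' _)
  · rw [T.eps_smul f a r g b _ _ (by simp)]
    exact .smul r (closure_eps_congr rfl h _)
  · rw [T.eps_slot_zero]; exact .zero _ _ _
  · rw [T.eps_one]; exact .zero _ _ _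

/-- Identities in the span contribute nothing by normalization, so only nonempty words are left. -/
theorem closure_eps_slot {P : Multiset d.J → Prop} {x y z w : D.Obj} (a : Chain D x y)
    (b : Chain D z w)
    (h : ∀ v : d.Word y z, P v.letters → Closure S (T.eps f (a.append (.cons v.val b)) _ rfl))
    {m n : ℤ} {g : D.Hom y z m} (hg : d.WordSpan P g) (hn : p + (a.append (.cons g b)).deg = n) :
    Closure S (T.eps f (a.append (.cons g b)) n hn) := by
  induction hg generalizing n with
  | word v hv => exact closure_eps_congr rfl (h v hv) _
  | one => rw [T.eps_one]; exact .zero _ _ _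
  | zero => rw [T.eps_slot_zero]; exact .zero _ _ _
  | add _ _ ih ih' =>
    rw [T.eps_add f a _ _ b _ _ (by simpa using hn) (by simpa using hn)]
    exact .add (ih b h _) (ih' b h _)
  | smul r _ ih =>
    rw [T.eps_smul f a r _ b _ _ (by simpa using hn)]
    exact .smul r (ih b h _)

variable (T S f d) in
/-- The symbols at sequences of words with fewer letters, or with the same letters and fewer words,
are in the closure of `S`. -/
def ClosureBelow (N : Multiset d.J) (n : ℕ) : Prop :=
  ∀ {y z : D.Obj} (l : d.WordList y z),
    Prod.Lex Multiset.IsDershowitzMannaLT (· < ·) (l.letters, l.length) (N, n) →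
      Closure S (T.eps f l.toChain _ rfl)

open ICellComplex

/-- Differentiating one word lowers its multiset of letters and leaves those of the other words
alone. -/
theorem closure_diffSum {N : Multiset d.J} {r : ℕ} (H : T.ClosureBelow S f d N r) {x y z : D.Obj}
    (a : d.WordList x y) (b : d.WordList y z) (hN : a.letters + b.letters = N)
    {s : Chain D x y} (hs : s = a.toChain) (n : ℤ) (h : p + (s.deg + b.toChain.deg) + 1 = n) :
    Closure S (T.diffSum f s b.toChain n h) := by
  induction b with
  | nil => exact .zero _ _ _
  | cons w b ih =>
    refine .add (.sg_smul (closure_eps_slot (d := d) s b.toChain (fun v hv => ?_)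
      (WordSpan.d_val w rfl) _) _) (ih (a.append (.cons w (.nil _))) ?_ ?_ _)
    · refine closure_eps_congr (s := (a.append (.cons v b)).toChain) ?_ (H _ (.left _ _ ?_)) _
      · rw [WordList.toChain_append, hs]
        rfl
      · rw [← hN, WordList.letters_append, add_comm a.letters, add_comm a.letters]
        refine Multiset.IsDershowitzMannaLT.add_right ?_ _
        exact Multiset.IsDershowitzMannaLT.add_right hv _
    · rw [WordList.letters_append, ← hN, add_assoc, WordList.letters, WordList.letters,
        WordList.letters, add_zero]
    · rw [WordList.toChain_append, hs]
      rfl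

/-- Merging two adjacent words keeps all letters and lowers the number of words, which is why that
number belongs to the rank. -/
theorem closure_mulSum {N : Multiset d.J} {r : ℕ} (H : T.ClosureBelow S f d N r) {x y z v : D.Obj}
    (a : d.WordList x y) (w : d.Word y z) (b : d.WordList z v)
    (hN : a.letters + (w.letters + b.letters) = N) (hr : a.length + (b.length + 1) = r)
    {s : Chain D x y} (hs : s = a.toChain) (n : ℤ)
    (h : p + (s.deg + ((w.deg - 1) + b.toChain.deg)) + 1 = n) :
    Closure S (T.mulSum f s w.val b.toChain n h) := by
  induction b generalizing y s with
  | nil => exact .zero _ _ _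
  | cons w' b ih =>
    rw [WordList.length] at hr
    refine .add (.sg_smul (closure_eps_slot (d := d) (P := (· = w'.letters + w.letters)) s b.toChain
      (fun v hv => ?_) (.of_mor_eq (w.val_append w' rfl).symm (.word _ (w.letters_append w'))) _) _)
      (ih (a.append (.cons w (.nil _))) w' ?_ ?_ ?_ _)
    · refine closure_eps_congr (s := (a.append (.cons v b)).toChain) ?_ (H _ ?_) _
      · rw [WordList.toChain_append, hs]
        rfl
      · have h1 : (a.append (.cons v b)).letters = N := by
          rw [WordList.letters_append, WordList.letters, hv, ← hN, WordList.letters,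
            add_comm w'.letters, add_assoc w.letters]
        rw [h1]
        refine .right _ ?_
        rw [WordList.length_append, WordList.length]
        omega
    · rw [WordList.letters_append, ← hN, add_assoc, WordList.letters, WordList.letters,
        WordList.letters, add_zero]
    · rw [WordList.length_append, WordList.length, WordList.length]
      omega
    · rw [WordList.toChain_append, hs]
      rfl

/-- The last word leaves the symbol, taking at least one letter with it. -/
theorem closure_lastTerm {N : Multiset d.J} {r : ℕ} (H : T.ClosureBelow S f d N r)
    (hR : ∀ {y z : D.Obj} {n : ℤ} (g : D.Hom y z n), Closure S (T.right c' g)) {x y z v : D.Obj}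
    (a : d.WordList x y) (w : d.Word y z) (b : d.WordList z v)
    (hN : a.letters + (w.letters + b.letters) = N)
    {s : Chain D x y} (hs : s = a.toChain) (n : ℤ)
    (h : p + (s.deg + ((w.deg - 1) + b.toChain.deg)) + 1 = n) :
    Closure S (T.lastTerm f s w.val b.toChain n h) := by
  induction b generalizing y s with
  | nil =>
    refine .sg_smul (.comp _ (hR _) (closure_eps_congr hs.symm (H a (.left _ _ ?_)) _)) _
    rw [← hN, WordList.letters, add_zero]
    exact Multiset.isDershowitzMannaLT_add_right _ w.letters_ne_zero
  | cons w' b ih =>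
    refine ih (a.append (.cons w (.nil _))) w' ?_ ?_ _
    · rw [WordList.letters_append, ← hN, add_assoc, WordList.letters, WordList.letters,
        WordList.letters, add_zero]
    · rw [WordList.toChain_append, hs]
      rfl

/-- The differential of a symbol at a sequence of words. -/
theorem closure_d_eps {x z : D.Obj} (l : d.WordList x z)
    (H : T.ClosureBelow S f d l.letters l.length)
    (hR : ∀ (c : C.Obj) {y z : D.Obj} {n : ℤ} (g : D.Hom y z n), Closure S (T.right c g))
    (hd : ∀ {y z : D.Obj} (s : Chain D y z), Closure S (T.eps (C.d p (p + 1) rfl f) s _ rfl))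
    {n n' : ℤ} (h : p + l.toChain.deg = n) (hn : n + 1 = n') :
    Closure S (E.d n n' hn (T.eps f l.toChain n h)) := by
  cases l with
  | nil =>
    have h1 : p + 1 + 0 = n' := by
      rw [← hn, ← h]
      exact add_right_comm _ _ _
    refine cast (congrArg _ (T.left_d rfl f x n n' hn h h1).symm) ?_
    exact closure_eps_congr rfl (hd _) _
  | cons w l =>
    have h1 : p + ((w.deg - 1) + l.toChain.deg) + 1 = n' := by rw [← hn, ← h]; rfl
    have h2 : ∀ q, q + (w.deg - 1 + l.toChain.deg) + 1 = n' → q + (0 + (w.deg - 1 + l.toChain.deg)) + 1 = n' :=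
      fun q h => by rw [zero_add]; exact h
    have key := T.eps_d rfl f w.val l.toChain n n' hn h
      (show p + 1 + ((w.deg - 1) + l.toChain.deg) = n' by rw [← h1]; ring) (h2 p h1) (h2 p h1) h1
    -- This solves relation 4 for the differential of the symbol.
    have aux : ∀ {a b e e' : E.Hom (T.obj (c, x)) (T.obj (c', z)) n'},
        a = b + e + e' → a + (-1 : k) • (e + e') = b := by
      rintro _ b e e' rfl
      rw [neg_one_smul, add_assoc b, add_neg_cancel_right]
    refine cast (congrArg (Closure S) (aux key)) (.add (closure_eps_congr rfl (hd _) _) (.smul _ (.add ?_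
      (.add (.add ?_ (.sg_smul (.comp _ ?_ (hR _ _)) _)) ?_))))
    · exact closure_diffSum H (.nil _) (.cons w l) (zero_add _) rfl _ _
    · exact closure_lastTerm H (hR _) (.nil _) w l (zero_add _) rfl _ _
    · refine H l (.left _ _ ?_)
      rw [WordList.letters, add_comm]
      exact Multiset.isDershowitzMannaLT_add_right _ w.letters_ne_zero
    · exact closure_mulSum H (.nil _) w l (zero_add _) (zero_add _) rfl _ _

end

end TwistedData

end Triangularity

/-! ### The cell structure on the twisted tensor product, and part (b) -/

section SemifreeTensor

variable {k : Type u} [Field k] {C D : DGCat.{u} k}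

open DGCat

variable {c : ICellComplex C} {d : ICellComplex D}

namespace ICellComplex.WordSeq

/-- The stages of the letters of a sequence of words. -/
noncomputable def letters : {x y : D.Obj} → d.WordSeq x y → Multiset d.J
  | _, _, .single w => w.letters + 0
  | _, _, .cons w s => w.letters + s.letters

/-- The number of words. -/
def length : {x y : D.Obj} → d.WordSeq x y → ℕ
  | _, _, .single _ => 0 + 1
  | _, _, .cons _ s => s.length + 1

theorem letters_consSeq {x y z : D.Obj} (w : d.Word x y) (l : d.WordList y z) :
    (l.consSeq w).letters = w.letters + l.letters := by
  induction l generalizing x with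
  | nil => rfl
  | cons w' l ih => rw [WordList.consSeq, letters, ih, WordList.letters]

theorem length_consSeq {x y z : D.Obj} (w : d.Word x y) (l : d.WordList y z) :
    (l.consSeq w).length = l.length + 1 := by
  induction l generalizing x with
  | nil => rfl
  | cons w' l ih => rw [WordList.consSeq, length, ih, WordList.length]

end ICellComplex.WordSeq

namespace TwistedGen

/-- The invariant which decreases when the differential is applied. -/
noncomputable def rank : TwistedGen c d → d.J ⊕ (c.J × Multiset d.J × ℕ)
  | .left i _ => .inr (i.1.j, 0, 0)
  | .right _ j => .inl j.1.j
  | .eps i s => .inr (i.1.j, s.letters, s.length)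

theorem rank_ofWords (i : c.Gen) {y z : D.Obj} (l : d.WordList y z) :
    (ofWords i l).rank = .inr (i.1.j, l.letters, l.length) := by
  cases l with
  | nil => rfl
  | cons w l =>
    rw [ofWords, rank, ICellComplex.WordSeq.letters_consSeq, ICellComplex.WordSeq.length_consSeq]
    rfl

/-- The comparison of ranks. -/
def RankLT (γ γ' : TwistedGen c d) : Prop :=
  Sum.Lex (· < ·) (Prod.Lex (· < ·) (Prod.Lex Multiset.IsDershowitzMannaLT (· < ·))) γ.rank γ'.rank

theorem rankLT_wellFounded : WellFounded (RankLT (c := c) (d := d)) :=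
  InvImage.wf rank (Sum.lex_wf wellFounded_lt (WellFounded.prod_lex wellFounded_lt
    (WellFounded.prod_lex Multiset.wellFounded_isDershowitzMannaLT wellFounded_lt)))

theorem closure_ofWords {S : Set (twistedTensor C D).Mor} {i : c.Gen} {y z : D.Obj}
    {l : d.WordList y z} (h : (ofWords i l).mor ∈ S) :
    Closure S ((twistedUniversal C D).eps (c.gen i).hom l.toChain _ rfl) :=
  .gen _ (ofWords_mor i l ▸ h)

/-- The generators id ⊗ g_j precede all others because relation 4 composes symbols with morphisms id
⊗ g, expanded in such generators. The stage of f_i is compared before the words because relation 3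
spreads ε(d f_i; s) over symbols of earlier f's at pieces of `s`. -/
theorem closure_d_mor (γ : TwistedGen c d) :
    Closure {m | ∃ γ' : TwistedGen c d, γ'.RankLT γ ∧ γ'.mor = m} γ.mor.d.hom := by
  induction γ using cases_ofWords with
  | right x j =>
    refine cast (congrArg _ ((twistedUniversal C D).right_d x _ _ rfl (d.gen j).hom))
      (TwistedData.closure_right (T := twistedUniversal C D) (G := d.genBefore j.1.j) ?_
        (d.closure_gen_d j))
    rintro _ ⟨j', h, rfl⟩
    exact .gen _ ⟨.right x j', .inl h, rfl⟩
  | ofWords i l =>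
    have hlow : ∀ {i' : c.Gen} {y z : D.Obj} (l' : d.WordList y z),
        Prod.Lex (· < ·) (Prod.Lex Multiset.IsDershowitzMannaLT (· < ·))
          (i'.1.j, l'.letters, l'.length) (i.1.j, l.letters, l.length) →
        Closure {m | ∃ γ' : TwistedGen c d, γ'.RankLT (ofWords i l) ∧ γ'.mor = m}
          ((twistedUniversal C D).eps (c.gen i').hom l'.toChain _ rfl) := fun l' h =>
      closure_ofWords ⟨_, by rw [RankLT, rank_ofWords, rank_ofWords]; exact .inr h, rfl⟩
    rw [ofWords_mor]
    refine TwistedData.closure_d_eps (T := twistedUniversal C D) l (fun l' h => hlow l' (.right _ h))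
      (fun x _ _ _ g => TwistedData.closure_right (T := twistedUniversal C D) ?_ (d.closure_gen g))
      (fun s => TwistedData.closure_eps (G := c.genBefore i.1.j) ?_ (c.closure_gen_d i) s _) _ _
    · rintro _ ⟨j, rfl⟩
      exact .gen _ ⟨.right x j, by rw [RankLT, rank_ofWords]; exact .sep _ _, rfl⟩
    · rintro _ ⟨i', h, rfl⟩ y z s
      exact TwistedData.closure_eps_chain (fun l' => hlow l' (.left _ _ h)) s

/-- The morphisms of the twisted tensor product are linear combinations of composites of
generators. -/
theorem closure_range_mor {x y : C.Obj × D.Obj} {n : ℤ} (f : TwistedHom C D x y n) :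
    Closure (A := twistedTensor C D) (Set.range (mor (c := c) (d := d))) f := by
  induction f using Quotient.ind with
  | _ t =>
  change Closure (A := twistedTensor C D) _ (TwistedHom.mk t)
  induction t with
  | one x => exact .one (A := twistedTensor C D) x
  | comp h t t' ih ih' => exact .comp (A := twistedTensor C D) h ih ih'
  | zero x y n => exact .zero (A := twistedTensor C D) x y n
  | add t t' ih ih' => exact .add (A := twistedTensor C D) ih ih'
  | smul r t ih => exact .smul (A := twistedTensor C D) r ih
  | d n m h t ih =>
    refine Closure.d (A := twistedTensor C D) ?_ h ih
    rintro _ ⟨γ, rfl⟩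
    refine γ.closure_d_mor.mono ?_
    rintro _ ⟨γ', -, rfl⟩
    exact ⟨γ', rfl⟩
  | right x g =>
    refine TwistedData.closure_right (T := twistedUniversal C D) ?_ (d.closure_gen g)
    rintro _ ⟨j, rfl⟩
    exact .gen _ ⟨.right x j, rfl⟩
  | eps f s n h =>
    refine TwistedData.closure_eps (T := twistedUniversal C D) ?_ (c.closure_gen f) s h
    rintro _ ⟨i, rfl⟩ y z s
    exact TwistedData.closure_eps_chain (T := twistedUniversal C D)
      (fun l => closure_ofWords (i := i) (l := l) (Set.mem_range_self _)) s

end TwistedGen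

theorem twistedTensor_exists_iCellComplex (c : ICellComplex C) (d : ICellComplex D) :
    ∃ (e : ICellComplex (twistedTensor C D)) (φ : e.Gen ≃ TwistedGen c d),
      ∀ γ, e.gen γ = (φ γ).mor := by
  have hwf : IsWellFounded (TwistedGen c d) TwistedGen.RankLT := ⟨TwistedGen.rankLT_wellFounded⟩
  -- Cells are attached one at a time along a well-order; any one extending the comparison of ranks
  -- will do.
  obtain ⟨r, hr, hr'⟩ := IsWellFounded.exists_well_order_ge (TwistedGen.RankLT (c := c) (d := d))
  let : LinearOrder (TwistedGen c d) := IsWellOrder.linearOrder r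
  have : WellFoundedLT (TwistedGen c d) := hr'.toIsWellFounded
  refine IsSemifree.exists_iCellComplex (gen := TwistedGen.mor (c := c) (d := d))
    ⟨fun Z => TwistedGen.exists_graded, TwistedGen.closure_range_mor, fun γ => ?_⟩
  refine γ.closure_d_mor.mono ?_
  rintro _ ⟨γ', h, rfl⟩
  exact ⟨γ', hr _ _ h, rfl⟩

end SemifreeTensor

theorem mainTheorem7 (k : Type u) [Field k] (C D : DGCat.{u} k) :
    (C.IsCofibrant → D.IsCofibrant → (twistedTensor C D).IsCofibrant) ∧
    (∀ (c : ICellComplex C) (d : ICellComplex D),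
      ∃ (e : ICellComplex (twistedTensor C D)) (φ : e.Gen ≃ TwistedGen c d),
        ∀ γ : e.Gen, e.gen γ = (φ γ).mor) := by
  exact ⟨twistedTensor_isCofibrant, twistedTensor_exists_iCellComplex⟩
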